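/- Let $k$ be a field, $Q$ a quiver with finite vertex set $Q_0$ and finite arrow set $Q_1$, $q\in (k^\times)^{Q_0}$, and $\overline Q$ the double quiver, with arrows $a$ and $a^*$ (opposite to $a$) for $a\in Q_1$, where $(a^*)^*=a$. Put $\epsilon(a)=1$, $\epsilon(a^*)=-1$ for $a\in Q_1$, and fix a total order on $\overline Q_1$. Let $L_Q=k\overline Q[g_a^{-1}]_{a\in\overline Q_1}$ be the universal localization of the path algebra at $g_a=1+aa^*$, let $\rho=\prod_{a\in\overline Q_1} g_a^{\epsilon(a)}$ (ordered product), $r=\rho-q$ with $q=\sum_i q_ie_i\in kQ_0$, and let $\Lambda^q(Q)=L_Q/(r)$ be the multiplicative preprojective algebra. Let $B=kQ_0[t,(q+t)^{-1}]$ and let $\tau:B\to L_Q$ be the algebra map over $kQ_0$ with $\tau(t)=r$. We say that $\Lambda^q(Q)$ has the strong free product property if there is a $kQ_0$-bimodule section $\sigma:\Lambda^q(Q)\to L_Q$ of the quotient map, with $\sigma(1)=1$, such that the linear map $$\sigma':\Lambda^q(Q)*_{kQ_0}B\to L_Q,\qquad a_0b_1a_1\cdots b_na_n\mapsto \sigma(a_0)\tau(b_1)\sigma(a_1)\cdots\tau(b_n)\sigma(a_n)\quad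 (a_i\in\Lambda^q(Q),\ b_i\in tB)$$ is a linear isomorphism. Let $\Lambda^{dg,q}(Q)=L_Q*_{kQ_0}kQ_0[s]$ be the dg multiplicative preprojective algebra: the dg algebra over $kQ_0$ with $L_Q$ in degree $0$, $|s|=-1$, and differential the $kQ_0$-linear graded derivation with $d|_{L_Q}=0$ and $ds=\rho-q$. (1) If $Q$ is connected and contains an unoriented cycle (loops and pairs of arrows joining the same two vertices being cycles of length 1 and 2), then $\Lambda^q(Q)$ has the strong free product property. (2) If $\Lambda^q(Q)$ has the strong free product property, then the homology of $\Lambda^{dg,q}(Q)$ is concentrated in degree $0$, and there is an algebra isomorphism $H_*(\Lambda^{dg,q}(Q))=H_0(\Lambda^{dg,q}(Q))\cong\Lambda^q(Q)$ sending the class of each $x\in L_Q$ to its image in $L_Q/(\rho-q)$. Moreover $\Lambda^{dg,q}(Q)$ is formal: it is connected to its homology algebra (with zero differential) by a zigzag of quasi-isomorphisms of dg algebras over $kQ_0$. In particular, the conclusions of (2) hold whenever $Q$ is connected and contains an unoriented cycle. -/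

import Mathlib

open scoped Polynomial

noncomputable section

namespace MPA

/-! ### Differential graded algebras over a (not necessarily central) base ring `S` -/

/-- A differential `ℤ`-graded `k`-algebra over the `k`-algebra `S` (the image of `S` need not be
central), with cohomological conventions: the differential has degree `+1`, satisfies the graded
Leibniz rule, and kills the image of `S`, which sits in degree `0`. -/
structure DGAlgebra (k : Type*) [Field k] (S : Type*) [Ring S] [Algebra k S] where
  carrier : Type*
  [ring : Ring carrier]
  [algebra : Algebra k carrier]
  grading : ℤ → Submodule k carrier
  gradedMonoid : SetLike.GradedMonoid grading
  isInternal : DirectSum.IsInternal grading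
  unit : S →ₐ[k] carrier
  unit_mem : ∀ s, unit s ∈ grading 0
  d : carrier →ₗ[k] carrier
  d_mem : ∀ (i : ℤ) (x : carrier), x ∈ grading i → d x ∈ grading (i + 1)
  d_d : ∀ x, d (d x) = 0
  d_unit : ∀ s, d (unit s) = 0
  leibniz : ∀ (i : ℤ) (x y : carrier), x ∈ grading i →
    d (x * y) = d x * y + i.negOnePow • (x * d y)

/-- Criterion for a family of submodules to be a direct sum decomposition. -/
theorem isInternal_of_proj {k M : Type*} [Field k] [AddCommGroup M] [Module k M]
    (G : ℤ → Submodule k M) (p : ℤ → M →ₗ[k] M)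
    (h_same : ∀ i x, x ∈ G i → p i x = x) (h_ne : ∀ i j x, x ∈ G i → j ≠ i → p j x = 0)
    (h_top : ⨆ i, G i = ⊤) : DirectSum.IsInternal G := by
  refine DirectSum.isInternal_submodule_of_iSupIndep_of_iSup_eq_top ?_ h_top
  intro i
  rw [Submodule.disjoint_def]
  intro x hx hx'
  have hle : (⨆ j, ⨆ (_ : j ≠ i), G j) ≤ LinearMap.ker (p i) := by
    refine iSup_le fun j => iSup_le fun hj => fun y hy => ?_
    exact h_ne j i y hy (Ne.symm hj)
  rw [← h_same i x hx]
  exact hle hx'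

namespace DGAlgebra

attribute [instance] DGAlgebra.ring DGAlgebra.algebra

variable {k : Type*} [Field k] {S : Type*} [Ring S] [Algebra k S]

section Cohomology

variable (A : DGAlgebra k S)

/-- Projection onto the homogeneous component of degree `i`. -/
def proj (i : ℤ) : A.carrier →ₗ[k] A.carrier :=
  letI := A.isInternal.chooseDecomposition
  (A.grading i).subtype ∘ₗ DirectSum.component k ℤ (fun j => A.grading j) i ∘ₗ
    (DirectSum.decomposeLinearEquiv A.grading).toLinearMap

theorem proj_mem (i : ℤ) (x : A.carrier) : A.proj i x ∈ A.grading i := by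
  simp [proj]

theorem proj_same {i : ℤ} {x : A.carrier} (hx : x ∈ A.grading i) : A.proj i x = x :=
  letI := A.isInternal.chooseDecomposition
  DirectSum.decompose_of_mem_same A.grading hx

theorem proj_ne {i j : ℤ} {x : A.carrier} (hx : x ∈ A.grading i) (hij : i ≠ j) :
    A.proj j x = 0 :=
  letI := A.isInternal.chooseDecomposition
  DirectSum.decompose_of_mem_ne A.grading hx hij

theorem exists_sum_proj (x : A.carrier) : ∃ s : Finset ℤ, ∑ i ∈ s, A.proj i x = x := by
  classical
  let := A.isInternal.chooseDecomposition
  exact ⟨_, DirectSum.sum_support_decompose A.grading x⟩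

theorem homogeneous_induction {P : A.carrier → Prop} (x : A.carrier) (h0 : P 0)
    (hadd : ∀ x y, P x → P y → P (x + y)) (hh : ∀ i x, x ∈ A.grading i → P x) : P x := by
  obtain ⟨s, hs⟩ := A.exists_sum_proj x
  rw [← hs]
  exact Finset.sum_induction _ P hadd h0 fun i _ => hh i _ (A.proj_mem i x)

theorem proj_d (i : ℤ) (x : A.carrier) : A.proj (i + 1) (A.d x) = A.d (A.proj i x) := by
  refine A.homogeneous_induction (P := fun x => A.proj (i + 1) (A.d x) = A.d (A.proj i x)) x
    (by simp) (fun x y hx hy => by simp [hx, hy]) fun j x hx => ?_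
  by_cases h : j = i
  · subst h
    rw [A.proj_same hx, A.proj_same (A.d_mem _ _ hx)]
  · rw [A.proj_ne hx h, A.proj_ne (A.d_mem _ _ hx) (by simpa using h), map_zero]

theorem d_mul_of_cocycle (x : A.carrier) {y : A.carrier} (hy : A.d y = 0) :
    A.d (x * y) = A.d x * y := by
  refine A.homogeneous_induction (P := fun x => A.d (x * y) = A.d x * y) x (by simp)
    (fun a b ha hb => by simp [add_mul, ha, hb]) fun i x hx => ?_
  rw [A.leibniz i x y hx, hy]
  simp

theorem d_proj_of_cocycle {x : A.carrier} (hx : A.d x = 0) (i : ℤ) : A.d (A.proj i x) = 0 := by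
  rw [← A.proj_d, hx, map_zero]

theorem mul_d_of_cocycle {x : A.carrier} (hx : A.d x = 0) (y : A.carrier) :
    ∃ w, A.d w = x * A.d y := by
  obtain ⟨s, hs⟩ := A.exists_sum_proj x
  refine ⟨∑ i ∈ s, i.negOnePow • (A.proj i x * y), ?_⟩
  conv_rhs => rw [← hs, Finset.sum_mul]
  rw [map_sum]
  refine Finset.sum_congr rfl fun i _ => ?_
  have h := A.leibniz i _ y (A.proj_mem i x)
  rw [A.d_proj_of_cocycle hx, zero_mul, zero_add] at h
  rcases Int.even_or_odd i with hi | hi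
  · simpa [Int.negOnePow_even i hi] using h
  · simp [Int.negOnePow_odd i hi, h]

/-- The algebra of cocycles `ker d`. -/
def cocycles : Subalgebra k A.carrier where
  carrier := {x | A.d x = 0}
  mul_mem' := by
    intro x y hx hy
    change A.d (x * y) = 0
    rw [A.d_mul_of_cocycle x hy, show A.d x = 0 from hx, zero_mul]
  add_mem' := by
    intro x y hx hy
    change A.d (x + y) = 0
    rw [map_add, show A.d x = 0 from hx, show A.d y = 0 from hy, add_zero]
  algebraMap_mem' := by
    intro c
    change A.d _ = 0
    rw [Algebra.algebraMap_eq_smul_one, map_smul, ← map_one A.unit, A.d_unit, smul_zero]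

theorem mem_cocycles {x : A.carrier} : x ∈ A.cocycles ↔ A.d x = 0 := Iff.rfl

/-- The ideal `im d` of coboundaries inside the algebra of cocycles. -/
def coboundaries : Ideal A.cocycles where
  carrier := {x | ∃ w, A.d w = x}
  zero_mem' := ⟨0, by simp⟩
  add_mem' := by
    rintro x y ⟨v, hv⟩ ⟨w, hw⟩
    exact ⟨v + w, by simp [hv, hw]⟩
  smul_mem' := by
    rintro c x ⟨w, hw⟩
    obtain ⟨v, hv⟩ := A.mul_d_of_cocycle c.2 w
    exact ⟨v, by rw [hv, hw]; rfl⟩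

theorem mem_coboundaries {x : A.cocycles} : x ∈ A.coboundaries ↔ ∃ w, A.d w = x := Iff.rfl

instance : A.coboundaries.IsTwoSided where
  mul_mem_of_left := by
    rintro x y ⟨w, hw⟩
    exact ⟨w * y, by rw [A.d_mul_of_cocycle w y.2, hw]; rfl⟩

/-- The underlying algebra `ker d / im d` of the cohomology. -/
abbrev H : Type _ := A.cocycles ⧸ A.coboundaries

/-- The class of a cocycle. -/
def toH : A.cocycles →ₐ[k] A.H := Ideal.Quotient.mkₐ k A.coboundaries

theorem toH_surjective : Function.Surjective A.toH := Ideal.Quotient.mkₐ_surjective k _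

theorem toH_eq_zero {x : A.cocycles} : A.toH x = 0 ↔ ∃ w, A.d w = x := by
  rw [toH, Ideal.Quotient.mkₐ_eq_mk, Ideal.Quotient.eq_zero_iff_mem, mem_coboundaries]

/-- The degree `i` part of the cohomology: classes of cocycles of degree `i`. -/
def HGrading (i : ℤ) : Submodule k A.H :=
  ((A.grading i).comap A.cocycles.val.toLinearMap).map A.toH.toLinearMap

theorem mem_HGrading {i : ℤ} {x : A.H} :
    x ∈ A.HGrading i ↔ ∃ z : A.cocycles, (z : A.carrier) ∈ A.grading i ∧ A.toH z = x := Iff.rfl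

/-- Projection of cocycles to a homogeneous component. -/
def cocyclesProj (i : ℤ) : A.cocycles →ₗ[k] A.cocycles :=
  LinearMap.codRestrict (Subalgebra.toSubmodule A.cocycles)
    (A.proj i ∘ₗ A.cocycles.val.toLinearMap) fun z => A.d_proj_of_cocycle z.2 i

/-- Projection of cohomology to a homogeneous component. -/
def HProj (i : ℤ) : A.H →ₗ[k] A.H :=
  (A.coboundaries.restrictScalars k).liftQ (A.toH.toLinearMap ∘ₗ A.cocyclesProj i) (by
    rintro z ⟨w, hw⟩
    refine A.toH_eq_zero.2 ⟨A.proj (i - 1) w, ?_⟩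
    rw [← A.proj_d, hw, sub_add_cancel]
    rfl) ∘ₗ (Submodule.Quotient.restrictScalarsEquiv k A.coboundaries).symm.toLinearMap

theorem HProj_toH (i : ℤ) (z : A.cocycles) : A.HProj i (A.toH z) = A.toH (A.cocyclesProj i z) :=
  rfl

theorem H_isInternal : DirectSum.IsInternal A.HGrading := by
  refine isInternal_of_proj _ A.HProj ?_ ?_ ?_
  · rintro i x ⟨z, hz, rfl⟩
    change A.HProj i (A.toH z) = A.toH z
    rw [HProj_toH]
    congr 1
    exact Subtype.ext (A.proj_same hz)
  · rintro i j x ⟨z, hz, rfl⟩ hij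
    change A.HProj j (A.toH z) = 0
    rw [HProj_toH]
    have : A.cocyclesProj j z = 0 := Subtype.ext (A.proj_ne hz (Ne.symm hij))
    rw [this, map_zero]
  · rw [eq_top_iff]
    rintro x -
    obtain ⟨z, rfl⟩ := A.toH_surjective x
    obtain ⟨s, hs⟩ := A.exists_sum_proj z
    have : z = ∑ i ∈ s, A.cocyclesProj i z := by
      apply Subtype.ext
      conv_lhs => rw [← hs]
      rw [AddSubmonoidClass.coe_finsetSum]
      rfl
    rw [this, map_sum]
    refine Submodule.sum_mem _ fun i _ => Submodule.mem_iSup_of_mem i ?_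
    exact ⟨A.cocyclesProj i z, A.proj_mem i z, rfl⟩

/-- The cohomology of a dg algebra, a graded algebra, as a dg algebra with zero differential. -/
def cohomology : DGAlgebra k S where
  carrier := A.H
  grading := A.HGrading
  gradedMonoid :=
    { one_mem := ⟨1, by simpa using (A.gradedMonoid.one_mem), map_one A.toH⟩
      mul_mem := by
        rintro i j x y ⟨z, hz, rfl⟩ ⟨w, hw, rfl⟩
        exact ⟨z * w, A.gradedMonoid.mul_mem hz hw, map_mul A.toH _ _⟩ }
  isInternal := A.H_isInternal
  unit := A.toH.comp (A.unit.codRestrict A.cocycles fun s => A.d_unit s)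
  unit_mem := fun s => ⟨_, A.unit_mem s, rfl⟩
  d := 0
  d_mem := fun i x _ => by simp
  d_d := fun x => by simp
  d_unit := fun s => by simp
  leibniz := fun i x y _ => by simp

end Cohomology

/-- Morphisms of dg algebras over `S`. -/
structure Hom (A B : DGAlgebra k S) where
  toAlgHom : A.carrier →ₐ[k] B.carrier
  map_grading : ∀ (i : ℤ) (x : A.carrier), x ∈ A.grading i → toAlgHom x ∈ B.grading i
  map_d : ∀ x, toAlgHom (A.d x) = B.d (toAlgHom x)
  map_unit : ∀ s, toAlgHom (A.unit s) = B.unit s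

/-- The map induced on cohomology. -/
def Hom.mapH {A B : DGAlgebra k S} (f : Hom A B) : A.H →ₐ[k] B.H :=
  Ideal.Quotient.liftₐ A.coboundaries
    (B.toH.comp ((f.toAlgHom.comp A.cocycles.val).codRestrict B.cocycles fun z => by
      change B.d (f.toAlgHom z) = 0
      rw [← f.map_d, A.mem_cocycles.1 z.2, map_zero]))
    (by
      rintro z ⟨w, hw⟩
      refine B.toH_eq_zero.2 ⟨f.toAlgHom w, ?_⟩
      rw [← f.map_d, hw]
      rfl)

/-- A morphism is a quasi-isomorphism if it induces an isomorphism on cohomology. -/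
def Hom.IsQuasiIso {A B : DGAlgebra k S} (f : Hom A B) : Prop := Function.Bijective f.mapH

/-- Two dg algebras over `S` are quasi-isomorphic if they are connected by a zigzag of
quasi-isomorphisms of dg algebras over `S`. -/
def QuasiIsomorphic (A B : DGAlgebra k S) : Prop :=
  Relation.EqvGen (fun A B : DGAlgebra k S => ∃ f : Hom A B, f.IsQuasiIso) A B

/-- A dg algebra is formal if it is quasi-isomorphic to its cohomology. -/
def Formal (A : DGAlgebra k S) : Prop := QuasiIsomorphic A A.cohomology

end DGAlgebra

/-! ### Free products amalgamated over a base ring, and quotients by one relation -/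

section FreeProduct

variable {k : Type*} [Field k] {S A B : Type*} [Ring S] [Algebra k S] [Ring A] [Algebra k A]
  [Ring B] [Algebra k B]

/-- The relations defining `A *_S B` on the free algebra on the disjoint union of `A` and `B`. -/
inductive FreeProdRel (f : S →ₐ[k] A) (g : S →ₐ[k] B) :
    FreeAlgebra k (A ⊕ B) → FreeAlgebra k (A ⊕ B) → Prop
  | inl_add (a a' : A) : FreeProdRel f g (FreeAlgebra.ι k (Sum.inl (a + a')))
      (FreeAlgebra.ι k (Sum.inl a) + FreeAlgebra.ι k (Sum.inl a'))
  | inl_mul (a a' : A) : FreeProdRel f g (FreeAlgebra.ι k (Sum.inl (a * a')))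
      (FreeAlgebra.ι k (Sum.inl a) * FreeAlgebra.ι k (Sum.inl a'))
  | inl_algebraMap (c : k) : FreeProdRel f g (FreeAlgebra.ι k (Sum.inl (algebraMap k A c)))
      (algebraMap k _ c)
  | inr_add (b b' : B) : FreeProdRel f g (FreeAlgebra.ι k (Sum.inr (b + b')))
      (FreeAlgebra.ι k (Sum.inr b) + FreeAlgebra.ι k (Sum.inr b'))
  | inr_mul (b b' : B) : FreeProdRel f g (FreeAlgebra.ι k (Sum.inr (b * b')))
      (FreeAlgebra.ι k (Sum.inr b) * FreeAlgebra.ι k (Sum.inr b'))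
  | inr_algebraMap (c : k) : FreeProdRel f g (FreeAlgebra.ι k (Sum.inr (algebraMap k B c)))
      (algebraMap k _ c)
  | amalg (s : S) : FreeProdRel f g (FreeAlgebra.ι k (Sum.inl (f s)))
      (FreeAlgebra.ι k (Sum.inr (g s)))

/-- The free product `A *_S B` of `k`-algebras amalgamated over `S`, i.e. the pushout of `f` and
`g` in the category of `k`-algebras. -/
def FreeProd (f : S →ₐ[k] A) (g : S →ₐ[k] B) : Type _ := RingQuot (FreeProdRel f g)

namespace FreeProd

variable (f : S →ₐ[k] A) (g : S →ₐ[k] B)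

instance : Ring (FreeProd f g) := inferInstanceAs (Ring (RingQuot (FreeProdRel f g)))

instance : Algebra k (FreeProd f g) := inferInstanceAs (Algebra k (RingQuot (FreeProdRel f g)))

/-- The quotient map from the free algebra. -/
def mk : FreeAlgebra k (A ⊕ B) →ₐ[k] FreeProd f g := RingQuot.mkAlgHom k (FreeProdRel f g)

theorem mk_surjective : Function.Surjective (mk f g) := RingQuot.mkAlgHom_surjective k _

variable {f g} in
theorem mk_rel {x y : FreeAlgebra k (A ⊕ B)} (h : FreeProdRel f g x y) : mk f g x = mk f g y :=
  RingQuot.mkAlgHom_rel k h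

/-- The canonical map `A → A *_S B`. -/
def inl : A →ₐ[k] FreeProd f g where
  toFun a := mk f g (FreeAlgebra.ι k (Sum.inl a))
  map_one' := by
    have h := mk_rel (f := f) (g := g) (.inl_algebraMap 1)
    simpa using h
  map_zero' := by
    have h := mk_rel (f := f) (g := g) (.inl_algebraMap 0)
    simpa using h
  map_mul' a a' := by rw [mk_rel (.inl_mul a a'), map_mul]
  map_add' a a' := by rw [mk_rel (.inl_add a a'), map_add]
  commutes' c := by rw [mk_rel (.inl_algebraMap c), AlgHom.commutes]

/-- The canonical map `B → A *_S B`. -/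
def inr : B →ₐ[k] FreeProd f g where
  toFun b := mk f g (FreeAlgebra.ι k (Sum.inr b))
  map_one' := by
    have h := mk_rel (f := f) (g := g) (.inr_algebraMap 1)
    simpa using h
  map_zero' := by
    have h := mk_rel (f := f) (g := g) (.inr_algebraMap 0)
    simpa using h
  map_mul' b b' := by rw [mk_rel (.inr_mul b b'), map_mul]
  map_add' b b' := by rw [mk_rel (.inr_add b b'), map_add]
  commutes' c := by rw [mk_rel (.inr_algebraMap c), AlgHom.commutes]

theorem inl_apply_eq_inr_apply (s : S) : inl f g (f s) = inr f g (g s) := mk_rel (.amalg s)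

variable {f g}

/-- The universal property of `A *_S B`. -/
def lift {T : Type*} [Ring T] [Algebra k T] (φ : A →ₐ[k] T) (ψ : B →ₐ[k] T)
    (h : ∀ s, φ (f s) = ψ (g s)) : FreeProd f g →ₐ[k] T :=
  RingQuot.liftAlgHom k ⟨FreeAlgebra.lift k (Sum.elim φ ψ), by
    intro x y hxy
    induction hxy with
    | amalg s => simpa using h s
    | _ => simp⟩

section
variable {T : Type*} [Ring T] [Algebra k T] (φ : A →ₐ[k] T) (ψ : B →ₐ[k] T)
  (h : ∀ s, φ (f s) = ψ (g s))

@[simp] theorem lift_inl (a : A) : lift φ ψ h (inl f g a) = φ a :=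
  (RingQuot.liftAlgHom_mkAlgHom_apply k _ _ _).trans (by simp)

@[simp] theorem lift_inr (b : B) : lift φ ψ h (inr f g b) = ψ b :=
  (RingQuot.liftAlgHom_mkAlgHom_apply k _ _ _).trans (by simp)

end

theorem induction {P : FreeProd f g → Prop} (h_inl : ∀ a, P (inl f g a))
    (h_inr : ∀ b, P (inr f g b)) (h_add : ∀ x y, P x → P y → P (x + y))
    (h_mul : ∀ x y, P x → P y → P (x * y)) (x : FreeProd f g) : P x := by
  obtain ⟨y, rfl⟩ := mk_surjective f g x
  induction y using FreeAlgebra.induction with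
  | grade0 c =>
    rw [AlgHom.commutes, ← (inl f g).commutes]
    exact h_inl _
  | grade1 z =>
    rcases z with a | b
    · exact h_inl a
    · exact h_inr b
  | mul a b ha hb => rw [map_mul]; exact h_mul _ _ ha hb
  | add a b ha hb => rw [map_add]; exact h_add _ _ ha hb

end FreeProd

/-- The quotient `A / (r)` of `A` by the two-sided ideal generated by `r`. -/
def QuotBy (k : Type*) [Field k] {A : Type*} [Ring A] [Algebra k A] (r : A) : Type _ :=
  RingQuot (fun x y : A => x = r ∧ y = 0)

namespace QuotBy

variable (k) (r : A)

instance : Ring (QuotBy k r) := inferInstanceAs (Ring (RingQuot _))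

instance : Algebra k (QuotBy k r) := inferInstanceAs (Algebra k (RingQuot _))

/-- The quotient map `A → A / (r)`. -/
def mk : A →ₐ[k] QuotBy k r := RingQuot.mkAlgHom k _

end QuotBy

end FreeProduct

/-! ### The dg algebra `A *_S S[s]` with `ds = r` -/

section Koszul

variable {k : Type*} [Field k] {S A : Type*} [CommRing S] [Algebra k S] [Ring A] [Algebra k A]
  (η : S →ₐ[k] A)

/-- The algebra `A *_S S[s]`, where `s` commutes with `S`. -/
abbrev Koszul : Type _ := FreeProd η (Polynomial.CAlgHom : S →ₐ[k] S[X])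

namespace Koszul

/-- The canonical map `A → A *_S S[s]`. -/
def ι : A →ₐ[k] Koszul η := FreeProd.inl _ _

/-- The element `s` of `A *_S S[s]`. -/
def s : Koszul η := FreeProd.inr _ _ Polynomial.X

theorem inr_C (c : S) : FreeProd.inr η (Polynomial.CAlgHom : S →ₐ[k] S[X]) (Polynomial.C c) =
    ι η (η c) :=
  (FreeProd.inl_apply_eq_inr_apply η (Polynomial.CAlgHom : S →ₐ[k] S[X]) c).symm

theorem commute_s (c : S) : Commute (ι η (η c)) (s η) := by
  rw [← inr_C, s, Commute, SemiconjBy, ← map_mul, ← map_mul, mul_comm]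

theorem induction {P : Koszul η → Prop} (h_ι : ∀ a, P (ι η a)) (h_s : P (s η))
    (h_add : ∀ x y, P x → P y → P (x + y)) (h_mul : ∀ x y, P x → P y → P (x * y))
    (x : Koszul η) : P x := by
  refine FreeProd.induction h_ι (fun b => ?_) h_add h_mul x
  induction b using Polynomial.induction_on' with
  | add p q hp hq => rw [map_add]; exact h_add _ _ hp hq
  | monomial n c =>
    rw [← Polynomial.C_mul_X_pow_eq_monomial, map_mul, inr_C, map_pow]
    induction n with
    | zero => simpa using h_ι (η c)
    | succ n ih => rw [pow_succ, ← mul_assoc]; exact h_mul _ _ ih h_s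

/-- The universal property of `A *_S S[s]`. -/
def lift {T : Type*} [Ring T] [Algebra k T] (φ : A →ₐ[k] T) (t : T)
    (h : ∀ c, Commute (φ (η c)) t) : Koszul η →ₐ[k] T :=
  FreeProd.lift φ (Polynomial.eval₂AlgHom (φ.comp η) t h)
    fun _ => (Polynomial.eval₂_C (φ.comp η : S →+* T) t).symm

section
variable {T : Type*} [Ring T] [Algebra k T] (φ : A →ₐ[k] T) (t : T)
  (h : ∀ c, Commute (φ (η c)) t)

@[simp] theorem lift_ι (a : A) : lift η φ t h (ι η a) = φ a := FreeProd.lift_inl _ _ _ a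

@[simp] theorem lift_s : lift η φ t h (s η) = t :=
  (FreeProd.lift_inr _ _ _ _).trans (Polynomial.eval₂_X (φ.comp η : S →+* T) t)

end

/-- `IsWord η n x` means that `x = a₀ s a₁ s ⋯ s aₘ` with `aᵢ ∈ A` and `n = -m`. -/
inductive IsWord : ℤ → Koszul η → Prop
  | base (a : A) : IsWord 0 (ι η a)
  | step (n : ℤ) (x : Koszul η) (a : A) : IsWord n x → IsWord (n - 1) (x * s η * ι η a)

/-- The grading of `A *_S S[s]` with `A` in degree `0` and `s` in degree `-1`. -/
def grading (n : ℤ) : Submodule k (Koszul η) := Submodule.span k {x | IsWord η n x}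

variable {η}

theorem IsWord.mul_ι {n : ℤ} {x : Koszul η} (hx : IsWord η n x) (a : A) :
    IsWord η n (x * ι η a) := by
  cases hx with
  | base b => rw [← map_mul]; exact .base _
  | step m y b hy => rw [mul_assoc, ← map_mul]; exact .step _ _ _ hy

theorem IsWord.mul {m n : ℤ} {x y : Koszul η} (hx : IsWord η m x) (hy : IsWord η n y) :
    IsWord η (m + n) (x * y) := by
  induction hy with
  | base a => rw [add_zero]; exact hx.mul_ι a
  | step n y a hy ih =>
    rw [← add_sub_assoc, ← mul_assoc, ← mul_assoc]
    exact .step _ _ _ ih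

variable (η)

theorem grading_mul {m n : ℤ} {x y : Koszul η} (hx : x ∈ grading η m) (hy : y ∈ grading η n) :
    x * y ∈ grading η (m + n) := by
  induction hx using Submodule.span_induction with
  | mem x hx =>
    induction hy using Submodule.span_induction with
    | mem y hy => exact Submodule.subset_span (IsWord.mul hx hy)
    | zero => simp
    | add y z _ _ h1 h2 => rw [mul_add]; exact add_mem h1 h2
    | smul c y _ h => rw [mul_smul_comm]; exact Submodule.smul_mem _ _ h
  | zero => simp
  | add y z _ _ h1 h2 => rw [add_mul]; exact add_mem h1 h2
  | smul c y _ h => rw [smul_mul_assoc]; exact Submodule.smul_mem _ _ h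

theorem ι_mem (a : A) : ι η a ∈ grading η 0 := Submodule.subset_span (.base a)

theorem s_mem : s η ∈ grading η (-1) := by
  have h : IsWord η (0 - 1) (ι η 1 * s η * ι η 1) := .step 0 _ _ (.base 1)
  rw [map_one, one_mul, mul_one] at h
  exact Submodule.subset_span h

instance gradedMonoid : SetLike.GradedMonoid (grading η) where
  one_mem := by simpa using ι_mem η 1
  mul_mem _ _ _ _ := grading_mul η

theorem iSup_grading : ⨆ n, grading η n = ⊤ := by
  rw [eq_top_iff]
  rintro x -
  refine induction η (P := fun x => x ∈ ⨆ n, grading η n) ?_ ?_ ?_ ?_ x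
  · exact fun a => Submodule.mem_iSup_of_mem 0 (ι_mem η a)
  · exact Submodule.mem_iSup_of_mem _ (s_mem η)
  · exact fun x y => add_mem
  · intro x y hx hy
    refine Submodule.iSup_induction _ (motive := fun x => x * y ∈ ⨆ n, grading η n) hx ?_
      (by simp) (fun a b h1 h2 => by rw [add_mul]; exact add_mem h1 h2)
    intro i x hx
    refine Submodule.iSup_induction _ (motive := fun y => x * y ∈ ⨆ n, grading η n) hy ?_
      (by simp) (fun a b h1 h2 => by rw [mul_add]; exact add_mem h1 h2)
    exact fun j y hy => Submodule.mem_iSup_of_mem _ (grading_mul η hx hy)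

/-- The coaction recording degrees. -/
def coaction : Koszul η →ₐ[k] AddMonoidAlgebra (Koszul η) ℤ :=
  lift η (AddMonoidAlgebra.singleZeroAlgHom.comp (ι η)) (AddMonoidAlgebra.single (-1) (s η)) (by
    intro c
    have h := commute_s η c
    change AddMonoidAlgebra.single 0 (ι η (η c)) * _ = _ * AddMonoidAlgebra.single 0 (ι η (η c))
    rw [AddMonoidAlgebra.single_mul_single, AddMonoidAlgebra.single_mul_single, h.eq, zero_add,
      add_zero])

theorem coaction_ι (a : A) : coaction η (ι η a) = AddMonoidAlgebra.single 0 (ι η a) :=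
  lift_ι η _ _ _ a

theorem coaction_s : coaction η (s η) = AddMonoidAlgebra.single (-1) (s η) :=
  lift_s η _ _ _

theorem coaction_of_isWord {n : ℤ} {x : Koszul η} (hx : IsWord η n x) :
    coaction η x = AddMonoidAlgebra.single n x := by
  induction hx with
  | base a => exact coaction_ι η a
  | step n x a hx ih =>
    rw [map_mul, map_mul, ih, coaction_ι, coaction_s, AddMonoidAlgebra.single_mul_single,
      AddMonoidAlgebra.single_mul_single, add_zero, sub_eq_add_neg]

theorem coaction_of_mem {n : ℤ} {x : Koszul η} (hx : x ∈ grading η n) :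
    coaction η x = AddMonoidAlgebra.single n x := by
  induction hx using Submodule.span_induction with
  | mem x hx => exact coaction_of_isWord η hx
  | zero => simp
  | add y z _ _ h1 h2 => rw [map_add, h1, h2, AddMonoidAlgebra.single_add]
  | smul c y _ h => rw [map_smul, h, AddMonoidAlgebra.smul_single]

theorem isInternal : DirectSum.IsInternal (grading η) := by
  refine isInternal_of_proj _ (fun i => Finsupp.lapply i ∘ₗ
    (AddMonoidAlgebra.coeffLinearEquiv k).toLinearMap ∘ₗ (coaction η).toLinearMap) ?_ ?_
    (iSup_grading η)
  · intro i x hx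
    change (coaction η x).coeff i = x
    rw [coaction_of_mem η hx, AddMonoidAlgebra.coeff_single, Finsupp.single_eq_same]
  · intro i j x hx hij
    change (coaction η x).coeff j = 0
    rw [coaction_of_mem η hx, AddMonoidAlgebra.coeff_single, Finsupp.single_eq_of_ne hij]

/-- The parity automorphism, `x ↦ (-1)^n x` in degree `n`. -/
def parity : Koszul η →ₐ[k] Koszul η :=
  lift η (ι η) (-s η) fun c => (commute_s η c).neg_right

@[simp] theorem parity_ι (a : A) : parity η (ι η a) = ι η a := by simp [parity]

@[simp] theorem parity_s : parity η (s η) = -s η := by simp [parity]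

theorem parity_of_mem {n : ℤ} {x : Koszul η} (hx : x ∈ grading η n) :
    parity η x = n.negOnePow • x := by
  induction hx using Submodule.span_induction with
  | mem x hx =>
    induction hx with
    | base a => simp
    | step n x a hx ih =>
      rw [map_mul, map_mul, ih, parity_s, parity_ι, Int.negOnePow_sub, Int.negOnePow_one]
      simp [Units.smul_def, mul_assoc]
  | zero => simp
  | add y z _ _ h1 h2 => rw [map_add, h1, h2, smul_add]
  | smul c y _ h => rw [map_smul, h, smul_comm]

variable (r : A) (hr : ∀ c, Commute (η c) r)

/-- The algebra map `x ↦ !![(-1)^|x| x, d x; 0, x]` through which the derivation `d` with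
`d s = r` is constructed. -/
def dMatrix : Koszul η →ₐ[k] Matrix (Fin 2) (Fin 2) (Koszul η) :=
  lift η ((Matrix.diagonalAlgHom k).comp ((Pi.constAlgHom k (Fin 2) _).comp (ι η)))
    !![-s η, ι η r; 0, s η] (by
      intro c
      have h := commute_s η c
      have h2 := (hr c).map (ι η)
      ext i j
      fin_cases i <;> fin_cases j <;>
        simp [Matrix.mul_apply, Matrix.diagonal, h.eq, h2.eq])

theorem dMatrix_ι (a : A) : dMatrix η r hr (ι η a) = !![ι η a, 0; 0, ι η a] := by
  refine (lift_ι η _ _ _ a).trans ?_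
  ext i j
  fin_cases i <;> fin_cases j <;> simp [Matrix.diagonal]

theorem dMatrix_s : dMatrix η r hr (s η) = !![-s η, ι η r; 0, s η] :=
  lift_s η _ _ _

/-- The differential: the derivation of degree `+1` with `d s = r` and `d a = 0` for `a ∈ A`. -/
def d : Koszul η →ₗ[k] Koszul η :=
  Matrix.entryLinearMap k _ 0 1 ∘ₗ (dMatrix η r hr).toLinearMap

theorem dMatrix_eq (x : Koszul η) :
    dMatrix η r hr x = !![parity η x, d η r hr x; 0, x] := by
  suffices h : dMatrix η r hr x 0 0 = parity η x ∧ dMatrix η r hr x 1 0 = 0 ∧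
      dMatrix η r hr x 1 1 = x by
    ext i j
    fin_cases i <;> fin_cases j <;> simp [d, h]
  refine induction η (P := fun x => dMatrix η r hr x 0 0 = parity η x ∧
    dMatrix η r hr x 1 0 = 0 ∧ dMatrix η r hr x 1 1 = x) ?_ ?_ ?_ ?_ x
  · intro a; simp [dMatrix_ι]
  · simp [dMatrix_s]
  · rintro x y ⟨h1, h2, h3⟩ ⟨h4, h5, h6⟩
    simp [h1, h2, h3, h4, h5, h6]
  · rintro x y ⟨h1, h2, h3⟩ ⟨h4, h5, h6⟩
    simp [Matrix.mul_apply, Fin.sum_univ_two, h1, h2, h3, h4, h5, h6]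

@[simp] theorem d_ι (a : A) : d η r hr (ι η a) = 0 := by simp [d, dMatrix_ι]

@[simp] theorem d_s : d η r hr (s η) = ι η r := by simp [d, dMatrix_s]

theorem d_mul (x y : Koszul η) :
    d η r hr (x * y) = d η r hr x * y + parity η x * d η r hr y := by
  have h : d η r hr (x * y) = (dMatrix η r hr x * dMatrix η r hr y) 0 1 := by
    rw [← map_mul]; rfl
  rw [h, dMatrix_eq, dMatrix_eq]
  simp [Matrix.mul_apply, Fin.sum_univ_two, add_comm]

theorem parity_parity (x : Koszul η) : parity η (parity η x) = x :=
  induction η (P := fun x => parity η (parity η x) = x) (by simp) (by simp)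
    (fun x y hx hy => by simp [hx, hy]) (fun x y hx hy => by simp [hx, hy]) x

theorem d_parity (x : Koszul η) : d η r hr (parity η x) = -parity η (d η r hr x) :=
  induction η (P := fun x => d η r hr (parity η x) = -parity η (d η r hr x)) (by simp) (by simp)
    (fun x y hx hy => by simp only [map_add, hx, hy]; abel)
    (fun x y hx hy => by
      simp only [map_mul, d_mul, hx, hy, map_add, neg_mul, mul_neg]; abel) x

theorem d_d (x : Koszul η) : d η r hr (d η r hr x) = 0 :=
  induction η (P := fun x => d η r hr (d η r hr x) = 0) (by simp) (by simp)
    (fun x y hx hy => by simp [hx, hy])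
    (fun x y hx hy => by simp [d_mul, hx, hy, d_parity]) x

theorem d_mem {n : ℤ} {x : Koszul η} (hx : x ∈ grading η n) :
    d η r hr x ∈ grading η (n + 1) := by
  induction hx using Submodule.span_induction with
  | mem x hx =>
    induction hx with
    | base a => simp
    | step n x a hx ih =>
      have hxm : x ∈ grading η n := Submodule.subset_span hx
      have h1 : d η r hr x * s η * ι η a ∈ grading η (n + 1 + -1 + 0) :=
        grading_mul η (grading_mul η ih (s_mem η)) (ι_mem η a)
      have h2 : x * ι η r * ι η a ∈ grading η (n + 0 + 0) :=
        grading_mul η (grading_mul η hxm (ι_mem η r)) (ι_mem η a)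
      rw [d_mul, d_ι, mul_zero, add_zero, d_mul, d_s, parity_of_mem η hxm, add_mul,
        show n - 1 + 1 = n by ring]
      refine add_mem (by simpa using h1) ?_
      rw [add_zero, add_zero] at h2
      rcases Int.even_or_odd n with hn | hn
      · simpa [Int.negOnePow_even n hn] using h2
      · simpa [Int.negOnePow_odd n hn] using h2
  | zero => simp
  | add y z _ _ h1 h2 => rw [map_add]; exact add_mem h1 h2
  | smul c y _ h => rw [map_smul]; exact Submodule.smul_mem _ _ h

/-- The dg algebra `A *_S S[s]` over `S`, with `A` in degree `0`, `s` in degree `-1`, and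
differential determined by `d s = r` and `d a = 0` for `a ∈ A`. -/
def dgAlgebra : DGAlgebra k S where
  carrier := Koszul η
  grading := grading η
  gradedMonoid := gradedMonoid η
  isInternal := isInternal η
  unit := (ι η).comp η
  unit_mem c := ι_mem η _
  d := d η r hr
  d_mem _ _ := d_mem η r hr
  d_d := d_d η r hr
  d_unit c := d_ι η r hr _
  leibniz i x y hx := by rw [d_mul, parity_of_mem η hx, smul_mul_assoc]

/-- The map `A → H⁰(A *_S S[s])` sending an element of `A` to its cohomology class. -/
def toCohomology : A →ₐ[k] (dgAlgebra η r hr).cohomology.carrier :=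
  (dgAlgebra η r hr).toH.comp
    ((ι η).codRestrict (dgAlgebra η r hr).cocycles fun a => d_ι η r hr a)

end Koszul

end Koszul

/-! ### The strong free product property -/

section StrongFreeProduct

variable {k : Type*} [Field k] {S A : Type*} [CommRing S] [Algebra k S] [Ring A] [Algebra k A]

/-- The localized polynomial algebra `B = S[t, (q + t)⁻¹]`. -/
abbrev LocPoly (q : S) : Type _ := Localization.Away (Polynomial.C q + Polynomial.X : S[X])

namespace LocPoly

variable (k) in
/-- The canonical map `S → S[t, (q + t)⁻¹]`. -/
def ofBase (q : S) : S →ₐ[k] LocPoly q :=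
  (IsScalarTower.toAlgHom k S[X] (LocPoly q)).comp Polynomial.CAlgHom

/-- The element `t` of `S[t, (q + t)⁻¹]`. -/
def t (q : S) : LocPoly q := algebraMap S[X] (LocPoly q) Polynomial.X

/-- The ideal `t B` of `B = S[t, (q + t)⁻¹]`, which is an `S`-bimodule complement of `S`. -/
def augIdeal (q : S) : Ideal (LocPoly q) := Ideal.span {t q}

variable (η : S →ₐ[k] A) (r : A) (hr : ∀ c, Commute (η c) r) (q : S)

/-- The algebra map `S[t] → A` extending `η : S → A` with `t ↦ r`. -/
def polyMap : S[X] →ₐ[k] A := Polynomial.eval₂AlgHom η r hr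

theorem polyMap_C (c : S) : polyMap η r hr (Polynomial.C c) = η c :=
  Polynomial.eval₂_C (η : S →+* A) r

theorem polyMap_X : polyMap η r hr Polynomial.X = r := Polynomial.eval₂_X (η : S →+* A) r

theorem isUnit_polyMap (hq : IsUnit (η q + r)) 
    (x : Submonoid.powers (Polynomial.C q + Polynomial.X : S[X])) :
    IsUnit (polyMap η r hr x) := by
  obtain ⟨_, n, rfl⟩ := x
  simpa [polyMap_C, polyMap_X] using hq.pow n

variable (hq : IsUnit (η q + r))

/-- The algebra map `τ : S[t, (q + t)⁻¹] → A` extending `η : S → A` with `t ↦ r`. -/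
def toAlg : LocPoly q →ₐ[k] A where
  toRingHom := OreLocalization.universalHom (polyMap η r hr : S[X] →+* A)
    (IsUnit.liftRight ((polyMap η r hr : S[X] →* A).comp (Submonoid.subtype _))
      (isUnit_polyMap η r hr q hq)) (fun _ => rfl)
  commutes' c := (OreLocalization.universalHom_commutes (r := algebraMap k S[X] c) _ _ _).trans
    ((polyMap η r hr).commutes c)

theorem toAlg_algebraMap (p : S[X]) :
    toAlg η r hr q hq (algebraMap S[X] (LocPoly q) p) = polyMap η r hr p :=
  OreLocalization.universalHom_commutes _ _ _

theorem toAlg_ofBase (c : S) : toAlg η r hr q hq (ofBase k q c) = η c :=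
  (toAlg_algebraMap η r hr q hq _).trans (polyMap_C η r hr c)

theorem toAlg_t : toAlg η r hr q hq (t q) = r :=
  (toAlg_algebraMap η r hr q hq _).trans (polyMap_X η r hr)

end LocPoly

variable (η : S →ₐ[k] A) (r : A)

/-- The structure map `S → A / (r)`. -/
def quotUnit : S →ₐ[k] QuotBy k r := (QuotBy.mk k r).comp η

/-- `σ : A / (r) → A` is a unital `S`-bimodule section of the quotient map `A → A / (r)`. -/
structure IsBimoduleSection (σ : QuotBy k r →ₗ[k] A) : Prop where
  section_eq : ∀ x, QuotBy.mk k r (σ x) = x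
  map_one : σ 1 = 1
  map_bimodule : ∀ (c : S) (x : QuotBy k r) (c' : S),
    σ (quotUnit η r c * x * quotUnit η r c') = η c * σ x * η c'

variable (hr : ∀ c, Commute (η c) r) (q : S) (hq : IsUnit (η q + r))

/-- The quadruple `(A, r, σ, B)`, with `B = S[t, (q + t)⁻¹]`, satisfies the strong free product
property: the linear map `σ' : A/(r) *_S B → A` sending an alternating word `a₀ b₁ a₁ ⋯ bₙ aₙ`
with `aᵢ ∈ A/(r)` and `bᵢ ∈ tB` to `σ(a₀) τ(b₁) σ(a₁) ⋯ τ(bₙ) σ(aₙ)` is a linear isomorphism.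
These words span `A/(r) *_S B`, so the displayed formula determines `σ'`. -/
def StrongFreeProductProperty (σ : QuotBy k r →ₗ[k] A) : Prop :=
  ∃ σ' : FreeProd (quotUnit η r) (LocPoly.ofBase k q) →ₗ[k] A,
    (∀ (a₀ : QuotBy k r) (w : List (LocPoly q × QuotBy k r)),
      (∀ p ∈ w, p.1 ∈ LocPoly.augIdeal q) →
        σ' (FreeProd.inl _ _ a₀ *
            (w.map fun p => FreeProd.inr _ _ p.1 * FreeProd.inl _ _ p.2).prod) =
          σ a₀ * (w.map fun p => LocPoly.toAlg η r hr q hq p.1 * σ p.2).prod) ∧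
    Function.Bijective σ'

end StrongFreeProduct

/-! ### Quivers and multiplicative preprojective algebras -/

/-- A quiver with vertex set `Q₀` and arrow set `Q₁`, given by its tail and head maps. -/
structure ArrowQuiver (Q₀ Q₁ : Type*) where
  tail : Q₁ → Q₀
  head : Q₁ → Q₀

namespace ArrowQuiver

variable {Q₀ Q₁ : Type*} (Q : ArrowQuiver Q₀ Q₁)

/-- The quiver is connected (in particular nonempty): its underlying graph is. -/
def Connected : Prop :=
  (SimpleGraph.fromRel fun i j : Q₀ => ∃ a : Q₁, Q.tail a = i ∧ Q.head a = j).Connected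

/-- The quiver contains an unoriented cycle of some length `n + 1 ≥ 1`: distinct vertices
`v₀, …, vₙ` and distinct arrows `a₀, …, aₙ` such that `aᵢ` joins `vᵢ` and `vᵢ₊₁` in one of the two
directions, with indices taken modulo `n + 1`. Loops and pairs of parallel or opposite arrows are
cycles of length `1` and `2`. -/
def ContainsCycle : Prop :=
  ∃ (n : ℕ) (v : Fin (n + 1) → Q₀) (a : Fin (n + 1) → Q₁),
    Function.Injective v ∧ Function.Injective a ∧
      ∀ i, s(Q.tail (a i), Q.head (a i)) = s(v i, v (i + 1))

/-- Tails of the arrows of the double quiver, whose arrow set is `Q₁ ⊕ Q₁`: `Sum.inl a` is the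
arrow `a` and `Sum.inr a` the opposite arrow `a*`. -/
def dtail : Q₁ ⊕ Q₁ → Q₀ := Sum.elim Q.tail Q.head

/-- Heads of the arrows of the double quiver. -/
def dhead : Q₁ ⊕ Q₁ → Q₀ := Sum.elim Q.head Q.tail

end ArrowQuiver

/-- Generators of `L_Q`: the vertex idempotents `eᵢ`, the arrows of the double quiver, and an
inverse of `g_a = 1 + a a*` for each arrow `a` of the double quiver. -/
inductive LGen (Q₀ Q₁ : Type*)
  | vertex (i : Q₀)
  | arrow (a : Q₁ ⊕ Q₁)
  | gInv (a : Q₁ ⊕ Q₁)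

section MultiplicativePreprojective

variable (k : Type*) [Field k] {Q₀ Q₁ : Type*} [Fintype Q₀] (Q : ArrowQuiver Q₀ Q₁)

/-- Defining relations of `L_Q`: the relations of the path algebra of the double quiver, with
paths composed from left to right, and the relations making `gInv a` inverse to `1 + a a*`. -/
inductive LRel : FreeAlgebra k (LGen Q₀ Q₁) → FreeAlgebra k (LGen Q₀ Q₁) → Prop
  | idem (i : Q₀) : LRel (FreeAlgebra.ι k (.vertex i) * FreeAlgebra.ι k (.vertex i))
      (FreeAlgebra.ι k (.vertex i))
  | orth (i j : Q₀) (h : i ≠ j) :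
      LRel (FreeAlgebra.ι k (.vertex i) * FreeAlgebra.ι k (.vertex j)) 0
  | sum_vertex : LRel (∑ i, FreeAlgebra.ι k (.vertex i)) 1
  | tail (a : Q₁ ⊕ Q₁) : LRel (FreeAlgebra.ι k (.vertex (Q.dtail a)) * FreeAlgebra.ι k (.arrow a))
      (FreeAlgebra.ι k (.arrow a))
  | head (a : Q₁ ⊕ Q₁) : LRel (FreeAlgebra.ι k (.arrow a) * FreeAlgebra.ι k (.vertex (Q.dhead a)))
      (FreeAlgebra.ι k (.arrow a))
  | mul_gInv (a : Q₁ ⊕ Q₁) :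
      LRel ((1 + FreeAlgebra.ι k (.arrow a) * FreeAlgebra.ι k (.arrow a.swap)) *
        FreeAlgebra.ι k (.gInv a)) 1
  | gInv_mul (a : Q₁ ⊕ Q₁) :
      LRel (FreeAlgebra.ι k (.gInv a) *
        (1 + FreeAlgebra.ι k (.arrow a) * FreeAlgebra.ι k (.arrow a.swap))) 1

/-- The algebra `L_Q`: the localization of the path algebra of the double quiver of `Q` obtained
by universally inverting all `g_a = 1 + a a*`. -/
def LAlg : Type _ := RingQuot (LRel k Q)

namespace LAlg

instance : Ring (LAlg k Q) := inferInstanceAs (Ring (RingQuot (LRel k Q)))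

instance : Algebra k (LAlg k Q) := inferInstanceAs (Algebra k (RingQuot (LRel k Q)))

/-- The quotient map from the free algebra. -/
def mk : FreeAlgebra k (LGen Q₀ Q₁) →ₐ[k] LAlg k Q := RingQuot.mkAlgHom k (LRel k Q)

variable {k Q} in
theorem mk_rel {x y : FreeAlgebra k (LGen Q₀ Q₁)} (h : LRel k Q x y) : mk k Q x = mk k Q y :=
  RingQuot.mkAlgHom_rel k h

/-- The vertex idempotent `eᵢ`. -/
def e (i : Q₀) : LAlg k Q := mk k Q (FreeAlgebra.ι k (.vertex i))

/-- An arrow of the double quiver as an element of `L_Q`. -/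
def x (a : Q₁ ⊕ Q₁) : LAlg k Q := mk k Q (FreeAlgebra.ι k (.arrow a))

/-- The element `g_a⁻¹`. -/
def gInv (a : Q₁ ⊕ Q₁) : LAlg k Q := mk k Q (FreeAlgebra.ι k (.gInv a))

/-- The element `g_a = 1 + a a*`. -/
def g (a : Q₁ ⊕ Q₁) : LAlg k Q := 1 + x k Q a * x k Q a.swap

theorem e_mul_self (i : Q₀) : e k Q i * e k Q i = e k Q i := by
  simpa [e] using mk_rel (.idem (k := k) (Q := Q) i)

theorem e_mul_ne {i j : Q₀} (h : i ≠ j) : e k Q i * e k Q j = 0 := by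
  simpa [e] using mk_rel (.orth (k := k) (Q := Q) i j h)

theorem sum_e : ∑ i, e k Q i = 1 := by
  simpa [e] using mk_rel (.sum_vertex (k := k) (Q := Q))

theorem e_tail_mul (a : Q₁ ⊕ Q₁) : e k Q (Q.dtail a) * x k Q a = x k Q a := by
  simpa [e, x] using mk_rel (.tail (k := k) (Q := Q) a)

theorem mul_e_head (a : Q₁ ⊕ Q₁) : x k Q a * e k Q (Q.dhead a) = x k Q a := by
  simpa [e, x] using mk_rel (.head (k := k) (Q := Q) a)

theorem g_mul_gInv (a : Q₁ ⊕ Q₁) : g k Q a * gInv k Q a = 1 := by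
  simpa [g, x, gInv] using mk_rel (.mul_gInv (k := k) (Q := Q) a)

theorem gInv_mul_g (a : Q₁ ⊕ Q₁) : gInv k Q a * g k Q a = 1 := by
  simpa [g, x, gInv] using mk_rel (.gInv_mul (k := k) (Q := Q) a)

/-- `g_a^{ε(a)}`, with `ε = 1` on the arrows of `Q` and `ε = -1` on the opposite arrows. -/
def gPow : Q₁ ⊕ Q₁ → LAlg k Q
  | .inl a => g k Q (.inl a)
  | .inr a => gInv k Q (.inr a)

theorem isUnit_gPow (a : Q₁ ⊕ Q₁) : IsUnit (gPow k Q a) := by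
  rcases a with a | a
  · exact ⟨⟨_, _, g_mul_gInv k Q _, gInv_mul_g k Q _⟩, rfl⟩
  · exact ⟨⟨_, _, gInv_mul_g k Q _, g_mul_gInv k Q _⟩, rfl⟩

/-- The structure map from `kQ₀`, the algebra of functions on the vertices, to `L_Q`. -/
def ofBase : (Q₀ → k) →ₐ[k] LAlg k Q :=
  AlgHom.ofLinearMap (∑ i, (LinearMap.toSpanSingleton k _ (e k Q i)).comp (LinearMap.proj i))
    (by simpa using sum_e k Q)
    (by
      classical
      intro c c'
      simp only [LinearMap.coe_sum, LinearMap.coe_comp, Finset.sum_apply, Function.comp_apply,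
        LinearMap.proj_apply, LinearMap.toSpanSingleton_apply, Pi.mul_apply, Finset.sum_mul_sum]
      refine Finset.sum_congr rfl fun i _ => ?_
      rw [Finset.sum_eq_single i (fun j _ hj => by
        rw [smul_mul_smul_comm, e_mul_ne k Q (Ne.symm hj), smul_zero]) (by simp)]
      rw [smul_mul_smul_comm, e_mul_self])

theorem ofBase_apply (c : Q₀ → k) : ofBase k Q c = ∑ i, c i • e k Q i := by
  simp [ofBase]

theorem ofBase_mul_x (c : Q₀ → k) (a : Q₁ ⊕ Q₁) :
    ofBase k Q c * x k Q a = c (Q.dtail a) • x k Q a := by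
  rw [ofBase_apply, Finset.sum_mul, Finset.sum_eq_single (Q.dtail a)]
  · rw [smul_mul_assoc, e_tail_mul]
  · intro j _ hj
    rw [← e_tail_mul k Q a, smul_mul_assoc, ← mul_assoc, e_mul_ne k Q hj, zero_mul, smul_zero]
  · simp

theorem x_mul_ofBase (c : Q₀ → k) (a : Q₁ ⊕ Q₁) :
    x k Q a * ofBase k Q c = c (Q.dhead a) • x k Q a := by
  rw [ofBase_apply, Finset.mul_sum, Finset.sum_eq_single (Q.dhead a)]
  · rw [mul_smul_comm, mul_e_head]
  · intro j _ hj
    rw [← mul_e_head k Q a, mul_smul_comm, mul_assoc, e_mul_ne k Q (Ne.symm hj), mul_zero,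
      smul_zero]
  · simp

theorem commute_g (c : Q₀ → k) (a : Q₁ ⊕ Q₁) : Commute (ofBase k Q c) (g k Q a) := by
  refine (Commute.one_right _).add_right ?_
  rw [Commute, SemiconjBy, ← mul_assoc, ofBase_mul_x, mul_assoc, x_mul_ofBase, smul_mul_assoc,
    mul_smul_comm]
  rcases a with a | a <;> rfl

theorem commute_gPow (c : Q₀ → k) (a : Q₁ ⊕ Q₁) : Commute (ofBase k Q c) (gPow k Q a) := by
  rcases a with a | a
  · exact commute_g k Q c _
  · exact Commute.units_inv_right (u := ⟨_, _, g_mul_gInv k Q (.inr a), gInv_mul_g k Q _⟩)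
      (commute_g k Q c _)

variable [Fintype Q₁] [LinearOrder (Q₁ ⊕ Q₁)]

/-- The product `ρ` of the `g_a^{ε(a)}` over the arrows of the double quiver, taken in increasing
order from left to right. -/
def rho : LAlg k Q :=
  (((Finset.univ : Finset (Q₁ ⊕ Q₁)).sort (· ≤ ·)).map (gPow k Q)).prod

theorem isUnit_rho : IsUnit (rho k Q) := by
  refine List.prod_isUnit fun y hy => ?_
  obtain ⟨a, -, rfl⟩ := List.mem_map.1 hy
  exact isUnit_gPow k Q a

theorem commute_rho (c : Q₀ → k) : Commute (ofBase k Q c) (rho k Q) := by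
  refine Commute.list_prod_right _ _ fun y hy => ?_
  obtain ⟨a, -, rfl⟩ := List.mem_map.1 hy
  exact commute_gPow k Q c a

end LAlg

variable {k} [Fintype Q₁] [LinearOrder (Q₁ ⊕ Q₁)] (q : Q₀ → kˣ)

/-- The parameter `q` as the element `∑ qᵢ eᵢ` of `kQ₀`. -/
def qElt : Q₀ → k := fun i => q i

/-- The multiplicative preprojective relation `r = ρ - q` in `L_Q`. -/
def mpaRel : LAlg k Q := LAlg.rho k Q - LAlg.ofBase k Q (qElt q)

theorem commute_mpaRel (c : Q₀ → k) : Commute (LAlg.ofBase k Q c) (mpaRel Q q) :=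
  (LAlg.commute_rho k Q c).sub_right ((Commute.all c (qElt q)).map (LAlg.ofBase k Q))

theorem isUnit_q_add_mpaRel : IsUnit (LAlg.ofBase k Q (qElt q) + mpaRel Q q) := by
  rw [mpaRel, add_sub_cancel]
  exact LAlg.isUnit_rho k Q

/-- The multiplicative preprojective algebra `Λ^q(Q) = L_Q / (ρ - q)`. -/
abbrev MPAlg : Type _ := QuotBy k (mpaRel Q q)

/-- `Λ^q(Q)` satisfies the strong free product property: `(L_Q, ρ - q, σ, kQ₀[t, (q + t)⁻¹])` does
for some choice of the `kQ₀`-bimodule section `σ : Λ^q(Q) → L_Q`. -/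
def MPAStrongFreeProduct : Prop :=
  ∃ σ : MPAlg Q q →ₗ[k] LAlg k Q, IsBimoduleSection (LAlg.ofBase k Q) (mpaRel Q q) σ ∧
    StrongFreeProductProperty (LAlg.ofBase k Q) (mpaRel Q q) (commute_mpaRel Q q) (qElt q)
      (isUnit_q_add_mpaRel Q q) σ

/-- The dg multiplicative preprojective algebra `L_Q *_{kQ₀} kQ₀[s]` over `kQ₀`, with
`ds = ρ - q`. -/
def dgMPA : DGAlgebra k (Q₀ → k) :=
  Koszul.dgAlgebra (LAlg.ofBase k Q) (mpaRel Q q) (commute_mpaRel Q q)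

/-- The map `L_Q → H⁰` sending an element of `L_Q` to its class in the cohomology of the dg
multiplicative preprojective algebra. -/
def classMap : LAlg k Q →ₐ[k] (dgMPA Q q).cohomology.carrier :=
  Koszul.toCohomology (LAlg.ofBase k Q) (mpaRel Q q) (commute_mpaRel Q q)

end MultiplicativePreprojective

end MPA

end

/-!
The multiplicative preprojective algebra `Λ` of a connected quiver with a cycle is `A/(r)` for
`A = L_Q`, an algebra over `S = k^{Q₀}`, and `r = ρ - q`. Tensor products over `S` are avoided by
means of its separability idempotent.

**From the free product property to homology.** Left Fox differentiation with respect to `t` on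
`Λ *_S B`, where `B = S[t, (q + t)⁻¹]`, singles out the first `t` of a word. Transported along an
isomorphism `Λ *_S B ≅ A`, it says that `A = σ(Λ) ⊕ σ(Λ) r A` and that there is a linear map `φ` on
`A` killing `σ(Λ)` and sending `σ(a) r x` to `σ(a) s x`
(`StrongFreeProductProperty.exists_homotopy`). Acting on the part of a word before the first `s`,
`φ` extends to all of `A *_S S[s]`, and the extension is a contracting homotopy from the identity
to the projection `σ ∘ aug`, where `aug` is the augmentation onto `Λ`
(`Koszul.exists_contraction`). Therefore `aug` induces an isomorphism from the cohomology onto `Λ`,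
placed in degree `0`, and is itself the quasi-isomorphism that proves formality
(`StrongFreeProductProperty.homology`).

**From a basis of words to the free product property.** Suppose that `A` has a basis of words in
some letters, among them letters `T i n` of value `eᵢ (ρⁿ - qᵢⁿ)`, such that the only condition on
a word involving these letters is that they are not adjacent (`WordBasis`). The words without
letters `T` then represent a basis of `Λ`, those containing one span the ideal `(r)`, and a basis
word is an alternating product of elements of `Λ` and of `tB`. To avoid normal forms in free
products, `Λ` is made to act on `A` through the part of a word before the first `T`, which yields
an action of `Λ *_S B` on `A`; acting on `1` is the map in question, and its inverse sends a basis
word to the same word in the free product (`WordBasis.strongFreeProductProperty`).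

**A basis of words for `L_Q`.** In a connected quiver with a cycle, every vertex `i` can be
assigned an arrow `d i` so that following these arrows leads into the cycle
(`ArrowQuiver.nonempty_flow`). Reversing arrows, which only replaces a generator `a` by
`-a (1 + a* a)⁻¹`, one may assume that `d i` leaves `i`. The equation "`ρ` has component `ρᵢ` at
`i`" can be solved for `1 + c s`, where `c` and `s` are the two arrows over `d i`. Off the cycle
the solution is recursive; on the cycle it says that `1 + c s = γ u`, where `u` is a conjugate, by
some `β`, of the element `1 + s c` of the preceding edge. Thus the powers of the `ρᵢ`, of the
`1 + c s` on the remaining edges, and of the elements `u` on the cycle, together with the arrows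
themselves, serve as letters, and a word is normal if certain pairs are not adjacent
(`Frame.Forbidden`).

Instead of proving confluence of a rewriting system, the vector space `V` with basis the normal
words is given operators for all arrows that satisfy the relations (`Frame.prod_opArrow`). The
delicate point is the cycle, where the operator for `s` must intertwine `γ u` with the next `u`: it
is built by a two-sided recursion along the powers of `u`, which is possible because `γ` acts as a
nonzero scalar modulo words on which `s` simply prepends a letter (`Frame.tameGroup`,
`Frame.eq_zero_of_cycle`). Then `L_Q` acts on `V^{Q₀}`. Evaluating words in `L_Q` is equivariant,
so the normal words span (`Realization.span_wordVal_eq_top`); acting on empty words recovers the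
word, so they are linearly independent (`Realization.linearIndependent_wordVal`).
-/

noncomputable section

namespace MPA

/-! ### Separability of `k^I` and the algebra `S[t, (q + t)⁻¹]` -/

section

open scoped TensorProduct

section Separability

variable {k : Type*} [Field k] {I : Type*} [Fintype I] {X Y : Type*} [Ring X] [Algebra k X]
  [Ring Y] [Algebra k Y]

/-- The `i`-th primitive idempotent of `k^I`. -/
def idem (k : Type*) [Field k] {I : Type*} (i : I) : I → k :=
  letI := Classical.decEq I
  Pi.single i 1

theorem sum_idem : ∑ i, idem k i = (1 : I → k) := by
  classical
  ext j
  simp [idem, Pi.single_apply]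

omit [Fintype I] in
theorem mul_idem (c : I → k) (i : I) : c * idem k i = c i • idem k i := by
  classical
  ext j
  by_cases h : j = i
  · subst h; simp [idem]
  · simp [idem, h]

/-- Left multiplication of `y` by the separability idempotent `∑ eᵢ ⊗ eᵢ` of `k^I`. -/
def sepMap (u : (I → k) →ₐ[k] X) (v : (I → k) →ₐ[k] Y) : Y →ₗ[k] X ⊗[k] Y :=
  ∑ i, (TensorProduct.mk k X Y (u (idem k i))).comp (LinearMap.mulLeft k (v (idem k i)))

variable (u : (I → k) →ₐ[k] X) (v : (I → k) →ₐ[k] Y)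

theorem sepMap_apply (y : Y) : sepMap u v y = ∑ i, u (idem k i) ⊗ₜ[k] (v (idem k i) * y) := by
  simp [sepMap]

/-- The separability idempotent intertwines the actions of `k^I` on the two tensor factors, which
makes `sepMap` induce a section of `X ⊗ Y → X ⊗_{k^I} Y`. This replaces tensor products over `k^I`.
-/
theorem rTensor_sepMap (c : I → k) (y : Y) :
    (LinearMap.mulLeft k (u c)).rTensor Y (sepMap u v y) = sepMap u v (v c * y) := by
  simp only [sepMap_apply, map_sum, LinearMap.rTensor_tmul, LinearMap.mulLeft_apply, ← map_mul,
    ← mul_assoc]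
  refine Finset.sum_congr rfl fun i _ => ?_
  rw [mul_comm (idem k i) c, mul_idem, map_smul, map_smul, smul_mul_assoc, TensorProduct.smul_tmul]

end Separability

namespace LocPoly

variable {k : Type*} [Field k] {S : Type*} [CommRing S] [Algebra k S] {q : S}

theorem isUnit_base_add_t (q : S) : IsUnit (ofBase k q q + t q) := by
  have h := IsLocalization.Away.algebraMap_isUnit (S := LocPoly q)
    (Polynomial.C q + Polynomial.X : S[X])
  rw [map_add] at h
  exact h

theorem t_mem (q : S) : t q ∈ augIdeal q := Ideal.mem_span_singleton_self _

theorem exists_mul_pow (b : LocPoly q) :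
    ∃ (p : S[X]) (n : ℕ), b * (ofBase k q q + t q) ^ n = algebraMap S[X] (LocPoly q) p := by
  obtain ⟨⟨p, ⟨_, n, rfl⟩⟩, h⟩ := IsLocalization.surj
    (Submonoid.powers (Polynomial.C q + Polynomial.X : S[X])) b
  refine ⟨p, n, ?_⟩
  rw [← h]
  simp only [map_pow, map_add]
  rfl

/-- If `q` is invertible, then `S[t, (q + t)⁻¹] = S + t S[t, (q + t)⁻¹]`. -/
theorem exists_sub_mem (hq : IsUnit q) (b : LocPoly q) :
    ∃ c : S, b - ofBase k q c ∈ augIdeal q := by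
  obtain ⟨p, n, h⟩ := exists_mul_pow (k := k) b
  obtain ⟨q', hq'⟩ := (hq.pow n).exists_right_inv
  refine ⟨q' * p.coeff 0, ?_⟩
  rw [← Ideal.Quotient.eq]
  have h1 := congrArg (Ideal.Quotient.mk (augIdeal q)) h
  have ht : Ideal.Quotient.mk (augIdeal q) (t q) = 0 :=
    Ideal.Quotient.eq_zero_iff_mem.2 (t_mem q)
  have hp : Ideal.Quotient.mk (augIdeal q) (algebraMap S[X] (LocPoly q) p) =
      Ideal.Quotient.mk (augIdeal q) (ofBase k q (p.coeff 0)) := by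
    conv_lhs => rw [← Polynomial.divX_mul_X_add p]
    rw [map_add, map_add, map_mul, map_mul]
    change _ * Ideal.Quotient.mk (augIdeal q) (t q) + _ = _
    rw [ht, mul_zero, zero_add]
    rfl
  rw [hp, map_mul, map_pow, map_add, ht, add_zero, ← map_pow, ← map_pow] at h1
  have h2 : ofBase k q (q ^ n) * ofBase k q q' = 1 := by rw [← map_mul, hq', map_one]
  have h3 : Ideal.Quotient.mk (augIdeal q) b *
      (Ideal.Quotient.mk (augIdeal q) (ofBase k q (q ^ n)) *
        Ideal.Quotient.mk (augIdeal q) (ofBase k q q')) = Ideal.Quotient.mk (augIdeal q) b := by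
    rw [← map_mul, h2, map_one, mul_one]
  rw [← h3, ← mul_assoc, h1, ← map_mul, ← map_mul, mul_comm]

end LocPoly

section Words

variable {k : Type*} [Field k] {S A : Type*} [CommRing S] [Algebra k S] [Ring A] [Algebra k A]
  (η : S →ₐ[k] A) (r : A) (q : S)

/-- The alternating words `a₀ b₁ a₁ ⋯ bₙ aₙ` with `bᵢ ∈ tB`. -/
def altWord (a₀ : QuotBy k r) (w : List (LocPoly q × QuotBy k r)) :
    FreeProd (quotUnit η r) (LocPoly.ofBase k q) :=
  FreeProd.inl _ _ a₀ * (w.map fun p => FreeProd.inr _ _ p.1 * FreeProd.inl _ _ p.2).prod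

theorem altWord_nil (a₀ : QuotBy k r) : altWord η r q a₀ [] = FreeProd.inl _ _ a₀ := by
  simp [altWord]

theorem altWord_cons (a₀ : QuotBy k r) (b : LocPoly q) (a₁ : QuotBy k r)
    (w : List (LocPoly q × QuotBy k r)) :
    altWord η r q a₀ ((b, a₁) :: w) =
      FreeProd.inl _ _ a₀ * (FreeProd.inr _ _ b * altWord η r q a₁ w) := by
  simp [altWord, mul_assoc]

/-- Since `S[t, (q + t)⁻¹] = S + t S[t, (q + t)⁻¹]`, the free product is spanned by the alternating
words with `bᵢ ∈ tB`. -/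
theorem span_altWord (hq : IsUnit q) :
    Submodule.span k {x | ∃ a₀ w, (∀ p ∈ w, p.1 ∈ LocPoly.augIdeal q) ∧
      x = altWord η r q a₀ w} = ⊤ := by
  set M := Submodule.span k {x | ∃ a₀ w, (∀ p ∈ w, p.1 ∈ LocPoly.augIdeal q) ∧
      x = altWord η r q a₀ w} with hM
  have hl : ∀ a, ∀ x ∈ M, FreeProd.inl _ _ a * x ∈ M := by
    intro a x hx
    induction hx using Submodule.span_induction with
    | mem x hx =>
      obtain ⟨a₀, w, hw, rfl⟩ := hx
      refine Submodule.subset_span ⟨a * a₀, w, hw, ?_⟩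
      rw [altWord, altWord, map_mul, mul_assoc]
    | zero => simp
    | add y z _ _ h1 h2 => rw [mul_add]; exact add_mem h1 h2
    | smul c y _ h => rw [mul_smul_comm]; exact Submodule.smul_mem _ _ h
  have hr' : ∀ b ∈ LocPoly.augIdeal q, ∀ x ∈ M, FreeProd.inr _ _ b * x ∈ M := by
    intro b hb x hx
    induction hx using Submodule.span_induction with
    | mem x hx =>
      obtain ⟨a₀, w, hw, rfl⟩ := hx
      refine Submodule.subset_span ⟨1, (b, a₀) :: w, ?_, ?_⟩
      · simpa using ⟨hb, fun a b h => hw (a, b) h⟩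
      · rw [altWord_cons, map_one, one_mul]
    | zero => simp
    | add y z _ _ h1 h2 => rw [mul_add]; exact add_mem h1 h2
    | smul c y _ h => rw [mul_smul_comm]; exact Submodule.smul_mem _ _ h
  have key : ∀ f, ∀ x ∈ M, f * x ∈ M := by
    intro f
    refine FreeProd.induction (P := fun f => ∀ x ∈ M, f * x ∈ M) hl ?_ ?_ ?_ f
    · intro b x hx
      obtain ⟨c, hc⟩ := LocPoly.exists_sub_mem (k := k) hq b
      have : FreeProd.inr (quotUnit η r) (LocPoly.ofBase k q) b * x =
          FreeProd.inr _ _ (b - LocPoly.ofBase k q c) * x +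
            FreeProd.inl _ _ (quotUnit η r c) * x := by
        rw [FreeProd.inl_apply_eq_inr_apply, ← add_mul, ← map_add, sub_add_cancel]
      rw [this]
      exact add_mem (hr' _ hc x hx) (hl _ x hx)
    · intro x y hx hy z hz
      rw [add_mul]; exact add_mem (hx z hz) (hy z hz)
    · intro x y hx hy z hz
      rw [mul_assoc]; exact hx _ (hy z hz)
  rw [eq_top_iff]
  rintro f -
  have h1 : (1 : FreeProd (quotUnit η r) (LocPoly.ofBase k q)) ∈ M :=
    Submodule.subset_span ⟨1, [], by simp, by simp [altWord]⟩
  simpa using key f 1 h1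

end Words

end

/-! ### The Fox derivative on the free product -/

section

open scoped TensorProduct

section Homotopy

variable {k : Type*} [Field k] {I : Type*} [Fintype I] {A : Type*} [Ring A] [Algebra k A]
  (η : (I → k) →ₐ[k] A) (r : A) (hr : ∀ c, Commute (η c) r) (q : I → k)

/-- The free product `A/(r) *_S S[t, (q + t)⁻¹]`. -/
abbrev QuotFreeProd : Type _ := FreeProd (quotUnit η r) (LocPoly.ofBase k q)

/-- The target `A/(r) ⊗ (A/(r) *_S B)` of the Fox derivative. -/
abbrev FoxTarget : Type _ := QuotBy k r ⊗[k] QuotFreeProd η r q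

/-- The element `t` of the free product. -/
def tF : QuotFreeProd η r q := FreeProd.inr _ _ (LocPoly.t q)

/-- `A/(r)` acts diagonally on `FoxTarget × (A/(r) *_S B)`. -/
def foxInl : QuotBy k r →ₐ[k] Module.End k (FoxTarget η r q × QuotFreeProd η r q) :=
  (LinearMap.prodMapAlgHom k _ _).comp
    (((Module.End.rTensorAlgHom k (QuotBy k r) (QuotFreeProd η r q)).comp
      (Algebra.lmul k (QuotBy k r))).prod
      ((Algebra.lmul k (QuotFreeProd η r q)).comp (FreeProd.inl _ _)))

omit [Fintype I] in
theorem foxInl_apply (a : QuotBy k r) (n : FoxTarget η r q) (f : QuotFreeProd η r q) :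
    foxInl η r q a (n, f) =
      ((LinearMap.mulLeft k a).rTensor _ n, FreeProd.inl _ _ a * f) := rfl

/-- The structure map of `S = k^I` into the free product. -/
def baseF : (I → k) →ₐ[k] QuotFreeProd η r q := (FreeProd.inl _ _).comp (quotUnit η r)

/-- `t` acts on `FoxTarget × (A/(r) *_S B)` by `(n, f) ↦ (∑ eᵢ ⊗ eᵢ f, t f)`. -/
def foxT : Module.End k (FoxTarget η r q × QuotFreeProd η r q) :=
  ((sepMap (quotUnit η r) (baseF η r q)).prod (LinearMap.mulLeft k (tF η r q))).comp
    (LinearMap.snd k _ _)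

theorem foxT_apply (n : FoxTarget η r q) (f : QuotFreeProd η r q) :
    foxT η r q (n, f) = (sepMap (quotUnit η r) (baseF η r q) f, tF η r q * f) := rfl

omit [Fintype I] in
theorem commute_baseF_tF (c : I → k) : Commute (baseF η r q c) (tF η r q) := by
  have h : baseF η r q c = FreeProd.inr _ _ (LocPoly.ofBase k q c) :=
    FreeProd.inl_apply_eq_inr_apply _ _ c
  rw [h, tF, Commute, SemiconjBy, ← map_mul, ← map_mul, mul_comm]

theorem commute_fox (c : I → k) :
    Commute ((foxInl η r q).comp (quotUnit η r) c) (foxT η r q) := by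
  refine LinearMap.ext fun ⟨n, f⟩ => ?_
  rw [Module.End.mul_apply, Module.End.mul_apply, AlgHom.comp_apply, foxT_apply, foxInl_apply,
    foxInl_apply, foxT_apply, rTensor_sepMap]
  refine Prod.ext rfl ?_
  change baseF η r q c * (tF η r q * f) = tF η r q * (baseF η r q c * f)
  rw [← mul_assoc, (commute_baseF_tF η r q c).eq, mul_assoc]

omit [Fintype I] in
theorem isUnit_baseF_add_tF : IsUnit (baseF η r q q + tF η r q) := by
  have h := (LocPoly.isUnit_base_add_t (k := k) q).map
    (FreeProd.inr (quotUnit η r) (LocPoly.ofBase k q))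
  rw [map_add, ← FreeProd.inl_apply_eq_inr_apply] at h
  exact h

/-- The operator by which `q + t` acts is block triangular, with the invertible diagonal blocks `q`
and `q + t`. -/
theorem isUnit_fox (hq : IsUnit q) :
    IsUnit ((foxInl η r q).comp (quotUnit η r) q + foxT η r q) := by
  obtain ⟨u, hu⟩ := isUnit_baseF_add_tF η r q
  obtain ⟨q', hq'⟩ := hq.exists_right_inv
  have hq1 : quotUnit η r q * quotUnit η r q' = 1 := by rw [← map_mul, hq', map_one]
  have hq2 : quotUnit η r q' * quotUnit η r q = 1 := by rw [← map_mul, mul_comm, hq', map_one]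
  have happ : ∀ n f, ((foxInl η r q).comp (quotUnit η r) q + foxT η r q) (n, f) =
      ((LinearMap.mulLeft k (quotUnit η r q)).rTensor _ n +
        sepMap (quotUnit η r) (baseF η r q) f, (u : QuotFreeProd η r q) * f) := by
    intro n f
    rw [LinearMap.add_apply, AlgHom.comp_apply, foxInl_apply, foxT_apply, hu, add_mul]
    rfl
  have hL : ∀ n : FoxTarget η r q, (LinearMap.mulLeft k (quotUnit η r q)).rTensor _
      ((LinearMap.mulLeft k (quotUnit η r q')).rTensor _ n) = n := by
    intro n
    rw [← LinearMap.comp_apply, ← LinearMap.rTensor_comp, ← LinearMap.mulLeft_mul, hq1,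
      LinearMap.mulLeft_one, LinearMap.rTensor_id, LinearMap.id_apply]
  have hL' : ∀ n : FoxTarget η r q, (LinearMap.mulLeft k (quotUnit η r q')).rTensor _
      ((LinearMap.mulLeft k (quotUnit η r q)).rTensor _ n) = n := by
    intro n
    rw [← LinearMap.comp_apply, ← LinearMap.rTensor_comp, ← LinearMap.mulLeft_mul, hq2,
      LinearMap.mulLeft_one, LinearMap.rTensor_id, LinearMap.id_apply]
  rw [Module.End.isUnit_iff]
  constructor
  · rintro ⟨n, f⟩ ⟨n', f'⟩ h
    rw [happ, happ, Prod.mk.injEq] at h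
    have hf : f = f' := by simpa using h.2
    subst hf
    have h1 := add_right_cancel h.1
    rw [← hL' n, h1, hL']
  · rintro ⟨n, f⟩
    refine ⟨((LinearMap.mulLeft k (quotUnit η r q')).rTensor _
      (n - sepMap (quotUnit η r) (baseF η r q) (↑u⁻¹ * f)), ↑u⁻¹ * f), ?_⟩
    rw [happ, hL, sub_add_cancel, Units.mul_inv_cancel_left]

variable (hq : IsUnit q)

/-- The action of `A/(r) *_S B` on `FoxTarget × (A/(r) *_S B)` encoding the left Fox derivative
with respect to `t`. -/
def foxRep : QuotFreeProd η r q →ₐ[k] Module.End k (FoxTarget η r q × QuotFreeProd η r q) :=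
  FreeProd.lift (foxInl η r q)
    (LocPoly.toAlg ((foxInl η r q).comp (quotUnit η r)) (foxT η r q) (commute_fox η r q) q
      (isUnit_fox η r q hq))
    fun c => (LocPoly.toAlg_ofBase _ _ (commute_fox η r q) q (isUnit_fox η r q hq) c).symm

theorem foxRep_inl (a : QuotBy k r) :
    foxRep η r q hq (FreeProd.inl _ _ a) = foxInl η r q a := FreeProd.lift_inl _ _ _ a

theorem foxRep_tF : foxRep η r q hq (tF η r q) = foxT η r q :=
  (FreeProd.lift_inr _ _ _ _).trans (LocPoly.toAlg_t _ _ _ _ _)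

/-- On the second component `foxRep` is left multiplication; the first component is a cocycle. -/
theorem foxRep_snd (x : QuotFreeProd η r q) :
    ∀ p, (foxRep η r q hq x p).2 = x * p.2 := by
  set Q : QuotFreeProd η r q → Prop := fun x => ∀ p, (foxRep η r q hq x p).2 = x * p.2 with hQ
  have h_inl : ∀ a, Q (FreeProd.inl _ _ a) := fun a p => by rw [foxRep_inl]; rfl
  have h_add : ∀ x y, Q x → Q y → Q (x + y) := fun x y hx hy p => by
    rw [map_add, LinearMap.add_apply, Prod.snd_add, hx, hy, add_mul]
  have h_mul : ∀ x y, Q x → Q y → Q (x * y) := fun x y hx hy p => by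
    rw [map_mul, Module.End.mul_apply, hx, hy, mul_assoc]
  refine FreeProd.induction (P := Q) h_inl (fun b => ?_) h_add h_mul x
  -- The claim for polynomials in `t` follows from the generators; it passes to fractions because
  -- `q + t` acts invertibly.
  have h_poly : ∀ p : (I → k)[X],
      Q (FreeProd.inr _ _ (algebraMap (I → k)[X] (LocPoly q) p)) := by
    intro p
    have hC : ∀ c, Q (FreeProd.inr _ _ (algebraMap (I → k)[X] (LocPoly q) (Polynomial.C c))) :=
      fun c => by
        have e : FreeProd.inr (quotUnit η r) (LocPoly.ofBase k q)
            (algebraMap (I → k)[X] (LocPoly q) (Polynomial.C c)) = FreeProd.inl _ _ _ :=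
          (FreeProd.inl_apply_eq_inr_apply _ _ c).symm
        rw [e]
        exact h_inl _
    have hX : Q (FreeProd.inr _ _ (algebraMap (I → k)[X] (LocPoly q) Polynomial.X)) := by
      intro z
      have e := foxRep_tF η r q hq
      change (foxRep η r q hq (tF η r q) z).2 = _
      rw [e]
      rfl
    induction p using Polynomial.induction_on with
    | C c => exact hC c
    | add f g hf hg => rw [map_add, map_add]; exact h_add _ _ hf hg
    | monomial n c h =>
      rw [pow_succ, ← mul_assoc, map_mul, map_mul]
      exact h_mul _ _ h hX
  obtain ⟨p, n, hp⟩ := LocPoly.exists_mul_pow (k := k) b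
  intro z
  have hu : IsUnit (foxRep η r q hq (FreeProd.inr _ _
      ((LocPoly.ofBase k q q + LocPoly.t q) ^ n))) :=
    (((LocPoly.isUnit_base_add_t (k := k) q).pow n).map _).map _
  rw [Module.End.isUnit_iff] at hu
  obtain ⟨y, rfl⟩ := hu.2 z
  have h1 := h_poly p y
  have h2 := h_poly ((Polynomial.C q + Polynomial.X) ^ n) y
  have e3 : algebraMap (I → k)[X] (LocPoly q) ((Polynomial.C q + Polynomial.X) ^ n) =
      (LocPoly.ofBase k q q + LocPoly.t q) ^ n := by
    rw [map_pow, map_add]; rfl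
  rw [e3] at h2
  rw [h2, ← Module.End.mul_apply, ← map_mul, ← map_mul, hp, h1, ← hp, map_mul, mul_assoc]

/-- The left Fox derivative with respect to `t` on `A/(r) *_S B`. -/
def fox : QuotFreeProd η r q →ₗ[k] FoxTarget η r q :=
  (LinearMap.fst k _ _).comp ((LinearMap.applyₗ (0, 1)).comp (foxRep η r q hq).toLinearMap)

theorem fox_inl (a : QuotBy k r) : fox η r q hq (FreeProd.inl _ _ a) = 0 := by
  change (foxRep η r q hq _ (0, 1)).1 = 0
  rw [foxRep_inl, foxInl_apply, map_zero]

theorem fox_inl_mul_tF_mul (a : QuotBy k r) (f : QuotFreeProd η r q) :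
    fox η r q hq (FreeProd.inl _ _ a * (tF η r q * f)) =
      (LinearMap.mulLeft k a).rTensor _ (sepMap (quotUnit η r) (baseF η r q) f) := by
  change (foxRep η r q hq _ (0, 1)).1 = _
  rw [map_mul, map_mul, foxRep_inl, foxRep_tF, Module.End.mul_apply, Module.End.mul_apply,
    ← Prod.mk.eta (p := foxRep η r q hq f (0, 1)), foxRep_snd, foxT_apply, foxInl_apply, mul_one]

end Homotopy

end

/-! ### The homotopy on `A` and its extension to `A *_S S[s]` -/

section

open scoped TensorProduct

section Homotopy

variable {k : Type*} [Field k] {I : Type*} [Fintype I] {A : Type*} [Ring A] [Algebra k A]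

omit [Fintype I] in
theorem idem_mul_idem (i : I) : idem k i * idem k i = idem k i := by
  rw [mul_idem]; simp [idem]

/-- Inserting the separability idempotent between factors commuting with `k^I` changes nothing. -/
theorem sum_idem_commute {X : Type*} [Ring X] [Algebra k X] (u : (I → k) →ₐ[k] X) {z : X}
    (hz : ∀ c, Commute (u c) z) (y : X) :
    ∑ i, u (idem k i) * (z * (u (idem k i) * y)) = z * y := by
  have : ∀ i, u (idem k i) * (z * (u (idem k i) * y)) = u (idem k i) * (z * y) := fun i => by
    rw [← mul_assoc z, ← (hz _).eq, mul_assoc, ← mul_assoc (u _) (u _), ← map_mul, idem_mul_idem]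
  rw [Finset.sum_congr rfl fun i _ => this i, ← Finset.sum_mul, ← map_sum, sum_idem, map_one,
    one_mul]

variable (η : (I → k) →ₐ[k] A) (r : A) (hr : ∀ c, Commute (η c) r) (q : I → k)
  (hq' : IsUnit (η q + r))

variable {η r hr q hq'} in
/-- The strong free product property yields a decomposition `A = σ(Λ) + σ(Λ) r A`, together with
a linear map sending `σ(a) r x` to `a s x` and killing `σ(Λ)`: the restriction to `A` of a
contracting homotopy of `A *_S S[s]`. -/
theorem StrongFreeProductProperty.exists_homotopy (hq : IsUnit q) {σ : QuotBy k r →ₗ[k] A}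
    (hσ : IsBimoduleSection η r σ) (h : StrongFreeProductProperty η r hr q hq' σ) :
    (Submodule.span k ({y | ∃ a, y = σ a} ∪ {y | ∃ a x, y = σ a * r * x}) = ⊤) ∧
    ∃ φ : A →ₗ[k] Koszul η, (∀ a, φ (σ a) = 0) ∧
      ∀ a x, φ (σ a * r * x) = Koszul.ι η (σ a) * Koszul.s η * Koszul.ι η x := by
  obtain ⟨σ', hword, hbij⟩ := h
  have hword' : ∀ a₀ w, (∀ p ∈ w, p.1 ∈ LocPoly.augIdeal q) → σ' (altWord η r q a₀ w) =
    σ a₀ * (w.map fun p => LocPoly.toAlg η r hr q hq' p.1 * σ p.2).prod := hword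
  have hinl : ∀ a, σ' (FreeProd.inl _ _ a) = σ a := fun a => by
    rw [← altWord_nil, hword' a [] (by simp)]; simp
  have hind : ∀ (P : QuotFreeProd η r q → Prop), (∀ a₀ w, (∀ p ∈ w, p.1 ∈ LocPoly.augIdeal q) →
      P (altWord η r q a₀ w)) → P 0 → (∀ x y, P x → P y → P (x + y)) →
      (∀ (c : k) x, P x → P (c • x)) → ∀ f, P f := by
    intro P h1 h2 h3 h4 f
    have hf : f ∈ Submodule.span k {x | ∃ a₀ w, (∀ p ∈ w, p.1 ∈ LocPoly.augIdeal q) ∧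
      x = altWord η r q a₀ w} := by rw [span_altWord η r q hq]; trivial
    induction hf using Submodule.span_induction with
    | mem x hx => obtain ⟨a₀, w, hw, rfl⟩ := hx; exact h1 a₀ w hw
    | zero => exact h2
    | add x y _ _ hx hy => exact h3 x y hx hy
    | smul c x _ hx => exact h4 c x hx
  -- The isomorphism of the strong free product property is left `S`-linear and turns the prefix
  -- `a t` into `σ(a) r`.
  have hbase : ∀ c f, σ' (baseF η r q c * f) = η c * σ' f := by
    intro c
    refine hind _ ?_ (by simp) (fun x y hx hy => by rw [mul_add, map_add, map_add, hx, hy, mul_add])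
      (fun c x hx => by rw [mul_smul_comm, map_smul, map_smul, hx, mul_smul_comm])
    intro a₀ w hw
    have e : baseF η r q c * altWord η r q a₀ w = altWord η r q (quotUnit η r c * a₀) w := by
      rw [altWord, altWord, map_mul, mul_assoc]; rfl
    have e2 := hσ.map_bimodule c a₀ 1
    rw [map_one, map_one, mul_one, mul_one] at e2
    rw [e, hword' _ _ hw, hword' _ _ hw, e2, mul_assoc]
  have ht : ∀ a f, σ' (FreeProd.inl _ _ a * (tF η r q * f)) = σ a * r * σ' f := by
    intro a
    refine hind _ ?_ (by simp)
      (fun x y hx hy => by rw [mul_add, mul_add, map_add, map_add, hx, hy, mul_add])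
      (fun c x hx => by
        rw [mul_smul_comm, mul_smul_comm, map_smul, map_smul, hx, mul_smul_comm])
    intro a₀ w hw
    rw [tF, ← altWord_cons, hword' _ _ hw, hword']
    · rw [List.map_cons, List.prod_cons, LocPoly.toAlg_t]
      simp only [mul_assoc]
    · simpa using ⟨LocPoly.t_mem q, fun a b h => hw (a, b) h⟩
  set e := LinearEquiv.ofBijective σ' hbij with he
  have he' : ∀ f, e.symm (σ' f) = f := fun f => e.symm_apply_apply f
  constructor
  · rw [eq_top_iff]
    rintro x -
    obtain ⟨f, rfl⟩ := hbij.2 x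
    revert f
    refine hind _ ?_ (by simp) (fun x y hx hy => by rw [map_add]; exact add_mem hx hy)
      (fun c x hx => by rw [map_smul]; exact Submodule.smul_mem _ _ hx)
    rintro a₀ (_ | ⟨⟨b, a₁⟩, w⟩) hw
    · rw [altWord_nil, hinl]
      exact Submodule.subset_span (Or.inl ⟨_, rfl⟩)
    · obtain ⟨b', hb'⟩ := Ideal.mem_span_singleton'.1 (hw (b, a₁) (by simp))
      rw [altWord_cons, ← show b' * LocPoly.t q = b from hb', mul_comm b',
        map_mul (FreeProd.inr (quotUnit η r) (LocPoly.ofBase k q)), mul_assoc]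
      refine Submodule.subset_span (Or.inr ⟨a₀, σ' (FreeProd.inr _ _ b' * altWord η r q a₁ w), ?_⟩)
      exact ht a₀ _
  -- Transport the Fox derivative to `A` and replace `a ⊗ f` by `σ(a) s f`.
  · let Θ : FoxTarget η r q →ₗ[k] Koszul η := TensorProduct.lift
      ((LinearMap.mul k (Koszul η)).compl₁₂ ((Koszul.ι η).toLinearMap.comp σ)
        ((LinearMap.mulLeft k (Koszul.s η)).comp ((Koszul.ι η).toLinearMap.comp σ')))
    have hΘ : ∀ a f, Θ (a ⊗ₜ f) = Koszul.ι η (σ a) * (Koszul.s η * Koszul.ι η (σ' f)) :=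
      fun a f => rfl
    refine ⟨Θ.comp ((fox η r q hq).comp e.symm.toLinearMap), fun a => ?_, fun a x => ?_⟩
    · change Θ (fox η r q hq (e.symm (σ a))) = 0
      rw [← hinl, he', fox_inl, map_zero]
    · obtain ⟨f, rfl⟩ := hbij.2 x
      change Θ (fox η r q hq (e.symm _)) = _
      rw [← ht, he', fox_inl_mul_tF_mul, sepMap_apply, map_sum, map_sum, mul_assoc,
        ← sum_idem_commute ((Koszul.ι η).comp η) (Koszul.commute_s η), Finset.mul_sum]
      refine Finset.sum_congr rfl fun i _ => ?_
      have e2 := hσ.map_bimodule 1 a (idem k i)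
      rw [map_one, map_one, one_mul, one_mul] at e2
      rw [LinearMap.rTensor_tmul, hΘ, LinearMap.mulLeft_apply, hbase, e2, map_mul, map_mul]
      simp only [mul_assoc]
      rfl

end Homotopy

section Extension

variable {k : Type*} [Field k] {I : Type*} [Fintype I] {A : Type*} [Ring A] [Algebra k A]
  (η : (I → k) →ₐ[k] A)

namespace Koszul

/-- The multiplication map `A ⊗ (A *_S S[s]) → A *_S S[s]`. -/
def mulMap : A ⊗[k] Koszul η →ₗ[k] Koszul η :=
  TensorProduct.lift ((LinearMap.mul k (Koszul η)).comp (ι η).toLinearMap)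

omit [Fintype I] in
theorem mulMap_tmul (a : A) (z : Koszul η) : mulMap η (a ⊗ₜ z) = ι η a * z := rfl

/-- Left multiplication by `s` followed by the separability idempotent, as an operator on
`A ⊗ (A *_S S[s])`. -/
def sOp : Module.End k (A ⊗[k] Koszul η) :=
  (sepMap η ((ι η).comp η)).comp ((LinearMap.mulLeft k (s η)).comp (mulMap η))

theorem commute_sOp (c : I → k) :
    Commute (((Module.End.rTensorAlgHom k A (Koszul η)).comp (Algebra.lmul k A)) (η c))
      (sOp η) := by
  refine TensorProduct.ext' fun a z => ?_
  rw [Module.End.mul_apply, Module.End.mul_apply]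
  change (LinearMap.mulLeft k (η c)).rTensor _ (sepMap η ((ι η).comp η) (s η * (ι η a * z))) =
    sepMap η ((ι η).comp η) (s η * (ι η (η c * a) * z))
  rw [rTensor_sepMap, AlgHom.comp_apply, map_mul (ι η), ← mul_assoc, (commute_s η c).eq]
  simp only [mul_assoc]

/-- The left action of `A *_S S[s]` on `A ⊗ (A *_S S[s])` used to isolate the first `s` of a
word. -/
def splitRep : Koszul η →ₐ[k] Module.End k (A ⊗[k] Koszul η) :=
  lift η ((Module.End.rTensorAlgHom k A (Koszul η)).comp (Algebra.lmul k A)) (sOp η)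
    (commute_sOp η)

/-- The map `a s z ↦ ∑ a eᵢ ⊗ eᵢ s z` isolating the first `s` of a word. -/
def split : Koszul η →ₗ[k] A ⊗[k] Koszul η :=
  (LinearMap.applyₗ (sepMap η ((ι η).comp η) 1)).comp (splitRep η).toLinearMap

/-- The multiplication map intertwines `splitRep` with left multiplication; in particular `split`
is a section of the multiplication map. -/
theorem mulMap_splitRep (x : Koszul η) : ∀ p, mulMap η (splitRep η x p) = x * mulMap η p := by
  refine induction η (P := fun x => ∀ p, mulMap η (splitRep η x p) = x * mulMap η p)
    (fun a => ?_) ?_ (fun x y hx hy p => by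
      rw [map_add, LinearMap.add_apply, map_add, hx, hy, add_mul])
    (fun x y hx hy p => by rw [map_mul, Module.End.mul_apply, hx, hy, mul_assoc]) x
  · rw [splitRep, lift_ι]
    intro p
    induction p using TensorProduct.induction_on with
    | zero => simp
    | add x y hx hy => rw [map_add, map_add, map_add, hx, hy, mul_add]
    | tmul b z =>
      change ι η (a * b) * z = ι η a * (ι η b * z)
      rw [map_mul, mul_assoc]
  · rw [splitRep, lift_s]
    intro p
    rw [sOp, LinearMap.comp_apply, LinearMap.comp_apply, LinearMap.mulLeft_apply, sepMap_apply,
      map_sum]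
    simp only [mulMap_tmul]
    have := sum_idem_commute ((ι η).comp η) (z := 1) (fun c => Commute.one_right _)
      (s η * mulMap η p)
    simpa using this

theorem mulMap_sepMap_one : mulMap η (sepMap η ((ι η).comp η) 1) = 1 := by
  have := sum_idem_commute ((ι η).comp η) (z := 1) (fun c => Commute.one_right _) 1
  rw [sepMap_apply, map_sum]
  simpa [mulMap_tmul] using this

theorem split_ι_mul (a : A) (z : Koszul η) :
    split η (ι η a * z) = (LinearMap.mulLeft k a).rTensor _ (split η z) := by
  change splitRep η (ι η a * z) _ = _
  rw [map_mul, Module.End.mul_apply]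
  change splitRep η (ι η a) (split η z) = _
  rw [splitRep, lift_ι]
  rfl

theorem split_one : split η 1 = sepMap η ((ι η).comp η) 1 := by
  change splitRep η 1 _ = _
  rw [map_one, Module.End.one_apply]

theorem split_s_mul (z : Koszul η) :
    split η (s η * z) = sepMap η ((ι η).comp η) (s η * z) := by
  change splitRep η (s η * z) _ = _
  have h : mulMap η (splitRep η z (sepMap η ((ι η).comp η) 1)) = z := by
    rw [mulMap_splitRep, mulMap_sepMap_one, mul_one]
  rw [map_mul, Module.End.mul_apply, splitRep, lift_s, ← splitRep]
  change sepMap η _ (s η * mulMap η _) = _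
  rw [h]

/-- The extension of a linear map `φ : A → A *_S S[s]` to `A *_S S[s]` by
`a s z ↦ φ(a) s z`. -/
def extend (φ : A →ₗ[k] Koszul η) : Koszul η →ₗ[k] Koszul η :=
  (TensorProduct.lift ((LinearMap.mul k (Koszul η)).comp φ)).comp (split η)

variable (φ : A →ₗ[k] Koszul η) (hφ : ∀ a c, φ (a * η c) = φ a * ι η (η c))

include hφ in
theorem lift_rTensor_sepMap (a : A) (z : Koszul η) :
    TensorProduct.lift ((LinearMap.mul k (Koszul η)).comp φ)
      ((LinearMap.mulLeft k a).rTensor _ (sepMap η ((ι η).comp η) z)) = φ a * z := by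
  rw [sepMap_apply, map_sum, map_sum]
  have : ∀ i, TensorProduct.lift ((LinearMap.mul k (Koszul η)).comp φ)
      ((LinearMap.mulLeft k a).rTensor _ (η (idem k i) ⊗ₜ ((ι η).comp η (idem k i) * z))) =
      φ a * ((ι η).comp η (idem k i) * (1 * ((ι η).comp η (idem k i) * z))) := by
    intro i
    change φ (a * η (idem k i)) * ((ι η).comp η (idem k i) * z) = _
    rw [hφ, one_mul, mul_assoc]
    rfl
  rw [Finset.sum_congr rfl fun i _ => this i, ← Finset.mul_sum,
    sum_idem_commute ((ι η).comp η) (z := 1) (fun c => Commute.one_right _), one_mul]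

include hφ in
theorem extend_ι (a : A) : extend η φ (ι η a) = φ a := by
  have h := lift_rTensor_sepMap η φ hφ a 1
  rw [← split_one, ← split_ι_mul, mul_one, mul_one] at h
  exact h

include hφ in
theorem extend_ι_mul_s_mul (a : A) (z : Koszul η) :
    extend η φ (ι η a * (s η * z)) = φ a * (s η * z) := by
  have h := lift_rTensor_sepMap η φ hφ a (s η * z)
  rw [← split_s_mul, ← split_ι_mul] at h
  exact h

end Koszul

end Extension

end

/-! ### Cohomology and formality -/

section

theorem QuotBy.mk_surjective {k : Type*} [Field k] {A : Type*} [Ring A] [Algebra k A] (r : A) :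
    Function.Surjective (QuotBy.mk k r) := RingQuot.mkAlgHom_surjective k _

theorem QuotBy.mk_self {k : Type*} [Field k] {A : Type*} [Ring A] [Algebra k A] (r : A) :
    QuotBy.mk k r r = 0 :=
  (RingQuot.mkAlgHom_rel k (s := fun x y : A => x = r ∧ y = 0) ⟨rfl, rfl⟩).trans
    (map_zero (QuotBy.mk k r))

namespace Koszul

variable {k : Type*} [Field k] {I : Type*} [Fintype I] {A : Type*} [Ring A] [Algebra k A]
  (η : (I → k) →ₐ[k] A) (r : A) (hr : ∀ c, Commute (η c) r)

omit [Fintype I] in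
/-- `A *_S S[s] = A + A s (A *_S S[s])`. -/
theorem span_words : Submodule.span k
    ({y | ∃ a, y = ι η a} ∪ {y | ∃ a z, y = ι η a * (s η * z)}) = ⊤ := by
  set M := Submodule.span k
    ({y | ∃ a, y = ι η a} ∪ {y | ∃ a z, y = ι η a * (s η * z)}) with hM
  have key : ∀ x : Koszul η, ∀ y ∈ M, x * y ∈ M := by
    refine induction η (P := fun x => ∀ y ∈ M, x * y ∈ M) (fun a y hy => ?_) (fun y _ => ?_)
      (fun x y hx hy z hz => by rw [add_mul]; exact add_mem (hx z hz) (hy z hz))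
      (fun x y hx hy z hz => by rw [mul_assoc]; exact hx _ (hy z hz))
    · induction hy using Submodule.span_induction with
      | mem y hy =>
        rcases hy with ⟨b, rfl⟩ | ⟨b, z, rfl⟩
        · exact Submodule.subset_span (Or.inl ⟨a * b, (map_mul _ _ _).symm⟩)
        · exact Submodule.subset_span (Or.inr ⟨a * b, z, by rw [map_mul, mul_assoc]⟩)
      | zero => simp
      | add y z _ _ h1 h2 => rw [mul_add]; exact add_mem h1 h2
      | smul c y _ h => rw [mul_smul_comm]; exact Submodule.smul_mem _ _ h
    · exact Submodule.subset_span (Or.inr ⟨1, y, by rw [map_one, one_mul]⟩)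
  rw [eq_top_iff]
  rintro x -
  have h1 : (1 : Koszul η) ∈ M := Submodule.subset_span (Or.inl ⟨1, (map_one _).symm⟩)
  simpa using key x 1 h1

/-- The augmentation `A *_S S[s] → A/(r)` sending `s` to `0`. -/
def aug : Koszul η →ₐ[k] QuotBy k r :=
  lift η (QuotBy.mk k r) 0 fun _ => Commute.zero_right _

omit [Fintype I] in
theorem aug_ι (a : A) : aug η r (ι η a) = QuotBy.mk k r a := lift_ι _ _ _ _ a

omit [Fintype I] in
theorem aug_s : aug η r (s η) = 0 := lift_s _ _ _ _

omit [Fintype I] in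
theorem aug_d (x : Koszul η) : aug η r (d η r hr x) = 0 :=
  induction η (P := fun x => aug η r (d η r hr x) = 0) (by simp)
    (by rw [d_s, aug_ι, QuotBy.mk_self]) (fun x y hx hy => by
      rw [map_add, map_add, hx, hy, add_zero])
    (fun x y hx hy => by rw [d_mul, map_add, map_mul, map_mul, hx, hy, zero_mul, mul_zero,
      add_zero])
    x

omit [Fintype I] in
theorem aug_of_mem {n : ℤ} (hn : n ≠ 0) {x : Koszul η} (hx : x ∈ grading η n) :
    aug η r x = 0 := by
  induction hx using Submodule.span_induction with
  | mem x hx =>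
    cases hx with
    | base a => exact absurd rfl hn
    | step m y a hy => rw [map_mul, map_mul, aug_s, mul_zero, zero_mul]
  | zero => simp
  | add y z _ _ h1 h2 => rw [map_add, h1, h2, add_zero]
  | smul c y _ h => rw [map_smul, h, smul_zero]

variable {η r} in
/-- Under the strong free product property, the identity of `A *_S S[s]` is homotopic to the
projection `σ ∘ aug` onto `σ(A/(r))`. -/
theorem exists_contraction {q : I → k} {hq' : IsUnit (η q + r)} (hq : IsUnit q)
    {σ : QuotBy k r →ₗ[k] A} (hσ : IsBimoduleSection η r σ)
    (h : StrongFreeProductProperty η r hr q hq' σ) :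
    ∃ H : Koszul η →ₗ[k] Koszul η, ∀ x,
      d η r hr (H x) + H (d η r hr x) = x - ι η (σ (aug η r x)) := by
  obtain ⟨hspan, φ, hφ1, hφ2⟩ := h.exists_homotopy hq hσ
  have hind : ∀ (P : A → Prop), (∀ a, P (σ a)) → (∀ a x, P (σ a * r * x)) → P 0 →
      (∀ x y, P x → P y → P (x + y)) → (∀ (c : k) x, P x → P (c • x)) → ∀ x, P x := by
    intro P h1 h2 h3 h4 h5 x
    have hx : x ∈ Submodule.span k ({y | ∃ a, y = σ a} ∪ {y | ∃ a x, y = σ a * r * x}) := by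
      rw [hspan]; trivial
    induction hx using Submodule.span_induction with
    | mem x hx =>
      rcases hx with ⟨a, rfl⟩ | ⟨a, x, rfl⟩
      · exact h1 a
      · exact h2 a x
    | zero => exact h3
    | add x y _ _ hx hy => exact h4 x y hx hy
    | smul c x _ hx => exact h5 c x hx
  have hπr : ∀ x y, QuotBy.mk k r (x * r * y) = 0 := fun x y => by
    rw [map_mul, map_mul, QuotBy.mk_self, mul_zero, zero_mul]
  -- `φ` is right `S`-linear, hence extends to words by acting on the part before the first `s`.
  have hφS : ∀ a c, φ (a * η c) = φ a * ι η (η c) := by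
    intro a c
    revert a
    refine hind _ (fun a => ?_) (fun a x => ?_) (by simp)
      (fun x y hx hy => by rw [add_mul, map_add, map_add, hx, hy, add_mul])
      (fun c x hx => by rw [smul_mul_assoc, map_smul, map_smul, hx, smul_mul_assoc])
    · have e2 := hσ.map_bimodule 1 a c
      rw [map_one, map_one, one_mul, one_mul] at e2
      rw [← e2, hφ1, hφ1, zero_mul]
    · rw [mul_assoc _ x, hφ2, hφ2, map_mul, mul_assoc _ _ (ι η (η c))]
  -- The homotopy formula in degree `0`, where `d` vanishes.
  have hdφ : ∀ a, d η r hr (φ a) = ι η a - ι η (σ (QuotBy.mk k r a)) := by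
    refine hind _ (fun a => ?_) (fun a x => ?_) (by simp)
      (fun x y hx hy => by simp only [map_add, hx, hy]; abel)
      (fun c x hx => by simp only [map_smul, hx, smul_sub])
    · rw [hφ1, hσ.section_eq, map_zero, sub_self]
    · rw [hφ2, hπr, map_zero, map_zero, sub_zero, d_mul, d_mul, d_ι, d_ι, d_s, parity_ι]
      simp
  -- `φ` takes values in odd degree.
  have hpar : ∀ a, parity η (φ a) = -φ a := by
    refine hind _ (fun a => ?_) (fun a x => ?_) (by simp)
      (fun x y hx hy => by simp only [map_add, hx, hy]; abel)
      (fun c x hx => by simp only [map_smul, hx, smul_neg])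
    · rw [hφ1, map_zero, neg_zero]
    · rw [hφ2]; simp
  -- The failure of `φ` to be right linear over elements `r b`: the factor `r` in `σ(a) r b` is
  -- replaced by `s`, which is the correction term needed below.
  have hstar : ∀ a b, φ (a * r * b) =
      φ a * ι η (r * b) + ι η (σ (QuotBy.mk k r a)) * (s η * ι η b) := by
    intro a b
    revert a
    refine hind _ (fun a => ?_) (fun a x => ?_) (by simp)
      (fun x y hx hy => by simp only [add_mul, map_add, hx, hy]; abel)
      (fun c x hx => by simp only [smul_mul_assoc, map_smul, hx, smul_add])
    · rw [hφ2, hφ1, zero_mul, zero_add, hσ.section_eq, mul_assoc]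
    · rw [mul_assoc _ x, mul_assoc _ (x * r), hφ2, hφ2, hπr, map_zero, map_zero, zero_mul, add_zero,
        mul_assoc x, map_mul, mul_assoc _ _ (ι η (r * b))]
  have hwords : ∀ (P : Koszul η → Prop), (∀ a, P (ι η a)) → (∀ a z, P (ι η a * (s η * z))) →
      P 0 → (∀ x y, P x → P y → P (x + y)) → (∀ (c : k) x, P x → P (c • x)) → ∀ x, P x := by
    intro P h1 h2 h3 h4 h5 x
    have hx : x ∈ Submodule.span k
        ({y | ∃ a, y = ι η a} ∪ {y | ∃ a z, y = ι η a * (s η * z)}) := by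
      rw [span_words]; trivial
    induction hx using Submodule.span_induction with
    | mem x hx =>
      rcases hx with ⟨a, rfl⟩ | ⟨a, x, rfl⟩
      · exact h1 a
      · exact h2 a x
    | zero => exact h3
    | add x y _ _ hx hy => exact h4 x y hx hy
    | smul c x _ hx => exact h5 c x hx
  -- The same formula for the extension of `φ` to words.
  have hH : ∀ a z, extend η φ (ι η a * (ι η r * z)) =
      φ a * (ι η r * z) + ι η (σ (QuotBy.mk k r a)) * (s η * z) := by
    intro a
    refine hwords _ (fun b => ?_) (fun b z => ?_) (by simp)
      (fun x y hx hy => by simp only [mul_add, map_add, hx, hy]; abel)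
      (fun c x hx => by simp only [mul_smul_comm, map_smul, hx, smul_add])
    · rw [← map_mul, ← map_mul, extend_ι η φ hφS, ← mul_assoc, hstar, map_mul]
    · rw [← mul_assoc (ι η r), ← map_mul (ι η), ← mul_assoc (ι η a), ← map_mul (ι η),
        extend_ι_mul_s_mul η φ hφS, ← mul_assoc a r b, hstar, add_mul]
      simp only [mul_assoc]
  refine ⟨extend η φ, ?_⟩
  refine hwords _ (fun a => ?_) (fun a z => ?_) (by simp)
    (fun x y hx hy => ?_) (fun c x hx => ?_)
  · rw [d_ι, map_zero, add_zero, extend_ι η φ hφS, hdφ, aug_ι]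
  · have e1 : d η r hr (ι η a * (s η * z)) =
        ι η a * (ι η r * z) - ι η a * (s η * d η r hr z) := by
      rw [d_mul, d_ι, zero_mul, zero_add, parity_ι, d_mul, d_s, parity_s, neg_mul, mul_add,
        mul_neg, sub_eq_add_neg]
    rw [e1, map_sub, hH, extend_ι_mul_s_mul η φ hφS, extend_ι_mul_s_mul η φ hφS, d_mul, hdφ, hpar,
      d_mul, d_s, parity_s, map_mul (aug η r), map_mul (aug η r), aug_s, zero_mul, mul_zero,
        map_zero, map_zero]
    noncomm_ring
  · have : d η r hr (extend η φ (x + y)) + extend η φ (d η r hr (x + y)) =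
      (d η r hr (extend η φ x) + extend η φ (d η r hr x)) +
        (d η r hr (extend η φ y) + extend η φ (d η r hr y)) := by
      simp only [map_add]; abel
    rw [this, hx, hy]
    simp only [map_add]; abel
  · have : d η r hr (extend η φ (c • x)) + extend η φ (d η r hr (c • x)) =
      c • (d η r hr (extend η φ x) + extend η φ (d η r hr x)) := by
      simp only [map_smul, smul_add]
    rw [this, hx]
    simp only [map_smul, smul_sub]

section Contracted

variable (σ : QuotBy k r →ₗ[k] A) (hσ : ∀ x, QuotBy.mk k r (σ x) = x)
  (H : Koszul η →ₗ[k] Koszul η)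
  (hH : ∀ x, d η r hr (H x) + H (d η r hr x) = x - ι η (σ (aug η r x)))

/-- The map `H(A *_S S[s]) → A/(r)` induced by the augmentation. -/
def augH : (dgAlgebra η r hr).H →ₐ[k] QuotBy k r :=
  Ideal.Quotient.liftₐ _ ((aug η r).comp (dgAlgebra η r hr).cocycles.val) (by
    rintro z ⟨w, hw⟩
    change aug η r z.1 = 0
    rw [← hw]
    exact aug_d η r hr w)

omit [Fintype I] in
theorem augH_toCohomology (a : A) :
    augH η r hr (toCohomology η r hr a) = QuotBy.mk k r a := aug_ι η r a

include hH in
omit [Fintype I] in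
theorem augH_injective : Function.Injective (augH η r hr) := by
  rw [injective_iff_map_eq_zero]
  intro y hy
  obtain ⟨z, rfl⟩ := (dgAlgebra η r hr).toH_surjective y
  -- A cocycle killed by the augmentation is a boundary, by the homotopy formula.
  have key : ∀ x : Koszul η, d η r hr x = 0 → aug η r x = 0 → d η r hr (H x) = x := by
    intro x h1 h2
    have h := hH x
    rwa [h1, h2, map_zero, map_zero, map_zero, sub_zero, add_zero] at h
  exact (dgAlgebra η r hr).toH_eq_zero.2 ⟨H z.1, key z.1 z.2 hy⟩

omit [Fintype I] in
theorem augH_surjective : Function.Surjective (augH η r hr) := by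
  intro x
  obtain ⟨a, rfl⟩ := QuotBy.mk_surjective r x
  exact ⟨toCohomology η r hr a, augH_toCohomology η r hr a⟩

include hH in
omit [Fintype I] in
theorem augH_bijective : Function.Bijective (augH η r hr) :=
  ⟨augH_injective η r hr σ H hH, augH_surjective η r hr⟩

include hH in
omit [Fintype I] in
/-- The augmentation kills the nonzero degrees and is injective on cohomology. -/
theorem cohomology_grading_eq_bot (n : ℤ) (hn : n ≠ 0) :
    (dgAlgebra η r hr).cohomology.grading n = ⊥ := by
  rw [eq_bot_iff]
  rintro _ ⟨z, hz, rfl⟩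
  have h1 : augH η r hr ((dgAlgebra η r hr).toH z) = augH η r hr 0 :=
    (aug_of_mem η r hn hz).trans (map_zero (augH η r hr)).symm
  exact augH_injective η r hr σ H hH h1

include hH in
omit [Fintype I] in
theorem cohomology_grading_zero : (dgAlgebra η r hr).cohomology.grading 0 = ⊤ := by
  rw [eq_top_iff]
  rintro y -
  obtain ⟨a, ha⟩ := QuotBy.mk_surjective r (augH η r hr y)
  rw [← augH_toCohomology η r hr] at ha
  rw [← augH_injective η r hr σ H hH ha]
  exact ⟨⟨ι η a, d_ι η r hr a⟩, ι_mem η a, rfl⟩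

/-- The composite of the augmentation with the inverse of `augH`. -/
def toHOfBijective (hb : Function.Bijective (augH η r hr)) :
    Koszul η →ₐ[k] (dgAlgebra η r hr).H :=
  (AlgEquiv.ofBijective (augH η r hr) hb).symm.toAlgHom.comp (aug η r)

omit [Fintype I] in
theorem augH_toHOfBijective (hb : Function.Bijective (augH η r hr)) (x : Koszul η) :
    augH η r hr (toHOfBijective η r hr hb x) = aug η r x :=
  (AlgEquiv.ofBijective (augH η r hr) hb).apply_symm_apply _

omit [Fintype I] in
theorem toHOfBijective_eq_zero (hb : Function.Bijective (augH η r hr)) {x : Koszul η}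
    (hx : aug η r x = 0) : toHOfBijective η r hr hb x = 0 :=
  hb.1 (by rw [augH_toHOfBijective, hx, map_zero])

/-- The projection of the dg algebra onto its cohomology, available when the cohomology is
concentrated in degree `0`. -/
def toCohomologyHom (hb : Function.Bijective (augH η r hr))
    (hg : (dgAlgebra η r hr).cohomology.grading 0 = ⊤) :
    DGAlgebra.Hom (dgAlgebra η r hr) (dgAlgebra η r hr).cohomology where
  toAlgHom := toHOfBijective η r hr hb
  map_grading n x hx := by
    by_cases hn : n = 0
    · subst hn; rw [hg]; trivial
    · have h1 : toHOfBijective η r hr hb x = 0 :=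
        toHOfBijective_eq_zero η r hr hb (aug_of_mem η r hn hx)
      exact h1 ▸ Submodule.zero_mem ((dgAlgebra η r hr).cohomology.grading n)
  map_d x := toHOfBijective_eq_zero η r hr hb (aug_d η r hr x)
  map_unit c := hb.1 (augH_toHOfBijective η r hr hb _)

omit [Fintype I] in
theorem toCohomologyHom_apply (hb : Function.Bijective (augH η r hr))
    (z : (dgAlgebra η r hr).cocycles) :
    toHOfBijective η r hr hb z.1 = (dgAlgebra η r hr).toH z :=
  hb.1 (augH_toHOfBijective η r hr hb _)

omit [Fintype I] in
theorem toCohomologyHom_isQuasiIso (hb : Function.Bijective (augH η r hr))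
    (hg : (dgAlgebra η r hr).cohomology.grading 0 = ⊤) :
    (toCohomologyHom η r hr hb hg).IsQuasiIso := by
  constructor
  · rw [injective_iff_map_eq_zero]
    intro y hy
    obtain ⟨z, rfl⟩ := (dgAlgebra η r hr).toH_surjective y
    obtain ⟨w, hw⟩ := (dgAlgebra η r hr).cohomology.toH_eq_zero.1 hy
    have h1 : (0 : (dgAlgebra η r hr).H) = toHOfBijective η r hr hb z.1 := hw
    rw [toCohomologyHom_apply] at h1
    exact h1.symm
  · intro y
    obtain ⟨y', rfl⟩ := (dgAlgebra η r hr).cohomology.toH_surjective y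
    obtain ⟨z, hz⟩ := (dgAlgebra η r hr).toH_surjective y'.1
    refine ⟨(dgAlgebra η r hr).toH z, ?_⟩
    change (dgAlgebra η r hr).cohomology.toH _ = _
    congr 1
    refine Subtype.ext ?_
    exact (toCohomologyHom_apply η r hr hb z).trans hz

end Contracted

end Koszul

variable {k : Type*} [Field k] {I : Type*} [Fintype I] {A : Type*} [Ring A] [Algebra k A]
  {η : (I → k) →ₐ[k] A} {r : A} {hr : ∀ c, Commute (η c) r}

/-- The strong free product property forces `A *_S S[s]` to be a resolution of `A/(r)`, hence
formal. -/
theorem StrongFreeProductProperty.homology {q : I → k} {hq' : IsUnit (η q + r)} (hq : IsUnit q)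
    {σ : QuotBy k r →ₗ[k] A} (hσ : IsBimoduleSection η r σ)
    (h : StrongFreeProductProperty η r hr q hq' σ) :
    (∀ n : ℤ, n ≠ 0 → (Koszul.dgAlgebra η r hr).cohomology.grading n = ⊥) ∧
    (Koszul.dgAlgebra η r hr).cohomology.grading 0 = ⊤ ∧
    (∃ φ : (Koszul.dgAlgebra η r hr).cohomology.carrier ≃ₐ[k] QuotBy k r,
      ∀ x, φ (Koszul.toCohomology η r hr x) = QuotBy.mk k r x) ∧
    (Koszul.dgAlgebra η r hr).Formal := by
  obtain ⟨H, hH⟩ := Koszul.exists_contraction hr hq hσ h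
  have hb := Koszul.augH_bijective η r hr σ H hH
  have hg := Koszul.cohomology_grading_zero η r hr σ H hH
  exact ⟨Koszul.cohomology_grading_eq_bot η r hr σ H hH, hg,
    ⟨AlgEquiv.ofBijective _ hb, Koszul.augH_toCohomology η r hr⟩,
    Relation.EqvGen.rel _ _ ⟨_, Koszul.toCohomologyHom_isQuasiIso η r hr hb hg⟩⟩

end

/-! ### Words and their values -/

section

section Words

variable {I ℓ : Type*} (tl hd : ℓ → I)

/-- `w` is a path starting at `i`. A letter `a` goes from `tl a` to `hd a`, and paths are composed
from left to right. -/
def Composable : I → List ℓ → Prop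
  | _, [] => True
  | i, a :: w => tl a = i ∧ Composable (hd a) w

/-- The end point of the path `w` starting at `i`. -/
def endpt : I → List ℓ → I
  | i, [] => i
  | _, a :: w => endpt (hd a) w

theorem composable_append (u v : List ℓ) : ∀ i, Composable tl hd i (u ++ v) ↔
    Composable tl hd i u ∧ Composable tl hd (endpt hd i u) v := by
  induction u with
  | nil => intro i; simp [Composable, endpt]
  | cons a u ih => intro i; simp only [List.cons_append, Composable, endpt, ih, and_assoc]

variable {k : Type*} [Field k] {X : Type*} [Ring X] [Algebra k X] (μ : (I → k) →ₐ[k] X)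
  (val : ℓ → X)

/-- The value `eᵢ ℓ₁ ⋯ ℓₙ` of a word `ℓ₁ ⋯ ℓₙ` based at `i`. -/
def wordVal (i : I) (w : List ℓ) : X := μ (idem k i) * (w.map val).prod

theorem wordVal_nil (i : I) : wordVal μ val i [] = μ (idem k i) := by simp [wordVal]

theorem map_mul_wordVal (c : I → k) (i : I) (w : List ℓ) :
    μ c * wordVal μ val i w = c i • wordVal μ val i w := by
  rw [wordVal, ← mul_assoc, ← map_mul, mul_idem, map_smul, smul_mul_assoc]

variable {tl hd μ val} (hl : ∀ a c, μ c * val a = c (tl a) • val a)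
  (hr : ∀ a c, val a * μ c = c (hd a) • val a)

include hl in
theorem idem_mul_of_ne {i : I} {a : ℓ} (h : tl a ≠ i) : μ (idem k i) * val a = 0 := by
  rw [hl]; simp [idem, h]

include hr in
theorem mul_idem_hd (a : ℓ) : val a * μ (idem k (hd a)) = val a := by
  rw [hr]; simp [idem]

include hr in
theorem wordVal_cons (i : I) (a : ℓ) (w : List ℓ) :
    wordVal μ val i (a :: w) = μ (idem k i) * val a * wordVal μ val (hd a) w := by
  rw [wordVal, wordVal, List.map_cons, List.prod_cons, ← mul_assoc (μ _ * val a),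
    mul_assoc _ (val a) (μ _), mul_idem_hd hr, mul_assoc]

include hl hr in
theorem wordVal_of_not_composable (w : List ℓ) :
    ∀ i, ¬ Composable tl hd i w → wordVal μ val i w = 0 := by
  induction w with
  | nil => intro i h; exact absurd trivial h
  | cons a w ih =>
    intro i h
    rw [wordVal_cons hr]
    by_cases hi : tl a = i
    · rw [ih _ fun hw => h ⟨hi, hw⟩, mul_zero]
    · rw [idem_mul_of_ne hl hi, zero_mul]

include hr in
theorem wordVal_append (u v : List ℓ) : ∀ i, wordVal μ val i (u ++ v) =
    wordVal μ val i u * wordVal μ val (endpt hd i u) v := by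
  induction u with
  | nil =>
    intro i
    rw [wordVal_nil, endpt, map_mul_wordVal]
    simp [idem]
  | cons a u ih =>
    intro i
    rw [List.cons_append, wordVal_cons hr, ih, wordVal_cons hr]
    simp only [endpt, mul_assoc]

include hr in
theorem wordVal_mul_map (u : List ℓ) (c : I → k) : ∀ i, wordVal μ val i u * μ c =
    c (endpt hd i u) • wordVal μ val i u := by
  induction u with
  | nil => intro i; rw [wordVal_nil, endpt, ← map_mul, mul_comm, mul_idem, map_smul]
  | cons a u ih => intro i; rw [wordVal_cons hr, mul_assoc, ih, mul_smul_comm]; rfl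

include hr in
/-- The product of two word values is the value of the concatenation, or zero if the paths are not
composable. -/
theorem wordVal_mul (i j : I) (u v : List ℓ) :
    wordVal μ val i u * wordVal μ val j v = wordVal μ val i (u ++ v) ∨
      wordVal μ val i u * wordVal μ val j v = 0 := by
  by_cases h : j = endpt hd i u
  · left; rw [wordVal_append hr, h]
  · right
    have h1 : wordVal μ val j v = μ (idem k j) * wordVal μ val j v := by
      rw [map_mul_wordVal]; simp [idem]
    rw [h1, ← mul_assoc, wordVal_mul_map hr]
    simp [idem, Ne.symm h]

end Words

theorem sub_algebraMap_mul_sub_algebraMap {k X : Type*} [Field k] [Ring X] [Algebra k X]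
    (x y : X) (a b : k) : (x - algebraMap k X a) * (y - algebraMap k X b) =
      x * y - algebraMap k X (a * b) - b • (x - algebraMap k X a) - a • (y - algebraMap k X b) := by
  simp only [Algebra.algebraMap_eq_smul_one, sub_mul, mul_sub, smul_sub, smul_mul_assoc,
    mul_smul_comm, mul_one, one_mul, smul_smul, mul_comm b a]
  abel

section Powers

variable {k : Type*} [Field k] {I : Type*} (q : I → kˣ) {X Y : Type*} [Ring X] [Algebra k X]
  [Ring Y] [Algebra k Y] (μ : (I → k) →ₐ[k] X) (R : Xˣ)

/-- The element `eᵢ (Rⁿ - qᵢⁿ)`. -/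
def powElt (i : I) (n : ℤ) : X :=
  μ (idem k i) * ((R ^ n : Xˣ) - algebraMap k X (q i ^ n : kˣ))

theorem powElt_zero (i : I) : powElt q μ R i 0 = 0 := by simp [powElt]

theorem map_powElt (f : X →ₐ[k] Y) (i : I) (n : ℤ) :
    f (powElt q μ R i n) = powElt q (f.comp μ) (Units.map (f : X →* Y) R) i n := by
  rw [powElt, powElt, map_mul, map_sub, AlgHom.commutes, ← map_zpow]
  rfl

theorem idem_mul_zpow (i : I) (n : ℤ) : μ (idem k i) * (R ^ n : Xˣ) =
    powElt q μ R i n + (q i ^ n : kˣ).1 • μ (idem k i) := by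
  rw [powElt, mul_sub, ← Algebra.commutes, ← Algebra.smul_def, sub_add_cancel]

variable {R} (hR : ∀ c, Commute (μ c) R)

include hR in
theorem commute_zpow (c : I → k) (n : ℤ) : Commute (μ c) (R ^ n : Xˣ) :=
  (hR c).units_zpow_right n

include hR in
theorem powElt_mul_map (i : I) (n : ℤ) (c : I → k) :
    powElt q μ R i n * μ c = c i • powElt q μ R i n := by
  rw [powElt, mul_assoc, ← ((commute_zpow μ hR c n).sub_right
    (Algebra.commute_algebraMap_right _ _)).eq, ← mul_assoc, ← map_mul, mul_comm (idem k i),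
    mul_idem, map_smul, smul_mul_assoc]

omit hR in
theorem map_mul_powElt (i : I) (n : ℤ) (c : I → k) :
    μ c * powElt q μ R i n = c i • powElt q μ R i n := by
  rw [powElt, ← mul_assoc, ← map_mul, mul_idem, map_smul, smul_mul_assoc]

include hR in
/-- Products of the elements `eᵢ (Rⁿ - qᵢⁿ)` at one vertex are linear combinations of such elements.
Adjacent letters `T` can therefore be merged. -/
theorem powElt_mul_powElt (i : I) (m n : ℤ) : powElt q μ R i m * powElt q μ R i n =
    powElt q μ R i (m + n) - (q i ^ n : kˣ).1 • powElt q μ R i m -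
      (q i ^ m : kˣ).1 • powElt q μ R i n := by
  have h1 : powElt q μ R i m * powElt q μ R i n = μ (idem k i) *
      (((R ^ m : Xˣ) - algebraMap k X (q i ^ m : kˣ)) *
        ((R ^ n : Xˣ) - algebraMap k X (q i ^ n : kˣ))) := by
    have : powElt q μ R i m * μ (idem k i) = powElt q μ R i m := by
      rw [powElt_mul_map q μ hR]; simp [idem]
    conv_lhs => rw [powElt.eq_def q μ R i n, ← mul_assoc, this, powElt, mul_assoc]
  rw [h1, powElt, powElt, powElt, ← mul_smul_comm, ← mul_smul_comm, ← mul_sub, ← mul_sub, zpow_add,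
    zpow_add]
  congr 1
  rw [Units.val_mul, Units.val_mul, sub_algebraMap_mul_sub_algebraMap]

include hR in
theorem powElt_mul_powElt_of_ne {i j : I} (h : i ≠ j) (m n : ℤ) :
    powElt q μ R i m * powElt q μ R j n = 0 := by
  have : powElt q μ R j n = μ (idem k j) * powElt q μ R j n := by
    rw [map_mul_powElt]; simp [idem]
  rw [this, ← mul_assoc, powElt_mul_map q μ hR]
  simp [idem, h]

/-- The elements `eᵢ (Rⁿ - qᵢⁿ)` vanish where `R` equals `q`, in particular in `A/(r)`. -/
theorem powElt_eq_zero (hR' : (R : X) = μ fun i => q i) (i : I) (n : ℤ) :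
    powElt q μ R i n = 0 := by
  have h : R = Units.map (μ : (I → k) →* X) (MulEquiv.piUnits.symm q) := Units.ext hR'
  have h2 : ((MulEquiv.piUnits.symm q ^ n : (I → k)ˣ) : I → k) = fun i => ((q i ^ n : kˣ) : k) := by
    rw [← map_zpow]; rfl
  have h3 : ((R ^ n : Xˣ) : X) = μ (fun i => ((q i ^ n : kˣ) : k)) := by
    rw [h, ← map_zpow, Units.coe_map, h2]; rfl
  rw [powElt, h3, mul_sub, ← map_mul, mul_comm (idem k i), mul_idem, ← Algebra.commutes,
    ← Algebra.smul_def, map_smul, sub_self]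

end Powers

end

/-! ### Bases of words with letters `eᵢ (ρⁿ - qᵢⁿ)` -/

section

/-- A basis of `A` consisting of words in an alphabet `ℓ` which contains, for every vertex `i` and
every `n ≠ 0`, a letter `T i n` of value `eᵢ (ρⁿ - qᵢⁿ)` with `ρ = q + r`, such that normality of a
word can be tested on the pieces between the letters `T i n`, apart from the requirement that no
two of these letters are adjacent. -/
structure WordBasis {k : Type*} [Field k] {I : Type*} {A : Type*} [Ring A]
    [Algebra k A] (η : (I → k) →ₐ[k] A) (q : I → kˣ) (ρ : Aˣ) (ℓ : Type*) where
  tl : ℓ → I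
  hd : ℓ → I
  val : ℓ → A
  map_mul_val : ∀ a c, η c * val a = c (tl a) • val a
  val_mul_map : ∀ a c, val a * η c = c (hd a) • val a
  T : I → ℤ → ℓ
  T_injective : ∀ i j m n, T i m = T j n → m = n
  tl_T : ∀ i n, tl (T i n) = i
  hd_T : ∀ i n, hd (T i n) = i
  val_T : ∀ i n, val (T i n) = powElt q η ρ i n
  Normal : List ℓ → Prop
  normal_nil : Normal []
  normal_T : ∀ u i n v, Normal (u ++ T i n :: v) ↔ Normal u ∧ Normal v ∧ n ≠ 0 ∧
    (∀ u' j m, u ≠ u' ++ [T j m]) ∧ (∀ v' j m, v ≠ T j m :: v')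
  linearIndependent : LinearIndependent k
    fun p : {p : I × List ℓ // Normal p.2 ∧ Composable tl hd p.1 p.2} => wordVal η val p.1.1 p.1.2
  span_eq_top : ⊤ ≤ Submodule.span k (Set.range
    fun p : {p : I × List ℓ // Normal p.2 ∧ Composable tl hd p.1 p.2} => wordVal η val p.1.1 p.1.2)

namespace WordBasis

variable {k : Type*} [Field k] {I : Type*} [Fintype I] {A : Type*} [Ring A]
    [Algebra k A] {η : (I → k) →ₐ[k] A} {q : I → kˣ} {ρ : Aˣ} {ℓ : Type*}
    (W : WordBasis η q ρ ℓ) (hρ : ∀ c, Commute (η c) ρ)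

/-- The words of `W` as a basis. -/
def basis : Module.Basis {p : I × List ℓ // W.Normal p.2 ∧ Composable W.tl W.hd p.1 p.2} k A :=
  Module.Basis.mk W.linearIndependent W.span_eq_top

omit [Fintype I] in
theorem basis_apply (p) : W.basis p = wordVal η W.val p.1.1 p.1.2 := Module.Basis.mk_apply _ _ _

/-- Words without letters `T i n`. -/
def TFree (w : List ℓ) : Prop := ∀ a ∈ w, ∀ i n, a ≠ W.T i n

/-- Words whose first letter is some `T i n`. -/
def THead (w : List ℓ) : Prop := ∃ v i n, w = W.T i n :: v

/-- The span of the normal words with property `P`. -/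
def spanOf (P : List ℓ → Prop) : Submodule k A :=
  Submodule.span k {x | ∃ i w, W.Normal w ∧ P w ∧ x = wordVal η W.val i w}

variable {W}

omit [Fintype I] in
theorem wordVal_mem {P : List ℓ → Prop} {i : I} {w : List ℓ} (hn : W.Normal w) (hw : P w) :
    wordVal η W.val i w ∈ W.spanOf P := Submodule.subset_span ⟨i, w, hn, hw, rfl⟩

omit [Fintype I] in
theorem spanOf_induction {P : List ℓ → Prop} {C : A → Prop} {x : A} (hx : x ∈ W.spanOf P)
    (h1 : ∀ i w, W.Normal w → P w → C (wordVal η W.val i w)) (h0 : C 0)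
    (hadd : ∀ x y, C x → C y → C (x + y)) (hsmul : ∀ (c : k) x, C x → C (c • x)) : C x := by
  induction hx using Submodule.span_induction with
  | mem x hx => obtain ⟨i, w, hn, hw, rfl⟩ := hx; exact h1 i w hn hw
  | zero => exact h0
  | add x y _ _ hx hy => exact hadd x y hx hy
  | smul c x _ hx => exact hsmul c x hx

omit [Fintype I] in
theorem mem_spanOf_true (x : A) : x ∈ W.spanOf fun _ => True := by
  have h : x ∈ (⊤ : Submodule k A) := trivial
  refine Submodule.span_le.2 ?_ (W.span_eq_top h)
  rintro _ ⟨p, rfl⟩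
  exact wordVal_mem p.2.1 trivial

omit [Fintype I] in
theorem induction_words {C : A → Prop} (x : A)
    (h1 : ∀ i w, W.Normal w → C (wordVal η W.val i w)) (h0 : C 0)
    (hadd : ∀ x y, C x → C y → C (x + y)) (hsmul : ∀ (c : k) x, C x → C (c • x)) : C x :=
  spanOf_induction (W := W) (mem_spanOf_true x) (fun i w hn _ => h1 i w hn) h0 hadd hsmul

omit [Fintype I] in
theorem linearMap_ext_words {M : Type*} [AddCommGroup M] [Module k M] {f g : A →ₗ[k] M}
    (h : ∀ i w, W.Normal w → f (wordVal η W.val i w) = g (wordVal η W.val i w)) (x : A) :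
    f x = g x :=
  induction_words (W := W) (C := fun x => f x = g x) x h (by simp)
    (fun x y hx hy => by rw [map_add, map_add, hx, hy])
    (fun c x hx => by rw [map_smul, map_smul, hx])

omit [Fintype I] in
/-- Induction on the number of letters `T i n`. -/
theorem splitting_induction {C : List ℓ → Prop} (h1 : ∀ u, W.TFree u → C u)
    (h2 : ∀ u i n v, W.TFree u → C v → C (u ++ W.T i n :: v)) (w : List ℓ) : C w := by
  suffices h : ∀ w u, W.TFree u → C (u ++ w) from h w [] (fun a ha => absurd ha (by simp))
  intro w
  induction w with
  | nil => intro u hu; rw [List.append_nil]; exact h1 u hu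
  | cons a w ih =>
    intro u hu
    by_cases ha : ∃ i n, a = W.T i n
    · obtain ⟨i, n, rfl⟩ := ha
      exact h2 u i n w hu (ih [] (fun a ha => absurd ha (by simp)))
    · have h := ih (u ++ [a]) (by
        intro b hb i n hbe
        rcases List.mem_append.1 hb with hb | hb
        · exact hu b hb i n hbe
        · rw [List.mem_singleton] at hb
          exact ha ⟨i, n, hb ▸ hbe⟩)
      simpa using h

omit [Fintype I] in
theorem TFree.not_eq_append {u : List ℓ} (hu : W.TFree u) (u' j m) : u ≠ u' ++ [W.T j m] := by
  rintro rfl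
  exact hu (W.T j m) (by simp) j m rfl

omit [Fintype I] in
theorem tFree_nil : W.TFree [] := fun a ha => absurd ha (by simp)

omit [Fintype I] in
theorem normal_T_cons {i n v} : W.Normal (W.T i n :: v) ↔
    W.Normal v ∧ n ≠ 0 ∧ (∀ v' j m, v ≠ W.T j m :: v') := by
  have h := W.normal_T [] i n v
  simpa [W.normal_nil] using h

omit [Fintype I] in
/-- Normal words can be glued at a letter `T`. -/
theorem normal_append {u v : List ℓ} (hu : W.TFree u) (hu' : W.Normal u) (hv : W.Normal v)
    (h : v = [] ∨ W.THead v) : W.Normal (u ++ v) := by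
  rcases h with rfl | ⟨v, i, n, rfl⟩
  · simpa using hu'
  · have h := normal_T_cons.1 hv
    exact (W.normal_T _ _ _ _).2 ⟨hu', h.1, h.2.1, hu.not_eq_append, h.2.2⟩

omit [Fintype I] in
/-- Every normal word is cut, before its first letter `T`, into two normal words. -/
theorem exists_splitting {w : List ℓ} (hw : W.Normal w) : ∃ u v, w = u ++ v ∧ W.TFree u ∧
    W.Normal u ∧ W.Normal v ∧ (v = [] ∨ W.THead v) := by
  revert hw
  induction w using W.splitting_induction with
  | h1 u hu => exact fun h => ⟨u, [], by simp, hu, h, W.normal_nil, Or.inl rfl⟩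
  | h2 u i n v hu _ =>
    intro h
    have h' := (W.normal_T _ _ _ _).1 h
    exact ⟨u, _, rfl, hu, h'.1, normal_T_cons.2 ⟨h'.2.1, h'.2.2.1, h'.2.2.2.2⟩,
      Or.inr ⟨v, i, n, rfl⟩⟩

omit [Fintype I] in
theorem wordVal_split {w u v : List ℓ} (h : w = u ++ v) (i : I) : wordVal η W.val i w =
    wordVal η W.val i u * wordVal η W.val (endpt W.hd i u) v := by
  rw [h, wordVal_append W.val_mul_map]

omit [Fintype I] in
theorem wordVal_T_cons (i j n v) : wordVal η W.val j (W.T i n :: v) =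
    η (idem k j) * powElt q η ρ i n * wordVal η W.val i v := by
  rw [wordVal_cons W.val_mul_map, W.val_T, W.hd_T]

omit [Fintype I] in
theorem wordVal_T_cons_self (i n v) : wordVal η W.val i (W.T i n :: v) =
    powElt q η ρ i n * wordVal η W.val i v := by
  rw [wordVal_T_cons, map_mul_powElt]; simp [idem]

omit [Fintype I] in
theorem wordVal_T_cons_of_ne {i j} (h : i ≠ j) (n v) : wordVal η W.val j (W.T i n :: v) = 0 := by
  rw [wordVal_T_cons, map_mul_powElt]; simp [idem, h]

omit [Fintype I] in
theorem powElt_mul_wordVal_of_ne (hρ : ∀ c, Commute (η c) ρ) {i j} (h : i ≠ j) (n v) :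
    powElt q η ρ i n * wordVal η W.val j v = 0 := by
  have : wordVal η W.val j v = η (idem k j) * wordVal η W.val j v := by
    rw [map_mul_wordVal]; simp [idem]
  rw [this, ← mul_assoc, powElt_mul_map q η hρ]
  simp [idem, h]

include hρ

omit [Fintype I] in
/-- Multiplying `eᵢ (ρⁿ - qᵢⁿ) y` by a normal word `u` not ending in a letter `T` only produces
normal words with prefix `u T`: expand `y` in normal words and merge adjacent letters `T`. -/
theorem wordVal_mul_powElt_mul_mem (P : List ℓ → Prop) {u : List ℓ} (hu : W.Normal u)
    (hu' : ∀ u' j m, u ≠ u' ++ [W.T j m])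
    (hP : ∀ v i n, W.Normal v → n ≠ 0 → (∀ v' j m, v ≠ W.T j m :: v') → P (u ++ W.T i n :: v))
    (l i n) (y : A) :
    wordVal η W.val l u * (powElt q η ρ i n * y) ∈ W.spanOf P := by
  have h0 : ∀ n v, W.Normal v → (∀ v' j m, v ≠ W.T j m :: v') →
      wordVal η W.val l u * (powElt q η ρ i n * wordVal η W.val i v) ∈ W.spanOf P := by
    intro n v hv hv'
    by_cases hn : n = 0
    · subst hn; rw [powElt_zero, zero_mul, mul_zero]; exact zero_mem _
    rw [← wordVal_T_cons_self]
    rcases wordVal_mul (hd := W.hd) W.val_mul_map (μ := η) l i u (W.T i n :: v) with h | h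
    · rw [h]
      exact wordVal_mem ((W.normal_T _ _ _ _).2 ⟨hu, hv, hn, hu', hv'⟩) (hP _ _ _ hv hn hv')
    · rw [h]; exact zero_mem _
  refine induction_words (W := W) (C := fun y => wordVal η W.val l u * (powElt q η ρ i n * y) ∈
    W.spanOf P) y (fun j v hv => ?_) (by simp)
    (fun x y hx hy => by rw [mul_add, mul_add]; exact add_mem hx hy)
    (fun c x hx => by rw [mul_smul_comm, mul_smul_comm]; exact Submodule.smul_mem _ _ hx)
  by_cases hij : i = j
  · subst hij
    by_cases hv' : ∃ v' j m, v = W.T j m :: v'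
    · obtain ⟨v', j, m, rfl⟩ := hv'
      obtain ⟨h1, h2, h3⟩ := normal_T_cons.1 hv
      by_cases hij : i = j
      · subst hij
        rw [wordVal_T_cons_self, ← mul_assoc (powElt _ _ _ _ _), powElt_mul_powElt q η hρ, sub_mul,
          sub_mul, mul_sub, mul_sub, smul_mul_assoc, smul_mul_assoc, mul_smul_comm, mul_smul_comm]
        exact sub_mem (sub_mem (h0 _ _ h1 h3) (Submodule.smul_mem _ _ (h0 _ _ h1 h3)))
          (Submodule.smul_mem _ _ (h0 _ _ h1 h3))
      · rw [wordVal_T_cons_of_ne (Ne.symm hij), mul_zero, mul_zero]; exact zero_mem _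
    · push Not at hv'
      exact h0 _ _ hv fun v' j m => hv' v' j m
  · rw [powElt_mul_wordVal_of_ne hρ hij, mul_zero]; exact zero_mem _

/-- `eᵢ (ρⁿ - qᵢⁿ) A` is spanned by words starting with a letter `T`. -/
theorem powElt_mul_mem (i n) (y : A) : powElt q η ρ i n * y ∈ W.spanOf W.THead := by
  have h : ∀ l, wordVal η W.val l [] * (powElt q η ρ i n * y) ∈ W.spanOf W.THead := fun l =>
    wordVal_mul_powElt_mul_mem hρ _ W.normal_nil (by simp)
      (fun v i n _ _ _ => ⟨v, i, n, rfl⟩) l i n y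
  have h2 := Submodule.sum_mem _ fun l (_ : l ∈ Finset.univ) => h l
  simp only [wordVal_nil] at h2
  rwa [← Finset.sum_mul, ← map_sum, sum_idem, map_one, one_mul] at h2

omit [Fintype I] in
/-- The ideal generated by the `eᵢ (ρⁿ - qᵢⁿ)` is spanned by words containing a letter `T`. -/
theorem mul_powElt_mul_mem (x : A) (i n) (y : A) :
    x * (powElt q η ρ i n * y) ∈ W.spanOf fun w => ¬ W.TFree w := by
  have hP : ∀ u v i n, ¬ W.TFree (u ++ W.T i n :: v) := fun u v i n h =>
    h (W.T i n) (by simp) i n rfl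
  have key : ∀ u, W.Normal u → (∀ u' j m, u ≠ u' ++ [W.T j m]) → ∀ l i n,
      wordVal η W.val l u * (powElt q η ρ i n * y) ∈ W.spanOf fun w => ¬ W.TFree w :=
    fun u hu hu' l i n =>
      wordVal_mul_powElt_mul_mem hρ _ hu hu' (fun v i n _ _ _ => hP u v i n) l i n y
  refine induction_words (W := W) (C := fun x => x * (powElt q η ρ i n * y) ∈
    W.spanOf fun w => ¬ W.TFree w) x (fun l u hu => ?_) (by simp)
    (fun x y hx hy => by rw [add_mul]; exact add_mem hx hy)
    (fun c x hx => by rw [smul_mul_assoc]; exact Submodule.smul_mem _ _ hx)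
  by_cases hu' : ∃ u' j m, u = u' ++ [W.T j m]
  · obtain ⟨u', j, m, rfl⟩ := hu'
    obtain ⟨h1, -, -, h3, -⟩ := (W.normal_T _ _ _ _).1 hu
    rw [wordVal_append W.val_mul_map, mul_assoc]
    by_cases hj : j = endpt W.hd l u'
    · rw [← hj, wordVal_T_cons_self, wordVal_nil, powElt_mul_map q η hρ, smul_mul_assoc,
      mul_smul_comm]
      refine Submodule.smul_mem _ _ ?_
      by_cases hij : j = i
      · subst hij
        rw [← mul_assoc (powElt _ _ _ _ _), powElt_mul_powElt q η hρ, sub_mul,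
          sub_mul, mul_sub, mul_sub, smul_mul_assoc, smul_mul_assoc, mul_smul_comm, mul_smul_comm]
        exact sub_mem (sub_mem (key _ h1 h3 _ _ _) (Submodule.smul_mem _ _ (key _ h1 h3 _ _ _)))
          (Submodule.smul_mem _ _ (key _ h1 h3 _ _ _))
      · rw [← mul_assoc (powElt _ _ _ _ _), powElt_mul_powElt_of_ne q η hρ hij, zero_mul, mul_zero]
        exact zero_mem _
    · rw [wordVal_T_cons_of_ne hj, zero_mul, mul_zero]; exact zero_mem _
  · push Not at hu'
    exact key u hu (fun u' j m => hu' u' j m) l i n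

omit [Fintype I] in
theorem mul_wordVal_mul_mem (x : A) {l w} (hw : ¬ W.TFree w) (y : A) :
    x * wordVal η W.val l w * y ∈ W.spanOf fun w => ¬ W.TFree w := by
  revert hw
  induction w using W.splitting_induction with
  | h1 u hu => exact fun h => absurd hu h
  | h2 u i n v hu _ =>
    intro _
    rw [wordVal_append W.val_mul_map, wordVal_T_cons, map_mul_powElt]
    simp only [smul_mul_assoc, mul_smul_comm, mul_assoc]
    rw [← mul_assoc x]
    exact Submodule.smul_mem _ _ (mul_powElt_mul_mem hρ _ _ _ _)

end WordBasis

end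

/-! ### The action of `A/(r)` on `A` -/

section

namespace WordBasis

variable {k : Type*} [Field k] {I : Type*} [Fintype I] {A : Type*} [Ring A]
    [Algebra k A] {η : (I → k) →ₐ[k] A} {q : I → kˣ} {ρ : Aˣ} {ℓ : Type*}
    (W : WordBasis η q ρ ℓ) (hρ : ∀ c, Commute (η c) ρ)

open Classical in
/-- The projection of `A` onto the span of the words without letters `T`, killing all other
words. -/
def projTFree : A →ₗ[k] A :=
  W.basis.constr k fun p => if W.TFree p.1.2 then wordVal η W.val p.1.1 p.1.2 else 0

variable {W}

omit [Fintype I] in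
theorem wordVal_eq_basis_or (i : I) {w : List ℓ} (hw : W.Normal w) :
    (∃ h, wordVal η W.val i w = W.basis ⟨(i, w), hw, h⟩) ∨ wordVal η W.val i w = 0 := by
  by_cases h : Composable W.tl W.hd i w
  · exact Or.inl ⟨h, (W.basis_apply ⟨(i, w), hw, h⟩).symm⟩
  · exact Or.inr (wordVal_of_not_composable W.map_mul_val W.val_mul_map w i h)

omit [Fintype I] in
theorem projTFree_of_tFree {i : I} {w : List ℓ} (hn : W.Normal w) (hw : W.TFree w) :
    W.projTFree (wordVal η W.val i w) = wordVal η W.val i w := by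
  rcases wordVal_eq_basis_or (W := W) i hn with ⟨h, h'⟩ | h'
  · conv_lhs => rw [h']
    rw [projTFree, Module.Basis.constr_basis, if_pos hw]
  · rw [h', map_zero]

omit [Fintype I] in
theorem projTFree_of_not_tFree {i : I} {w : List ℓ} (hn : W.Normal w) (hw : ¬ W.TFree w) :
    W.projTFree (wordVal η W.val i w) = 0 := by
  rcases wordVal_eq_basis_or (W := W) i hn with ⟨h, h'⟩ | h'
  · rw [h', projTFree, Module.Basis.constr_basis, if_neg hw]
  · rw [h', map_zero]

omit [Fintype I] in
theorem projTFree_of_mem {x : A} (hx : x ∈ W.spanOf fun w => ¬ W.TFree w) : W.projTFree x = 0 :=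
  spanOf_induction (C := fun x => W.projTFree x = 0) hx (fun _ _ hn hw =>
    projTFree_of_not_tFree hn hw) (map_zero _)
    (fun x y hx hy => by rw [map_add, hx, hy, add_zero])
    (fun c x hx => by rw [map_smul, hx, smul_zero])

omit [Fintype I] in
theorem projTFree_of_mem_tFree {x : A} (hx : x ∈ W.spanOf W.TFree) : W.projTFree x = x :=
  spanOf_induction (C := fun x => W.projTFree x = x) hx (fun _ _ hn hw =>
    projTFree_of_tFree hn hw) (map_zero _)
    (fun x y hx hy => by rw [map_add, hx, hy])
    (fun c x hx => by rw [map_smul, hx])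

omit [Fintype I] in
theorem projTFree_mem (x : A) : W.projTFree x ∈ W.spanOf W.TFree := by
  refine induction_words (W := W) (C := fun x => W.projTFree x ∈ W.spanOf W.TFree) x
    (fun i w hn => ?_) (by simp) (fun x y hx hy => by rw [map_add]; exact add_mem hx hy)
    (fun c x hx => by rw [map_smul]; exact Submodule.smul_mem _ _ hx)
  by_cases hw : W.TFree w
  · rw [projTFree_of_tFree hn hw]; exact wordVal_mem hn hw
  · rw [projTFree_of_not_tFree hn hw]; exact zero_mem _

omit [Fintype I] in
theorem sub_projTFree_mem (x : A) : x - W.projTFree x ∈ W.spanOf fun w => ¬ W.TFree w := by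
  refine induction_words (W := W)
    (C := fun x => x - W.projTFree x ∈ W.spanOf fun w => ¬ W.TFree w) x
    (fun i w hn => ?_) (by simp)
    (fun x y hx hy => by rw [map_add, add_sub_add_comm]; exact add_mem hx hy)
    (fun c x hx => by rw [map_smul, ← smul_sub]; exact Submodule.smul_mem _ _ hx)
  by_cases hw : W.TFree w
  · rw [projTFree_of_tFree hn hw, sub_self]; exact zero_mem _
  · rw [projTFree_of_not_tFree hn hw, sub_zero]
    exact wordVal_mem (P := fun w => ¬ W.TFree w) hn hw

omit [Fintype I] in
theorem projTFree_map_mul (c : I → k) (x : A) :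
    W.projTFree (η c * x) = η c * W.projTFree x := by
  refine linearMap_ext_words (W := W) (f := W.projTFree ∘ₗ LinearMap.mulLeft k (η c))
    (g := LinearMap.mulLeft k (η c) ∘ₗ W.projTFree) (fun i w hn => ?_) x
  change W.projTFree (η c * _) = η c * _
  rw [map_mul_wordVal, map_smul]
  by_cases hw : W.TFree w
  · rw [projTFree_of_tFree hn hw, map_mul_wordVal]
  · rw [projTFree_of_not_tFree hn hw, mul_zero, smul_zero]

omit [Fintype I] in
theorem projTFree_mul_map (x : A) (c : I → k) :
    W.projTFree (x * η c) = W.projTFree x * η c := by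
  refine linearMap_ext_words (W := W) (f := W.projTFree ∘ₗ LinearMap.mulRight k (η c))
    (g := LinearMap.mulRight k (η c) ∘ₗ W.projTFree) (fun i w hn => ?_) x
  change W.projTFree (_ * η c) = _ * η c
  rw [wordVal_mul_map W.val_mul_map, map_smul]
  by_cases hw : W.TFree w
  · rw [projTFree_of_tFree hn hw, wordVal_mul_map W.val_mul_map]
  · rw [projTFree_of_not_tFree hn hw, zero_mul, smul_zero]

include hρ in
omit [Fintype I] in
/-- The kernel of `projTFree` is the ideal spanned by the words containing a letter `T`, so an inner
projection does not change the result. -/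
theorem projTFree_mul_projTFree (a x : A) :
    W.projTFree (a * W.projTFree x) = W.projTFree (a * x) := by
  have h : ∀ y ∈ W.spanOf fun w => ¬ W.TFree w, W.projTFree (a * y) = 0 := by
    intro y hy
    refine spanOf_induction (C := fun y => W.projTFree (a * y) = 0) hy (fun i w hn hw => ?_)
      (by simp)
      (fun x y hx hy => by rw [mul_add, map_add, hx, hy, add_zero])
      (fun c x hx => by rw [mul_smul_comm, map_smul, hx, smul_zero])
    have := mul_wordVal_mul_mem hρ a (l := i) hw 1
    rw [mul_one] at this
    exact projTFree_of_mem this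
  have h2 := h _ (W.sub_projTFree_mem x)
  rw [mul_sub, map_sub, sub_eq_zero] at h2
  exact h2.symm

variable (W)

/-- `l` is one of the letters `T i n`. -/
def IsT (l : ℓ) : Prop := ∃ i n, l = W.T i n

open Classical in
/-- `a` acts on a word `u v`, with `u` the largest initial piece without letters `T`, by
`u v ↦ proj (a u) v`. -/
def headAct (a : A) : A →ₗ[k] A :=
  W.basis.constr k fun p =>
    W.projTFree (a * wordVal η W.val p.1.1 (p.1.2.takeWhile fun l => ¬ W.IsT l)) *
      wordVal η W.val (endpt W.hd p.1.1 (p.1.2.takeWhile fun l => ¬ W.IsT l))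
        (p.1.2.dropWhile fun l => ¬ W.IsT l)

variable {W}

omit [Fintype I] in
/-- The defining formula of `headAct` holds for all vertices `i` and `j`; both sides vanish if the
words are not composable. -/
theorem headAct_wordVal (a : A) {u v : List ℓ} (hu : W.TFree u) (hu' : W.Normal u)
    (hv : W.Normal v) (h : v = [] ∨ W.THead v) (i j) :
    W.headAct a (wordVal η W.val i u * wordVal η W.val j v) =
      W.projTFree (a * wordVal η W.val i u) * wordVal η W.val j v := by
  classical
  by_cases hj : j = endpt W.hd i u
  · subst hj
    rw [← wordVal_append W.val_mul_map]
    have e1 : (u ++ v).takeWhile (fun l => decide (¬ W.IsT l)) = u := by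
      rw [List.takeWhile_append_of_pos fun a ha => by
        simpa [IsT] using fun i n => hu a ha i n]
      rcases h with rfl | ⟨v, i, n, rfl⟩ <;> simp [IsT]
    have e2 : (u ++ v).dropWhile (fun l => decide (¬ W.IsT l)) = v := by
      rw [List.dropWhile_append_of_pos fun a ha => by
        simpa [IsT] using fun i n => hu a ha i n]
      rcases h with rfl | ⟨v, i, n, rfl⟩ <;> simp [IsT]
    rcases wordVal_eq_basis_or (W := W) i (normal_append hu hu' hv h) with ⟨h', h''⟩ | h'
    · rw [h'', headAct, Module.Basis.constr_basis]
      simp only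
      rw [e1, e2]
    · rw [h', map_zero]
      by_cases hc : Composable W.tl W.hd i u
      · have hc' : ¬ Composable W.tl W.hd (endpt W.hd i u) v := by
          intro hc'
          have h1 := W.basis.ne_zero ⟨(i, u ++ v), normal_append hu hu' hv h,
            (composable_append _ _ _ _ _).2 ⟨hc, hc'⟩⟩
          rw [basis_apply] at h1
          exact h1 h'
        rw [wordVal_of_not_composable W.map_mul_val W.val_mul_map v _ hc', mul_zero]
      · rw [wordVal_of_not_composable W.map_mul_val W.val_mul_map u _ hc, mul_zero, map_zero,
          zero_mul]
  · have h1 : wordVal η W.val j v = η (idem k j) * wordVal η W.val j v := by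
      rw [map_mul_wordVal]; simp [idem]
    rw [h1, ← mul_assoc, ← mul_assoc, ← projTFree_mul_map, mul_assoc a,
      wordVal_mul_map W.val_mul_map]
    simp [idem, Ne.symm hj]

omit [Fintype I] in
theorem headAct_mul_wordVal (a : A) {z : A} (hz : z ∈ W.spanOf W.TFree) {v : List ℓ}
    (hv : W.Normal v) (h : v = [] ∨ W.THead v) (j) :
    W.headAct a (z * wordVal η W.val j v) = W.projTFree (a * z) * wordVal η W.val j v :=
  spanOf_induction (C := fun z => W.headAct a (z * wordVal η W.val j v) =
    W.projTFree (a * z) * wordVal η W.val j v) hz (fun i u hu' hu =>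
      headAct_wordVal a hu hu' hv h i j) (by simp)
    (fun x y hx hy => by rw [add_mul, map_add, hx, hy, mul_add, map_add, add_mul])
    (fun c x hx => by
      rw [smul_mul_assoc, map_smul, hx, mul_smul_comm, map_smul, smul_mul_assoc])

omit [Fintype I] in
/-- Linear maps agree if they do so on products `z v` with `z` in the span of the words without
letters `T`, and `v` empty or starting with a letter `T`. -/
theorem ext_split {M : Type*} [AddCommGroup M] [Module k M] {f g : A →ₗ[k] M}
    (h : ∀ z ∈ W.spanOf W.TFree, ∀ j v, W.Normal v → v = [] ∨ W.THead v →
      f (z * wordVal η W.val j v) = g (z * wordVal η W.val j v)) : f = g := by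
  refine LinearMap.ext fun x => linearMap_ext_words (W := W) (fun i w hw => ?_) x
  obtain ⟨u, v, hs, hu, hu', hv, hv'⟩ := exists_splitting hw
  rw [wordVal_split hs]
  exact h _ (wordVal_mem hu' hu) _ _ hv hv'

variable (W)

/-- `headAct` as an algebra map. -/
def headActHom : A →ₐ[k] Module.End k A :=
  AlgHom.ofLinearMap
    { toFun := W.headAct
      map_add' := fun a b => ext_split (W := W) fun z hz j v hv hv' => by
        rw [LinearMap.add_apply, headAct_mul_wordVal _ hz hv hv', headAct_mul_wordVal _ hz hv hv',
          headAct_mul_wordVal _ hz hv hv', add_mul, map_add, add_mul]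
      map_smul' := fun c a => ext_split (W := W) fun z hz j v hv hv' => by
        rw [RingHom.id_apply, LinearMap.smul_apply, headAct_mul_wordVal _ hz hv hv',
          headAct_mul_wordVal _ hz hv hv', smul_mul_assoc, map_smul, smul_mul_assoc] }
    (ext_split (W := W) fun z hz j v hv hv' => by
      change W.headAct 1 _ = _
      rw [headAct_mul_wordVal _ hz hv hv', one_mul, projTFree_of_mem_tFree hz]
      rfl)
    (fun a b => ext_split (W := W) fun z hz j v hv hv' => by
      change W.headAct (a * b) _ = W.headAct a (W.headAct b _)
      rw [headAct_mul_wordVal _ hz hv hv', headAct_mul_wordVal _ hz hv hv',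
        headAct_mul_wordVal _ (projTFree_mem _) hv hv', projTFree_mul_projTFree hρ, mul_assoc])

end WordBasis

end

/-! ### The action of the free product and the strong free product property -/

section

namespace LocPoly

variable {k : Type*} [Field k] {I : Type*} (q : I → kˣ)

/-- The unit `q + t` of `S[t, (q + t)⁻¹]`. -/
def unitQT : (LocPoly fun i => (q i : k))ˣ := (isUnit_base_add_t (k := k) fun i => (q i : k)).unit

theorem coe_unitQT : (unitQT q : LocPoly fun i => (q i : k)) =
    ofBase k (fun i => (q i : k)) (fun i => q i) + t (fun i => (q i : k)) :=
  IsUnit.unit_spec _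

/-- `S[t, (q + t)⁻¹]` is generated by `S` and the powers of `q + t`. -/
theorem induction_zpow {C : LocPoly (fun i => (q i : k)) → Prop}
    (h1 : ∀ c, C (ofBase k _ c)) (h2 : ∀ n : ℤ, C ((unitQT q ^ n :) : _))
    (hadd : ∀ x y, C x → C y → C (x + y)) (hmul : ∀ x y, C x → C y → C (x * y))
    (b : LocPoly fun i => (q i : k)) : C b := by
  have ht : C (t _) := by
    have e : t (fun i => (q i : k)) = ((unitQT q ^ (1 : ℤ) :) : LocPoly fun i => (q i : k)) +
        ofBase k _ (-fun i => (q i : k)) := by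
      rw [zpow_one, coe_unitQT, map_neg]; abel
    rw [e]
    exact hadd _ _ (h2 1) (h1 _)
  have hp : ∀ p, C (algebraMap (I → k)[X] _ p) := by
    intro p
    induction p using Polynomial.induction_on with
    | C c => exact h1 c
    | add f g hf hg => rw [map_add]; exact hadd _ _ hf hg
    | monomial n c h => rw [pow_succ, ← mul_assoc, map_mul]; exact hmul _ _ h ht
  obtain ⟨p, n, h⟩ := exists_mul_pow (k := k) b
  have e : b = algebraMap (I → k)[X] _ p * ((unitQT q ^ (-(n : ℤ)) :) : LocPoly _) := by
    rw [← h, ← coe_unitQT, zpow_neg, zpow_natCast, ← Units.val_pow_eq_pow_val,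
      Units.mul_inv_cancel_right]
  rw [e]
  exact hmul _ _ (hp p) (h2 _)

end LocPoly

namespace WordBasis

variable {k : Type*} [Field k] {I : Type*} [Fintype I] {A : Type*} [Ring A]
    [Algebra k A] {η : (I → k) →ₐ[k] A} {q : I → kˣ} {ρ : Aˣ} {ℓ : Type*}
    (W : WordBasis η q ρ ℓ) (r : A) (hρr : (ρ : A) = η (fun i => q i) + r)
    (hr : ∀ c, Commute (η c) r)

omit [Fintype I] in
include hρr hr in
theorem commute_of_eq (c : I → k) : Commute (η c) (ρ : A) := by
  rw [hρr]
  exact ((Commute.all c _).map η).add_right (hr c)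

include hρr in
theorem relation_eq_sum : r = ∑ i, powElt q η ρ i 1 := by
  have : ∀ i, powElt q η ρ i 1 = η (idem k i) * r := by
    intro i
    rw [powElt, zpow_one, zpow_one, hρr, mul_sub, mul_add, ← map_mul, mul_comm (idem k i), mul_idem,
      map_smul, ← Algebra.commutes, ← Algebra.smul_def, add_sub_cancel_left]
  simp only [this]
  rw [← Finset.sum_mul, ← map_sum, sum_idem, map_one, one_mul]

variable {W}

include hρr hr in
theorem relation_mul_mem (y : A) : r * y ∈ W.spanOf W.THead := by
  rw [relation_eq_sum (q := q) r hρr, Finset.sum_mul]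
  exact Submodule.sum_mem _ fun i _ => powElt_mul_mem (commute_of_eq r hρr hr) i 1 y

include hρr hr in
theorem projTFree_relation_mul (y : A) : W.projTFree (r * y) = 0 := by
  refine projTFree_of_mem ?_
  rw [relation_eq_sum (q := q) r hρr, Finset.sum_mul]
  refine Submodule.sum_mem _ fun i _ => ?_
  have := mul_powElt_mul_mem (W := W) (commute_of_eq r hρr hr) 1 i 1 y
  rwa [one_mul] at this

theorem sum_wordVal_nil : ∑ i, wordVal η W.val i [] = 1 := by
  simp only [wordVal_nil]
  rw [← map_sum, sum_idem, map_one]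

theorem headAct_of_head (a : A) {v : List ℓ} (hv : W.Normal v) (h : v = [] ∨ W.THead v) (j) :
    W.headAct a (wordVal η W.val j v) = W.projTFree a * wordVal η W.val j v := by
  have e : ∀ i, W.headAct a (wordVal η W.val i [] * wordVal η W.val j v) =
      W.projTFree (a * wordVal η W.val i []) * wordVal η W.val j v := fun i =>
    headAct_wordVal a tFree_nil W.normal_nil hv h i j
  have e2 := Finset.sum_congr (s₁ := Finset.univ) rfl fun i _ => e i
  rwa [← map_sum, ← Finset.sum_mul, ← Finset.sum_mul, ← map_sum, ← Finset.mul_sum, sum_wordVal_nil,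
    one_mul, mul_one] at e2

theorem headAct_one (a : A) : W.headAct a 1 = W.projTFree a := by
  conv_lhs => rw [← sum_wordVal_nil (W := W), map_sum]
  rw [Finset.sum_congr rfl fun i _ => headAct_of_head a W.normal_nil (Or.inl rfl) i,
    ← Finset.mul_sum, sum_wordVal_nil, mul_one]

include hρr hr in
/-- On `r A`, which is spanned by words starting with a letter `T`, the action is left
multiplication by the projection. -/
theorem headAct_relation_mul (a y : A) : W.headAct a (r * y) = W.projTFree a * (r * y) :=
  spanOf_induction (C := fun x => W.headAct a x = W.projTFree a * x)
    (relation_mul_mem r hρr hr y) (fun _ _ hn hw => headAct_of_head a hn (Or.inr hw) _) (by simp)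
    (fun x y hx hy => by rw [map_add, hx, hy, mul_add])
    (fun c x hx => by rw [map_smul, hx, mul_smul_comm])

variable (W)

/-- The action `headAct` descends to `A/(r)`. -/
def quotAct : QuotBy k r →ₐ[k] Module.End k A :=
  RingQuot.liftAlgHom k ⟨W.headActHom (commute_of_eq r hρr hr), by
    rintro x y ⟨rfl, rfl⟩
    rw [map_zero]
    refine ext_split (W := W) fun z hz j v hv hv' => ?_
    change W.headAct x _ = 0
    rw [headAct_mul_wordVal _ hz hv hv', projTFree_relation_mul x hρr hr, zero_mul]⟩

theorem quotAct_mk (a : A) : W.quotAct r hρr hr (QuotBy.mk k r a) = W.headAct a :=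
  RingQuot.liftAlgHom_mkAlgHom_apply k _ _ _

/-- The section `A/(r) → A` whose image is spanned by the words without letters `T`. -/
def quotSection : QuotBy k r →ₗ[k] A :=
  LinearMap.applyₗ (1 : A) ∘ₗ (W.quotAct r hρr hr).toLinearMap

theorem quotSection_mk (a : A) : W.quotSection r hρr hr (QuotBy.mk k r a) = W.projTFree a := by
  change W.quotAct r hρr hr (QuotBy.mk k r a) 1 = _
  rw [quotAct_mk, headAct_one]

include hρr in
omit [Fintype I] in
theorem mk_powElt (i : I) (n : ℤ) : QuotBy.mk k r (powElt q η ρ i n) = 0 := by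
  rw [map_powElt]
  refine powElt_eq_zero q _ ?_ i n
  change QuotBy.mk k r ρ = _
  rw [hρr, map_add, QuotBy.mk_self, add_zero]
  rfl

include hρr in
omit [Fintype I] in
theorem mk_projTFree (a : A) : QuotBy.mk k r (W.projTFree a) = QuotBy.mk k r a := by
  symm
  rw [← sub_eq_zero, ← map_sub]
  refine spanOf_induction (C := fun x => QuotBy.mk k r x = 0) (W.sub_projTFree_mem a)
    (fun i w hn hw => ?_) (by simp) (fun x y hx hy => by rw [map_add, hx, hy, add_zero])
    (fun c x hx => by rw [map_smul, hx, smul_zero])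
  revert hw
  clear hn
  induction w using W.splitting_induction with
  | h1 u hu => exact fun h => absurd hu h
  | h2 u j n v hu _ =>
    intro _
    rw [wordVal_append W.val_mul_map, wordVal_T_cons, map_mul, map_mul, map_mul, mk_powElt r hρr,
      mul_zero, zero_mul, mul_zero]

theorem isBimoduleSection : IsBimoduleSection η r (W.quotSection r hρr hr) where
  section_eq x := by
    obtain ⟨a, rfl⟩ := QuotBy.mk_surjective r x
    rw [quotSection_mk, mk_projTFree W r hρr]
  map_one := by
    rw [← map_one (QuotBy.mk k r), quotSection_mk]
    have : (1 : A) = ∑ i, wordVal η W.val i [] := sum_wordVal_nil.symm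
    rw [this, map_sum]
    exact Finset.sum_congr rfl fun i _ => projTFree_of_tFree W.normal_nil tFree_nil
  map_bimodule c x c' := by
    obtain ⟨a, rfl⟩ := QuotBy.mk_surjective r x
    have : quotUnit η r c * QuotBy.mk k r a * quotUnit η r c' =
        QuotBy.mk k r (η c * a * η c') := by rw [map_mul, map_mul]; rfl
    rw [this, quotSection_mk, quotSection_mk, projTFree_mul_map, projTFree_map_mul]

variable (hq' : IsUnit (η (fun i => (q i : k)) + r))

/-- The structure map `S[t, (q + t)⁻¹] → A`. -/
abbrev tauHom : LocPoly (fun i => (q i : k)) →ₐ[k] A := LocPoly.toAlg η r hr _ hq'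

omit [Fintype I] in
theorem tauHom_powElt (hρr : (ρ : A) = η (fun i => q i) + r) (i n) :
    tauHom r hr hq' (powElt q (LocPoly.ofBase k _) (LocPoly.unitQT q) i n) = powElt q η ρ i n := by
  rw [map_powElt]
  congr 1
  · exact AlgHom.ext fun c => LocPoly.toAlg_ofBase _ _ hr _ hq' c
  · refine Units.ext ?_
    rw [hρr]
    change tauHom r hr hq' (LocPoly.unitQT q : LocPoly _) = _
    rw [LocPoly.coe_unitQT, map_add, tauHom, LocPoly.toAlg_ofBase, LocPoly.toAlg_t]

/-- The action of `A/(r) *_S S[t, (q + t)⁻¹]` on `A`: the factor `A/(r)` acts by `quotAct`, the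
other one by left multiplication. -/
def freeProdAct : QuotFreeProd η r (fun i => (q i : k)) →ₐ[k] Module.End k A :=
  FreeProd.lift (W.quotAct r hρr hr) ((Algebra.lmul k A).comp (tauHom r hr hq')) (by
    intro c
    refine ext_split (W := W) fun z hz j v hv hv' => ?_
    change W.quotAct r hρr hr (QuotBy.mk k r (η c)) _ = tauHom r hr hq' _ * _
    rw [quotAct_mk, headAct_mul_wordVal _ hz hv hv', tauHom, LocPoly.toAlg_ofBase,
      projTFree_map_mul, projTFree_of_mem_tFree hz, mul_assoc])

theorem freeProdAct_inl (a : QuotBy k r) :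
    W.freeProdAct r hρr hr hq' (FreeProd.inl _ _ a) = W.quotAct r hρr hr a :=
  FreeProd.lift_inl _ _ _ a

theorem freeProdAct_inr (b) (x : A) :
    W.freeProdAct r hρr hr hq' (FreeProd.inr _ _ b) x = tauHom r hr hq' b * x := by
  rw [freeProdAct, FreeProd.lift_inr]; rfl

/-- Applied to `1`, the action of the free product computes the map of the strong free product
property. -/
theorem freeProdAct_altWord (w) : ∀ a₀, (∀ p ∈ w, p.1 ∈ LocPoly.augIdeal _) →
    W.freeProdAct r hρr hr hq' (altWord η r (fun i => (q i : k)) a₀ w) 1 =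
      W.quotSection r hρr hr a₀ *
        (w.map fun p => tauHom r hr hq' p.1 * W.quotSection r hρr hr p.2).prod := by
  induction w with
  | nil =>
    intro a₀ _
    rw [altWord_nil, freeProdAct_inl, List.map_nil, List.prod_nil, mul_one]
    rfl
  | cons p w ih =>
    obtain ⟨b, a₁⟩ := p
    intro a₀ hw
    obtain ⟨a, rfl⟩ := QuotBy.mk_surjective r a₀
    -- `b ∈ tB` acts by `r` times something, and on such elements `A/(r)` acts by multiplication.
    obtain ⟨b', hb'⟩ := Ideal.mem_span_singleton'.1 (hw (b, a₁) (by simp))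
    have hτ : tauHom r hr hq' b = r * tauHom r hr hq' b' := by
      rw [← show b' * LocPoly.t _ = b from hb', mul_comm, map_mul]
      congr 1
      exact LocPoly.toAlg_t _ _ _ _ _
    rw [altWord_cons, map_mul, map_mul, Module.End.mul_apply, Module.End.mul_apply, freeProdAct_inr,
      freeProdAct_inl, ih a₁ fun p hp => hw p (by simp [hp]), quotAct_mk, hτ, mul_assoc r,
      headAct_relation_mul r hρr hr, quotSection_mk, List.map_cons, List.prod_cons, hτ]
    simp only [mul_assoc]

open Classical in
/-- The element of `A/(r) *_S S[t, (q + t)⁻¹]` corresponding to a letter: `T i n` goes to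
`eᵢ ((q + t)ⁿ - qᵢⁿ)`, the other letters to their classes in `A/(r)`. -/
def letterF (a : ℓ) : QuotFreeProd η r (fun i => (q i : k)) :=
  if h : W.IsT a then FreeProd.inr _ _ (powElt q (LocPoly.ofBase k _) (LocPoly.unitQT q) (W.tl a)
    h.choose_spec.choose) else FreeProd.inl _ _ (QuotBy.mk k r (W.val a))

omit [Fintype I] in
theorem letterF_T (i n) : W.letterF r (W.T i n) =
    FreeProd.inr _ _ (powElt q (LocPoly.ofBase k _) (LocPoly.unitQT q) i n) := by
  have h : W.IsT (W.T i n) := ⟨i, n, rfl⟩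
  rw [letterF, dif_pos h, W.tl_T, ← W.T_injective _ _ _ _ h.choose_spec.choose_spec]

omit [Fintype I] in
theorem letterF_of_not_isT {a : ℓ} (h : ¬ W.IsT a) :
    W.letterF r a = FreeProd.inl _ _ (QuotBy.mk k r (W.val a)) := by
  rw [letterF, dif_neg h]

omit [Fintype I] in
theorem commute_unitQT (c : I → k) :
    Commute (LocPoly.ofBase k (fun i => (q i : k)) c) (LocPoly.unitQT q) := Commute.all _ _

omit [Fintype I] in
theorem baseF_eq_inr (c : I → k) : baseF η r (fun i => (q i : k)) c =
    FreeProd.inr _ _ (LocPoly.ofBase k _ c) := FreeProd.inl_apply_eq_inr_apply _ _ c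

omit [Fintype I] in
theorem baseF_mul_letterF (a : ℓ) (c : I → k) :
    baseF η r (fun i => (q i : k)) c * W.letterF r a = c (W.tl a) • W.letterF r a := by
  by_cases h : W.IsT a
  · obtain ⟨i, n, rfl⟩ := h
    rw [letterF_T, baseF_eq_inr, ← map_mul, map_mul_powElt, map_smul, W.tl_T]
  · rw [letterF_of_not_isT W r h]
    change FreeProd.inl _ _ (QuotBy.mk k r (η c)) * _ = _
    rw [← map_mul, ← map_mul, W.map_mul_val, map_smul, map_smul]

omit [Fintype I] in
theorem letterF_mul_baseF (a : ℓ) (c : I → k) :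
    W.letterF r a * baseF η r (fun i => (q i : k)) c = c (W.hd a) • W.letterF r a := by
  by_cases h : W.IsT a
  · obtain ⟨i, n, rfl⟩ := h
    rw [letterF_T, baseF_eq_inr, ← map_mul, powElt_mul_map q _ commute_unitQT, map_smul, W.hd_T]
  · rw [letterF_of_not_isT W r h]
    change _ * FreeProd.inl _ _ (QuotBy.mk k r (η c)) = _
    rw [← map_mul, ← map_mul, W.val_mul_map, map_smul, map_smul]

/-- The element of `A/(r) *_S S[t, (q + t)⁻¹]` corresponding to a word. -/
abbrev wordF (i : I) (w : List ℓ) : QuotFreeProd η r (fun i => (q i : k)) :=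
  wordVal (baseF η r _) (W.letterF r) i w

omit [Fintype I] in
theorem wordF_of_tFree {u : List ℓ} (hu : W.TFree u) (i : I) :
    W.wordF r i u = FreeProd.inl _ _ (QuotBy.mk k r (wordVal η W.val i u)) := by
  rw [wordF, wordVal, wordVal, map_mul, map_mul, map_list_prod, map_list_prod, List.map_map,
    List.map_map]
  congr 2
  refine List.map_congr_left fun a ha => ?_
  exact letterF_of_not_isT W r fun ⟨i, n, h⟩ => hu a ha i n h

omit [Fintype I] in
theorem wordF_split {w u v : List ℓ} (h : w = u ++ v) (hu : W.TFree u) (i : I) :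
    W.wordF r i w = FreeProd.inl _ _ (QuotBy.mk k r (wordVal η W.val i u)) *
      W.wordF r (endpt W.hd i u) v := by
  rw [← wordF_of_tFree W r hu, h, wordF, wordVal_append (W.letterF_mul_baseF r)]

omit [Fintype I] in
theorem wordF_T_cons (i j n v) : W.wordF r j (W.T i n :: v) = idem k j i •
    (FreeProd.inr _ _ (powElt q (LocPoly.ofBase k _) (LocPoly.unitQT q) i n) * W.wordF r i v) := by
  rw [wordF, wordVal_cons (W.letterF_mul_baseF r), baseF_mul_letterF, W.hd_T, W.tl_T, letterF_T,
    smul_mul_assoc]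

theorem freeProdAct_wordF {w : List ℓ} (hw : W.Normal w) (i : I) :
    W.freeProdAct r hρr hr hq' (W.wordF r i w) 1 = wordVal η W.val i w := by
  revert hw i
  induction w using W.splitting_induction with
  | h1 u hu =>
    intro hn i
    rw [wordF_of_tFree W r hu, freeProdAct_inl, quotAct_mk, headAct_one, projTFree_of_tFree hn hu]
  | h2 u j n v hu ih =>
    intro hn i
    have h' := (W.normal_T _ _ _ _).1 hn
    have hv : W.Normal (W.T j n :: v) := normal_T_cons.2 ⟨h'.2.1, h'.2.2.1, h'.2.2.2.2⟩
    rw [wordF_split W r rfl hu, wordVal_split (W := W) rfl, wordF_T_cons, mul_smul_comm, map_smul,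
      map_mul, map_mul, LinearMap.smul_apply, Module.End.mul_apply, Module.End.mul_apply,
      ih h'.2.1, freeProdAct_inr, tauHom_powElt r hr hq' hρr, freeProdAct_inl, quotAct_mk,
      wordVal_T_cons, map_mul_powElt, smul_mul_assoc, mul_smul_comm]
    congr 1
    rw [← wordVal_T_cons_self, headAct_of_head _ hv (Or.inr ⟨_, _, _, rfl⟩),
      projTFree_of_tFree h'.1 hu]

/-- The map sending a basis word of `A` to the corresponding element of
`A/(r) *_S S[t, (q + t)⁻¹]`. -/
def toFreeProd : A →ₗ[k] QuotFreeProd η r (fun i => (q i : k)) :=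
  W.basis.constr k fun p => W.wordF r p.1.1 p.1.2

omit [Fintype I] in
theorem toFreeProd_wordVal {w : List ℓ} (hw : W.Normal w) (i : I) :
    W.toFreeProd r (wordVal η W.val i w) = W.wordF r i w := by
  by_cases h : Composable W.tl W.hd i w
  · rw [← W.basis_apply ⟨(i, w), hw, h⟩, toFreeProd, Module.Basis.constr_basis]
  · rw [wordVal_of_not_composable W.map_mul_val W.val_mul_map w i h,
      wordF, wordVal_of_not_composable (W.baseF_mul_letterF r) (W.letterF_mul_baseF r) w i h,
        map_zero]

/-- Acting on `1` recovers the element of `A`: `toFreeProd` is a section of the map of the strong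
free product property. -/
theorem freeProdAct_toFreeProd (x : A) :
    W.freeProdAct r hρr hr hq' (W.toFreeProd r x) 1 = x :=
  induction_words (W := W) (C := fun x => W.freeProdAct r hρr hr hq' (W.toFreeProd r x) 1 = x) x
    (fun i w hw => by rw [toFreeProd_wordVal W r hw, freeProdAct_wordF W r hρr hr hq' hw])
    (by rw [map_zero, map_zero, LinearMap.zero_apply])
    (fun x y hx hy => by rw [map_add, map_add, LinearMap.add_apply, hx, hy])
    (fun c x hx => by rw [map_smul, map_smul, LinearMap.smul_apply, hx])

omit [Fintype I] in
theorem wordF_mem_range {w : List ℓ} (hw : W.Normal w) (i : I) :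
    W.wordF r i w ∈ LinearMap.range (W.toFreeProd r) := ⟨_, toFreeProd_wordVal W r hw i⟩

include hρr in
omit [Fintype I] in
theorem inl_mul_wordF_mem (a : QuotBy k r) {w : List ℓ} (hw : W.Normal w) (i : I) :
    FreeProd.inl _ _ a * W.wordF r i w ∈ LinearMap.range (W.toFreeProd r) := by
  obtain ⟨a, rfl⟩ := QuotBy.mk_surjective r a
  obtain ⟨u, v, hs, hu, hu', hv, hv'⟩ := exists_splitting hw
  rw [wordF_split W r hs hu, ← mul_assoc, ← map_mul, ← map_mul, ← mk_projTFree W r hρr]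
  refine spanOf_induction (C := fun x => FreeProd.inl _ _ (QuotBy.mk k r x) * W.wordF r _ v ∈
    LinearMap.range (W.toFreeProd r)) (projTFree_mem (W := W) _) (fun i' u' hn' hu' => ?_)
    (by simp) (fun x y hx hy => by rw [map_add, map_add, add_mul]; exact add_mem hx hy)
    (fun c x hx => by
      rw [map_smul, map_smul, smul_mul_assoc]; exact Submodule.smul_mem _ _ hx)
  rw [← wordF_of_tFree W r hu']
  rcases wordVal_mul (hd := W.hd) (W.letterF_mul_baseF r) i' (endpt W.hd i u) u' v with h | h
  · rw [h]; exact wordF_mem_range W r (normal_append hu' hn' hv hv') _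
  · rw [h]; exact zero_mem _

omit [Fintype I] in
theorem inr_powElt_mul_wordF_mem (n : ℤ) {w : List ℓ} (hw : W.Normal w) (i : I) :
    FreeProd.inr _ _ (powElt q (LocPoly.ofBase k _) (LocPoly.unitQT q) i n) * W.wordF r i w ∈
      LinearMap.range (W.toFreeProd r) := by
  have h0 : ∀ n v, W.Normal v → (∀ v' j m, v ≠ W.T j m :: v') →
      FreeProd.inr _ _ (powElt q (LocPoly.ofBase k _) (LocPoly.unitQT q) i n) * W.wordF r i v ∈
      LinearMap.range (W.toFreeProd r) := by
    intro n v hv hv'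
    by_cases hn : n = 0
    · subst hn; rw [powElt_zero, map_zero, zero_mul]; exact zero_mem _
    have h1 := wordF_mem_range W r (w := W.T i n :: v) (normal_T_cons.2 ⟨hv, hn, hv'⟩) i
    rw [wordF_T_cons] at h1
    simpa [idem] using h1
  by_cases hv' : ∃ v' j m, w = W.T j m :: v'
  · obtain ⟨v', j, m, rfl⟩ := hv'
    obtain ⟨h1, h2, h3⟩ := normal_T_cons.1 hw
    by_cases hij : j = i
    · subst hij
      rw [wordF_T_cons, mul_smul_comm, ← mul_assoc, ← map_mul, powElt_mul_powElt q _ commute_unitQT,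
        map_sub, map_sub, map_smul, map_smul, sub_mul, sub_mul, smul_mul_assoc, smul_mul_assoc]
      exact Submodule.smul_mem _ _ (sub_mem (sub_mem (h0 _ _ h1 h3)
        (Submodule.smul_mem _ _ (h0 _ _ h1 h3))) (Submodule.smul_mem _ _ (h0 _ _ h1 h3)))
    · rw [wordF_T_cons]
      simp [idem, hij]
  · push Not at hv'
    exact h0 _ _ hw fun v' j m => hv' v' j m

omit [Fintype I] in
theorem inr_zpow_mul_wordF_mem (n : ℤ) {w : List ℓ} (hw : W.Normal w) (i : I) :
    FreeProd.inr _ _ ((LocPoly.unitQT q ^ n :) : LocPoly _) * W.wordF r i w ∈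
      LinearMap.range (W.toFreeProd r) := by
  have e : W.wordF r i w = FreeProd.inr _ _ (LocPoly.ofBase k _ (idem k i)) * W.wordF r i w := by
    rw [← baseF_eq_inr, map_mul_wordVal]; simp [idem]
  have e2 : FreeProd.inr _ _ ((LocPoly.unitQT q ^ n :) : LocPoly _) * W.wordF r i w =
      FreeProd.inr _ _ (powElt q (LocPoly.ofBase k _) (LocPoly.unitQT q) i n) * W.wordF r i w +
        (q i ^ n : kˣ).1 • W.wordF r i w := by
    conv_lhs => rw [e]
    rw [← mul_assoc, ← map_mul, mul_comm, idem_mul_zpow, map_add, map_smul, add_mul,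
      smul_mul_assoc, ← e]
  rw [e2]
  exact add_mem (inr_powElt_mul_wordF_mem W r n hw i)
    (Submodule.smul_mem _ _ (wordF_mem_range W r hw i))

include hρr in
/-- `toFreeProd` is surjective: its range contains `1` and is stable under left multiplication by
both factors. -/
theorem range_toFreeProd : LinearMap.range (W.toFreeProd r) = ⊤ := by
  have ext : ∀ f, (∀ w i, W.Normal w → f * W.wordF r i w ∈ LinearMap.range (W.toFreeProd r)) →
      ∀ y ∈ LinearMap.range (W.toFreeProd r), f * y ∈ LinearMap.range (W.toFreeProd r) := by
    rintro f hf _ ⟨x, rfl⟩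
    refine induction_words (W := W) (C := fun x => f * W.toFreeProd r x ∈
      LinearMap.range (W.toFreeProd r)) x (fun i w hw => ?_) (by simp)
      (fun x y hx hy => by rw [map_add, mul_add]; exact add_mem hx hy)
      (fun c x hx => by rw [map_smul, mul_smul_comm]; exact Submodule.smul_mem _ _ hx)
    rw [toFreeProd_wordVal W r hw]
    exact hf w i hw
  have hinl : ∀ a, ∀ y ∈ LinearMap.range (W.toFreeProd r),
      FreeProd.inl _ _ a * y ∈ LinearMap.range (W.toFreeProd r) := fun a =>
    ext _ fun w i hw => inl_mul_wordF_mem W r hρr a hw i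
  have key : ∀ f, ∀ y ∈ LinearMap.range (W.toFreeProd r),
      f * y ∈ LinearMap.range (W.toFreeProd r) := by
    refine FreeProd.induction hinl (fun b => ?_)
      (fun x y hx hy z hz => by rw [add_mul]; exact add_mem (hx z hz) (hy z hz))
      (fun x y hx hy z hz => by rw [mul_assoc]; exact hx _ (hy z hz))
    refine LocPoly.induction_zpow q (C := fun b => ∀ y ∈ LinearMap.range (W.toFreeProd r),
      FreeProd.inr _ _ b * y ∈ LinearMap.range (W.toFreeProd r)) (fun c => ?_) (fun n => ?_)
      (fun x y hx hy z hz => by rw [map_add, add_mul]; exact add_mem (hx z hz) (hy z hz))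
      (fun x y hx hy z hz => by rw [map_mul, mul_assoc]; exact hx _ (hy z hz)) b
    · rw [← baseF_eq_inr]; exact hinl _
    · exact ext _ fun w i hw => inr_zpow_mul_wordF_mem W r n hw i
  rw [eq_top_iff]
  rintro f -
  have h1 : (1 : QuotFreeProd η r (fun i => (q i : k))) ∈ LinearMap.range (W.toFreeProd r) := by
    have : (1 : QuotFreeProd η r (fun i => (q i : k))) = ∑ i, W.wordF r i [] := by
      simp only [wordVal_nil]
      rw [← map_sum, sum_idem, map_one]
    rw [this]
    exact Submodule.sum_mem _ fun i _ => wordF_mem_range W r W.normal_nil i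
  simpa using key f 1 h1

include W hρr in
/-- An algebra with a word basis of the required kind has the strong free product property. -/
theorem strongFreeProductProperty : ∃ σ, IsBimoduleSection η r σ ∧
    StrongFreeProductProperty η r hr (fun i => (q i : k)) hq' σ := by
  refine ⟨W.quotSection r hρr hr, W.isBimoduleSection r hρr hr, LinearMap.applyₗ (1 : A) ∘ₗ
    (W.freeProdAct r hρr hr hq').toLinearMap, fun a₀ w hw =>
      W.freeProdAct_altWord r hρr hr hq' w a₀ hw, ?_, fun x =>
      ⟨_, W.freeProdAct_toFreeProd r hρr hr hq' x⟩⟩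
  intro f g hfg
  have hf : f ∈ LinearMap.range (W.toFreeProd r) := by rw [W.range_toFreeProd r hρr]; trivial
  have hg : g ∈ LinearMap.range (W.toFreeProd r) := by rw [W.range_toFreeProd r hρr]; trivial
  obtain ⟨x, rfl⟩ := hf
  obtain ⟨y, rfl⟩ := hg
  have e1 : x = y := (W.freeProdAct_toFreeProd r hρr hr hq' x).symm.trans
    (hfg.trans (W.freeProdAct_toFreeProd r hρr hr hq' y))
  rw [e1]

end WordBasis

end

/-! ### Frames, normal words and Laurent operators -/

section

/-- Indices of the invertible elements whose powers occur as letters: `rho i` stands for the product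
of the arrows at the vertex `i`, `rest e` for `1 + c s` on an edge `e` not assigned to a vertex, and
`cycle i`, for a vertex `i` of the cycle, for a conjugate of `1 + s c` on the edge of the cycle
entering `i`. -/
inductive LaurentIndex (I E : Type*)
  | rho (i : I)
  | rest (e : E)
  | cycle (i : I)

/-- Letters: powers `lau y n` of invertible elements, up to a scalar, and the two arrows
`c e : t → h` and `s e : h → t` of the double quiver given by an edge `e` with end points `t` and
`h`. -/
inductive Letter (I E : Type*)
  | lau (y : LaurentIndex I E) (n : ℤ)
  | c (e : E)
  | s (e : E)

/-- Combinatorial data organizing the double quiver of a connected graph with edge set `E` that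
contains a cycle. Edges are oriented from `te e` to `he e`; every vertex `i` is assigned an edge
`d i` leaving it. Following these edges from any vertex leads into the cycle `cyc`, on which
`prd` is the inverse of `i ↦ he (d i)`; outside the cycle `rank` increases along them.
The arrows of the double quiver are elements of `E ⊕ E`, where `Sum.inl e` leads from `te e` to
`he e` and `Sum.inr e` is its opposite. The ordered list of the arrows with tail `i` is cut into the
pieces `L₁ i`, `L₂ i`, `L₃ i` by the arrow `Sum.inl (d i)` and, if `i` lies on the cycle, by the
arrow `Sum.inr (d (prd i))`, the latter coming first if `negFirst i` holds; outside the cycle only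
`L₁` and `L₃` matter. See `Frame.arrowList`. -/
structure Frame (I E : Type*) where
  te : E → I
  he : E → I
  d : I → E
  te_d : ∀ i, te (d i) = i
  cyc : Set I
  prd : I → I
  he_d_mem : ∀ i ∈ cyc, he (d i) ∈ cyc
  prd_mem : ∀ i ∈ cyc, prd i ∈ cyc
  he_d_prd : ∀ i ∈ cyc, he (d (prd i)) = i
  prd_he_d : ∀ i ∈ cyc, prd (he (d i)) = i
  rank : I → ℕ
  rank_lt : ∀ i, i ∉ cyc → rank i < rank (he (d i))
  negFirst : I → Prop
  L₁ : I → List (E ⊕ E)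
  L₂ : I → List (E ⊕ E)
  L₃ : I → List (E ⊕ E)
  pos_mem : ∀ i e, Sum.inl e ∈ L₁ i ++ L₂ i ++ L₃ i → te e = i ∧ d (te e) ≠ e
  neg_mem : ∀ i e, Sum.inr e ∈ L₁ i ++ L₂ i ++ L₃ i → he e = i ∧ (d (te e) = e → te e ∉ cyc)

namespace Frame

variable {I E : Type*} (F : Frame I E)

/-- Edges of the cycle. -/
def IsCyc (e : E) : Prop := F.d (F.te e) = e ∧ F.te e ∈ F.cyc

theorem isCyc_d {i : I} : F.IsCyc (F.d i) ↔ i ∈ F.cyc := by simp [IsCyc, F.te_d]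

/-- The powers `lau y n` that are used. -/
def Admissible : LaurentIndex I E → Prop
  | .rho _ => True
  | .rest e => F.d (F.te e) ≠ e
  | .cycle i => i ∈ F.cyc

/-- The letters that are used. -/
def Valid : Letter I E → Prop
  | .lau y n => n ≠ 0 ∧ F.Admissible y
  | .c _ => True
  | .s _ => True

/-- Pairs of letters that may not be adjacent. Powers of one element are merged, `c s` is one less
than an invertible element and so is `s c`. On the cycle, moreover, powers of `cycle` elements are
moved to the left of `c` and `s`; outside the cycle `1 + s c` is not a letter, and `s c` is
allowed. -/
inductive Forbidden : Letter I E → Letter I E → Prop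
  | lau (y n m) : Forbidden (.lau y n) (.lau y m)
  | c_s (e) : Forbidden (.c e) (.s e)
  | s_c (e) (h : F.IsCyc e) : Forbidden (.s e) (.c e)
  | c_cycle (e n) (h : F.IsCyc e) : Forbidden (.c e) (.lau (.cycle (F.he e)) n)
  | s_cycle (e n) (h : F.IsCyc e) : Forbidden (.s e) (.lau (.cycle (F.te e)) n)

/-- Normal words. -/
def Normal : List (Letter I E) → Prop
  | [] => True
  | a :: w => F.Valid a ∧ (∀ b ∈ w.head?, ¬ F.Forbidden a b) ∧ Normal w

theorem normal_tail {a : Letter I E} {w} (h : F.Normal (a :: w)) : F.Normal w := h.2.2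

variable (k : Type*) [Field k]

/-- The vector space with basis the normal words. -/
def Space : Type _ := {w : List (Letter I E) // F.Normal w} →₀ k

instance : AddCommGroup (F.Space k) :=
  inferInstanceAs (AddCommGroup ({w : List (Letter I E) // F.Normal w} →₀ k))

instance : Module k (F.Space k) :=
  inferInstanceAs (Module k ({w : List (Letter I E) // F.Normal w} →₀ k))

/-- The basis of normal words. -/
def spaceBasis : Module.Basis {w : List (Letter I E) // F.Normal w} k (F.Space k) :=
  Module.Basis.ofRepr (LinearEquiv.refl k ({w : List (Letter I E) // F.Normal w} →₀ k))

open Classical in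
/-- The vector of a word; zero if the word is not normal. -/
def vec (w : List (Letter I E)) : F.Space k :=
  if h : F.Normal w then F.spaceBasis k ⟨w, h⟩ else 0

variable {F k}

theorem vec_of_not {w : List (Letter I E)} (h : ¬ F.Normal w) : F.vec k w = 0 := dif_neg h

theorem vec_of_normal {w : List (Letter I E)} (h : F.Normal w) :
    F.vec k w = F.spaceBasis k ⟨w, h⟩ := dif_pos h

/-- The linear map with prescribed values on words. -/
def lin {M : Type*} [AddCommGroup M] [Module k M] (f : List (Letter I E) → M) : F.Space k →ₗ[k] M :=
  (F.spaceBasis k).constr k fun w => f w.1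

variable {M : Type*} [AddCommGroup M] [Module k M]

theorem lin_vec (f : List (Letter I E) → M) {w} (h : F.Normal w) :
    lin f (F.vec k w) = f w := by
  rw [vec_of_normal h, lin, Module.Basis.constr_basis]

theorem space_ext {f g : F.Space k →ₗ[k] M}
    (h : ∀ w, F.Normal w → f (F.vec k w) = g (F.vec k w)) : f = g := by
  refine (F.spaceBasis k).ext fun w => ?_
  have := h w.1 w.2
  rwa [vec_of_normal w.2] at this

theorem mem_of_vec_mem {N : Submodule k (F.Space k)} (h : ∀ w, F.Normal w → F.vec k w ∈ N)
    (f : F.Space k) : f ∈ N := by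
  suffices h' : ⊤ ≤ N from h' trivial
  rw [← (F.spaceBasis k).span_eq, Submodule.span_le]
  rintro _ ⟨w, rfl⟩
  have := h w.1 w.2
  rwa [vec_of_normal w.2] at this

variable (F k)

/-- Prepending a letter. -/
def app (a : Letter I E) : Module.End k (F.Space k) := lin fun w => F.vec k (a :: w)

variable {F k}

theorem app_vec (a : Letter I E) (w) : F.app k a (F.vec k w) = F.vec k (a :: w) := by
  by_cases h : F.Normal w
  · exact lin_vec _ h
  · rw [vec_of_not h, map_zero, vec_of_not fun h' => h (F.normal_tail h')]

theorem vec_lau_zero (y : LaurentIndex I E) (w) : F.vec k (.lau y 0 :: w) = 0 :=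
  vec_of_not fun h => h.1.1 rfl

/-- Words starting with a power of index `y`. -/
def Headed (y : LaurentIndex I E) (w : List (Letter I E)) : Prop :=
  ∃ n w', w = .lau y n :: w'

theorem not_headed_of_normal {y : LaurentIndex I E} {n w} (h : F.Normal (.lau y n :: w)) :
    ¬ Headed y w := by
  rintro ⟨m, w', rfl⟩
  exact h.2.1 (.lau y m) (by simp) (.lau y n m)

theorem normal_lau {y : LaurentIndex I E} {n w} (hn : n ≠ 0) (hy : F.Admissible y)
    (hw : F.Normal w) (h : ¬ Headed y w) : F.Normal (.lau y n :: w) := by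
  refine ⟨⟨hn, hy⟩, fun b hb hf => ?_, hw⟩
  cases hf with
  | lau _ _ m =>
    rcases w with _ | ⟨a, w⟩
    · simp at hb
    · simp at hb; exact h ⟨m, w, by rw [hb]⟩

section Laurent

variable (F k) (q : I → kˣ)

/-- The letter `lau y n` stands for the `n`-th power minus the scalar `shift q y n`. For `rho i`
this is the choice for which the letter vanishes modulo the relation `ρ = q`. For `rho i` and
`rest e` the shift is multiplicative in `n`, which makes the invertible operator a scalar modulo
words starting with its letters. The powers of index `cycle i` are not shifted, apart from the
convention at `n = 0`, where the letter is to be zero. -/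
def shift : LaurentIndex I E → ℤ → k
  | .rho i, n => (q i ^ n : kˣ)
  | .rest _, _ => 1
  | .cycle _, n => if n = 0 then 1 else 0

omit F in
theorem shift_zero (y : LaurentIndex I E) : shift k q y 0 = 1 := by cases y <;> simp [shift]

/-- The result of applying the `n`-th power of index `y` to a word not starting with such a
power. -/
def powVec (y : LaurentIndex I E) (n : ℤ) (w : List (Letter I E)) : F.Space k :=
  F.vec k (.lau y n :: w) + shift k q y n • F.vec k w

theorem powVec_zero (y : LaurentIndex I E) (w) : F.powVec k q y 0 w = F.vec k w := by
  rw [powVec, vec_lau_zero, shift_zero, zero_add, one_smul]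

open Classical in
/-- The `m`-th power of the invertible operator of index `y`. -/
def lauOp (y : LaurentIndex I E) (m : ℤ) : Module.End k (F.Space k) :=
  lin fun w => match w with
    | .lau y' n :: w' => if y' = y then
        F.powVec k q y (n + m) w' - shift k q y n • F.powVec k q y m w'
      else F.powVec k q y m w
    | _ => F.powVec k q y m w

variable {F k}

theorem lauOp_of_not_headed {y : LaurentIndex I E} (m : ℤ) {w} (hw : F.Normal w)
    (h : ¬ Headed y w) : F.lauOp k q y m (F.vec k w) = F.powVec k q y m w := by
  rw [lauOp, lin_vec _ hw]
  split
  · exact if_neg fun h' => h ⟨_, _, by rw [h']⟩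
  · rfl

theorem lauOp_lau {y : LaurentIndex I E} (m n : ℤ) {w} (hw : F.Normal (.lau y n :: w)) :
    F.lauOp k q y m (F.vec k (.lau y n :: w)) =
      F.powVec k q y (n + m) w - shift k q y n • F.powVec k q y m w := by
  rw [lauOp, lin_vec _ hw]
  exact if_pos rfl

theorem lauOp_powVec {y : LaurentIndex I E} (hy : F.Admissible y) (m n : ℤ) {w}
    (hw : F.Normal w) (h : ¬ Headed y w) :
    F.lauOp k q y m (F.powVec k q y n w) = F.powVec k q y (n + m) w := by
  by_cases hn : n = 0
  · subst hn
    rw [powVec_zero, lauOp_of_not_headed q m hw h, zero_add]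
  · rw [powVec, map_add, map_smul, lauOp_lau q m n (normal_lau hn hy hw h),
      lauOp_of_not_headed q m hw h, sub_add_cancel]

theorem ext_powVec {y : LaurentIndex I E} {f g : F.Space k →ₗ[k] M}
    (h : ∀ n w, F.Normal w → ¬ Headed y w → f (F.powVec k q y n w) = g (F.powVec k q y n w)) :
    f = g := by
  have h0 : ∀ w, F.Normal w → ¬ Headed y w → f (F.vec k w) = g (F.vec k w) := fun w hw hy => by
    rw [← powVec_zero F k q y]; exact h 0 w hw hy
  refine space_ext fun w hw => ?_
  by_cases hy : Headed y w
  · obtain ⟨n, w, rfl⟩ := hy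
    have h1 := F.normal_tail hw
    have h2 := not_headed_of_normal hw
    have e : F.vec k (.lau y n :: w) = F.powVec k q y n w - shift k q y n • F.vec k w := by
      rw [powVec, add_sub_cancel_right]
    rw [e, map_sub, map_sub, map_smul, map_smul, h n w h1 h2, h0 w h1 h2]
  · exact h0 w hw hy

/-- The powers of the invertible operator of index `y`. -/
def lauHom {y : LaurentIndex I E} (hy : F.Admissible y) :
    Multiplicative ℤ →* Module.End k (F.Space k) where
  toFun m := F.lauOp k q y m.toAdd
  map_one' := ext_powVec q (y := y) fun n w hw h => by
    rw [toAdd_one, lauOp_powVec q hy _ _ hw h, add_zero]; rfl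
  map_mul' a b := ext_powVec q (y := y) fun n w hw h => by
    rw [toAdd_mul, Module.End.mul_apply, lauOp_powVec q hy _ _ hw h, lauOp_powVec q hy _ _ hw h,
      lauOp_powVec q hy _ _ hw h, add_assoc, add_comm b.toAdd]

variable (F) in
open Classical in
/-- The invertible operator of index `y`. -/
def lauUnit (y : LaurentIndex I E) : (Module.End k (F.Space k))ˣ :=
  if hy : F.Admissible y then (lauHom q hy).toHomUnits (Multiplicative.ofAdd 1) else 1

theorem coe_lauUnit_zpow {y : LaurentIndex I E} (hy : F.Admissible y) (n : ℤ) :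
    ((F.lauUnit q y ^ n : (Module.End k (F.Space k))ˣ) : Module.End k (F.Space k)) =
      F.lauOp k q y n := by
  rw [lauUnit, dif_pos hy, ← map_zpow, ← ofAdd_zsmul, smul_eq_mul, mul_one]
  rfl

theorem coe_lauUnit {y : LaurentIndex I E} (hy : F.Admissible y) :
    (F.lauUnit q y : Module.End k (F.Space k)) = F.lauOp k q y 1 := by
  rw [← coe_lauUnit_zpow q hy, zpow_one]

end Laurent

end Frame

end

/-! ### Solving the relations outside the cycle -/

section

/-- A functional `Φ` on families such that the `i`-th component of `Φ f` only depends on the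
components of `f` of smaller rank has a fixed point. -/
theorem exists_fixedPoint_of_local {I X : Type*} [Inhabited X] (rank : I → ℕ)
    (Φ : (I → X) → I → X)
    (hΦ : ∀ i f g, (∀ j, rank j < rank i → f j = g j) → Φ f i = Φ g i) :
    ∃ f, ∀ i, f i = Φ f i := by
  have key : ∀ N i, rank i < N → ∀ n m, rank i < n → rank i < m →
      Φ^[n] default i = Φ^[m] default i := by
    intro N
    induction N with
    | zero => intro i hi; exact absurd hi (Nat.not_lt_zero _)
    | succ N ih =>
      intro i hi n m hn hm
      obtain ⟨n, rfl⟩ := Nat.exists_eq_succ_of_ne_zero (Nat.ne_of_gt (Nat.zero_lt_of_lt hn))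
      obtain ⟨m, rfl⟩ := Nat.exists_eq_succ_of_ne_zero (Nat.ne_of_gt (Nat.zero_lt_of_lt hm))
      rw [Function.iterate_succ_apply', Function.iterate_succ_apply']
      exact hΦ i _ _ fun j hj => ih j (by omega) n m (by omega) (by omega)
  refine ⟨fun i => Φ^[rank i + 1] default i, fun i => ?_⟩
  change Φ^[rank i + 1] default i = _
  rw [Function.iterate_succ_apply']
  exact hΦ i _ _ fun j hj => key _ j (Nat.lt_succ_self _) _ _ hj (Nat.lt_succ_self _)

/-- If `1 + cs` is invertible, then so is `1 + sc`. -/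
def swapUnit {R : Type*} [Ring R] (c s : R) (w : Rˣ) (h : c * s = w - 1) : Rˣ where
  val := 1 + s * c
  inv := 1 - s * ↑w⁻¹ * c
  val_inv := by
    have e : (1 + s * c) * (1 - s * ↑w⁻¹ * c) =
      1 + s * c - s * ↑w⁻¹ * c - s * (c * s) * ↑w⁻¹ * c := by noncomm_ring
    rw [e, h, mul_sub, sub_mul (s * (w : R)), mul_assoc s (w : R), Units.mul_inv]
    noncomm_ring
  inv_val := by
    have e : (1 - s * ↑w⁻¹ * c) * (1 + s * c) =
      1 + s * c - s * ↑w⁻¹ * c - s * ↑w⁻¹ * (c * s) * c := by noncomm_ring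
    rw [e, h, mul_sub, mul_assoc s _ (w : R), Units.inv_mul]
    noncomm_ring

namespace Frame

variable {I E : Type*} (F : Frame I E)

section Group

variable {G : Type*} [Group G] (g : E ⊕ E → G) (ρ : I → G)

/-- The value of `Sum.inl (d i)` for which the product of the arrows at a vertex `i` outside the
cycle equals `ρ i`, given the values `g` of the other arrows. -/
def treeVal (i : I) : G := ((F.L₁ i).map g).prod⁻¹ * ρ i * ((F.L₃ i).map g).prod⁻¹

open Classical in
/-- The element `β` at a vertex of the cycle, by which the arrow entering along the cycle is
twisted. -/
def betaVal (i : I) : G :=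
  if F.negFirst i then F.treeVal g ρ i else ((F.L₂ i).map g).prod⁻¹

open Classical in
/-- The element `γ` at a vertex of the cycle: the arrow `Sum.inl (d i)` takes the value `γ u`,
where the arrow `Sum.inr (d (prd i))` takes the value `β u⁻¹ β⁻¹`. -/
def gammaVal (i : I) : G :=
  if F.negFirst i then ((F.L₂ i).map g).prod⁻¹ * F.betaVal g ρ i
  else F.treeVal g ρ i * F.betaVal g ρ i

variable {F g ρ}

theorem listProd_mem {H : Subgroup G} {l : List (E ⊕ E)} (h : ∀ a ∈ l, g a ∈ H) :
    (l.map g).prod ∈ H := Subgroup.list_prod_mem _ fun x hx => by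
  obtain ⟨a, ha, rfl⟩ := List.mem_map.1 hx
  exact h a ha

theorem treeVal_mem {H : Subgroup G} {i : I} (h : ∀ a ∈ F.L₁ i ++ F.L₂ i ++ F.L₃ i, g a ∈ H)
    (hρ : ρ i ∈ H) : F.treeVal g ρ i ∈ H :=
  mul_mem (mul_mem (inv_mem (listProd_mem fun a ha => h a (by simp [ha]))) hρ)
    (inv_mem (listProd_mem fun a ha => h a (by simp [ha])))

theorem betaVal_mem {H : Subgroup G} {i : I} (h : ∀ a ∈ F.L₁ i ++ F.L₂ i ++ F.L₃ i, g a ∈ H)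
    (hρ : ρ i ∈ H) : F.betaVal g ρ i ∈ H := by
  rw [betaVal]
  split_ifs
  · exact treeVal_mem h hρ
  · exact inv_mem (listProd_mem fun a ha => h a (by simp [ha]))

theorem gammaVal_mem {H : Subgroup G} {i : I} (h : ∀ a ∈ F.L₁ i ++ F.L₂ i ++ F.L₃ i, g a ∈ H)
    (hρ : ρ i ∈ H) : F.gammaVal g ρ i ∈ H := by
  rw [gammaVal]
  split_ifs
  · exact mul_mem (inv_mem (listProd_mem fun a ha => h a (by simp [ha]))) (betaVal_mem h hρ)
  · exact mul_mem (treeVal_mem h hρ) (betaVal_mem h hρ)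

theorem map_treeVal {G' : Type*} [Group G'] (f : G →* G') (i : I) :
    f (F.treeVal g ρ i) = F.treeVal (fun a => f (g a)) (fun i => f (ρ i)) i := by
  simp only [treeVal, map_mul, map_inv, map_list_prod, List.map_map]
  rfl

theorem map_betaVal {G' : Type*} [Group G'] (f : G →* G') (i : I) :
    f (F.betaVal g ρ i) = F.betaVal (fun a => f (g a)) (fun i => f (ρ i)) i := by
  rw [betaVal, betaVal]
  split_ifs
  · exact map_treeVal f i
  · rw [map_inv, map_list_prod, List.map_map]; rfl

theorem map_gammaVal {G' : Type*} [Group G'] (f : G →* G') (i : I) :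
    f (F.gammaVal g ρ i) = F.gammaVal (fun a => f (g a)) (fun i => f (ρ i)) i := by
  rw [gammaVal, gammaVal]
  split_ifs
  · rw [map_mul, map_inv, map_list_prod, List.map_map, map_betaVal]; rfl
  · rw [map_mul, map_treeVal, map_betaVal]

theorem prodMk_treeVal {G' : Type*} [Group G'] (g' : E ⊕ E → G') (ρ' : I → G') (i : I) :
    (F.treeVal g ρ i, F.treeVal g' ρ' i) =
      F.treeVal (fun a => (g a, g' a)) (fun i => (ρ i, ρ' i)) i :=
  Prod.ext
    (map_treeVal (g := fun a => (g a, g' a)) (ρ := fun i => (ρ i, ρ' i))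
      (MonoidHom.fst G G') i).symm
    (map_treeVal (g := fun a => (g a, g' a)) (ρ := fun i => (ρ i, ρ' i))
      (MonoidHom.snd G G') i).symm

theorem prodMk_betaVal {G' : Type*} [Group G'] (g' : E ⊕ E → G') (ρ' : I → G') (i : I) :
    (F.betaVal g ρ i, F.betaVal g' ρ' i) =
      F.betaVal (fun a => (g a, g' a)) (fun i => (ρ i, ρ' i)) i :=
  Prod.ext
    (map_betaVal (g := fun a => (g a, g' a)) (ρ := fun i => (ρ i, ρ' i))
      (MonoidHom.fst G G') i).symm
    (map_betaVal (g := fun a => (g a, g' a)) (ρ := fun i => (ρ i, ρ' i))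
      (MonoidHom.snd G G') i).symm

theorem prodMk_gammaVal {G' : Type*} [Group G'] (g' : E ⊕ E → G') (ρ' : I → G') (i : I) :
    (F.gammaVal g ρ i, F.gammaVal g' ρ' i) =
      F.gammaVal (fun a => (g a, g' a)) (fun i => (ρ i, ρ' i)) i :=
  Prod.ext
    (map_gammaVal (g := fun a => (g a, g' a)) (ρ := fun i => (ρ i, ρ' i))
      (MonoidHom.fst G G') i).symm
    (map_gammaVal (g := fun a => (g a, g' a)) (ρ := fun i => (ρ i, ρ' i))
      (MonoidHom.snd G G') i).symm

theorem treeVal_congr {g' : E ⊕ E → G} {i : I}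
    (h : ∀ a ∈ F.L₁ i ++ F.L₂ i ++ F.L₃ i, g a = g' a) : F.treeVal g ρ i = F.treeVal g' ρ i := by
  rw [treeVal, treeVal, List.map_congr_left fun a ha => h a (by simp [ha]),
    List.map_congr_left fun a (ha : a ∈ F.L₃ i) => h a (by simp [ha])]

theorem betaVal_congr {g' : E ⊕ E → G} {i : I}
    (h : ∀ a ∈ F.L₁ i ++ F.L₂ i ++ F.L₃ i, g a = g' a) : F.betaVal g ρ i = F.betaVal g' ρ i := by
  rw [betaVal, betaVal, treeVal_congr h,
    List.map_congr_left fun a (ha : a ∈ F.L₂ i) => h a (by simp [ha])]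

theorem gammaVal_congr {g' : E ⊕ E → G} {i : I}
    (h : ∀ a ∈ F.L₁ i ++ F.L₂ i ++ F.L₃ i, g a = g' a) : F.gammaVal g ρ i = F.gammaVal g' ρ i := by
  rw [gammaVal, gammaVal, treeVal_congr h, betaVal_congr h,
    List.map_congr_left fun a (ha : a ∈ F.L₂ i) => h a (by simp [ha])]

end Group

open Classical in
/-- The list of the arrows of the double quiver with tail `i`. -/
def arrowList (i : I) : List (E ⊕ E) :=
  if i ∉ F.cyc then F.L₁ i ++ Sum.inl (F.d i) :: F.L₃ i
  else if F.negFirst i then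
    F.L₁ i ++ Sum.inr (F.d (F.prd i)) :: (F.L₂ i ++ Sum.inl (F.d i) :: F.L₃ i)
  else F.L₁ i ++ Sum.inl (F.d i) :: (F.L₂ i ++ Sum.inr (F.d (F.prd i)) :: F.L₃ i)

section Group

variable {G : Type*} [Group G] {g : E ⊕ E → G} {ρ : I → G}

/-- Outside the cycle, the relation at `i` can be solved for the arrow `Sum.inl (d i)`. -/
theorem prod_arrowList_of_not_mem {i : I} (hi : i ∉ F.cyc) :
    ((F.arrowList i).map g).prod = ρ i ↔ g (.inl (F.d i)) = F.treeVal g ρ i := by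
  rw [arrowList, if_pos hi, treeVal]
  simp only [List.map_append, List.map_cons, List.prod_append, List.prod_cons]
  rw [← eq_inv_mul_iff_mul_eq, eq_mul_inv_iff_mul_eq]

/-- At a vertex of the cycle, the relation expresses the arrow leaving along the cycle by a
conjugate of the inverse of the arrow entering along the cycle. -/
theorem prod_arrowList_of_mem {i : I} (hi : i ∈ F.cyc) :
    ((F.arrowList i).map g).prod = ρ i ↔
      g (.inl (F.d i)) = F.gammaVal g ρ i * ((F.betaVal g ρ i)⁻¹ *
        (g (.inr (F.d (F.prd i))))⁻¹ * F.betaVal g ρ i) := by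
  rw [arrowList, if_neg (not_not.2 hi), gammaVal, betaVal]
  split_ifs with h
  · simp only [List.map_append, List.map_cons, List.prod_append, List.prod_cons, treeVal]
    rw [← eq_inv_mul_iff_mul_eq, ← eq_inv_mul_iff_mul_eq, ← eq_inv_mul_iff_mul_eq,
      ← eq_mul_inv_iff_mul_eq]
    simp only [mul_assoc, mul_inv_cancel_left]
  · simp only [List.map_append, List.map_cons, List.prod_append, List.prod_cons, treeVal]
    rw [← eq_inv_mul_iff_mul_eq, ← eq_mul_inv_iff_mul_eq, mul_inv_rev, mul_inv_rev]
    simp only [mul_assoc, inv_mul_cancel_left, inv_inv]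

end Group

variable (k : Type*) [Field k]

/-- The letters that may follow every letter `c e` or `s e` of the cycle, as well as every power of
index `cycle i`. -/
def IsTame : Letter I E → Prop
  | .lau (.rho _) _ => True
  | .lau (.rest _) _ => True
  | .lau (.cycle _) _ => False
  | .c e => ¬ F.IsCyc e
  | .s e => ¬ F.IsCyc e

/-- The span of the words starting with a tame letter. -/
def tameSpan : Submodule k (F.Space k) :=
  Submodule.span k {f | ∃ a w, F.IsTame a ∧ f = F.vec k (a :: w)}

variable {F k}

theorem vec_mem_tameSpan {a : Letter I E} (h : F.IsTame a) (w) : F.vec k (a :: w) ∈ F.tameSpan k :=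
  Submodule.subset_span ⟨a, w, h, rfl⟩

variable (F k)

/-- The invertible operators that are a nonzero scalar modulo `tameSpan`. -/
def tameGroup : Subgroup (Module.End k (F.Space k))ˣ where
  carrier := {g | ∃ a : k, a ≠ 0 ∧ ∀ f, (g : Module.End k (F.Space k)) f - a • f ∈ F.tameSpan k}
  one_mem' := ⟨1, one_ne_zero, fun f => by simp⟩
  mul_mem' := by
    rintro g h ⟨a, ha, hg⟩ ⟨b, hb, hh⟩
    refine ⟨a * b, mul_ne_zero ha hb, fun f => ?_⟩
    have h1 := add_mem (hg ((h : Module.End k (F.Space k)) f)) (Submodule.smul_mem _ a (hh f))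
    rwa [smul_sub, sub_add_sub_cancel, smul_smul] at h1
  inv_mem' := by
    rintro g ⟨a, ha, hg⟩
    refine ⟨a⁻¹, inv_ne_zero ha, fun f => ?_⟩
    have h1 := Submodule.smul_mem _ (-a⁻¹) (hg ((↑g⁻¹ : Module.End k (F.Space k)) f))
    rw [← Module.End.mul_apply, Units.mul_inv, Module.End.one_apply, smul_sub, smul_smul, neg_mul,
      inv_mul_cancel₀ ha, neg_smul, neg_smul, one_smul, sub_neg_eq_add, neg_add_eq_sub] at h1
    exact h1

variable {F k} (q : I → kˣ)

/-- The invertible operators of index `rho i` and `rest e` are tame: their powers are shifted by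
multiplicative scalars. -/
theorem lauUnit_mem_tameGroup {y : LaurentIndex I E} (hy : F.Admissible y)
    (ht : ∀ n, F.IsTame (.lau y n)) : F.lauUnit q y ∈ F.tameGroup k := by
  refine ⟨shift k q y 1, ?_, fun f => ?_⟩
  · cases y with
    | rho i => exact Units.ne_zero _
    | rest e => exact one_ne_zero
    | cycle i => exact absurd (ht 0) id
  have hs : ∀ n, shift k q y (n + 1) = shift k q y n * shift k q y 1 := fun n => by
    cases y with
    | rho i => simp [shift, zpow_add]
    | rest e => simp [shift]
    | cycle i => exact absurd (ht 0) id
  have hmem : ∀ n w, F.powVec k q y n w - shift k q y n • F.vec k w ∈ F.tameSpan k := fun n w => by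
    rw [powVec, add_sub_cancel_right]; exact vec_mem_tameSpan (ht n) w
  suffices h : (Submodule.mkQ (F.tameSpan k)) ∘ₗ (F.lauUnit q y : Module.End k (F.Space k)) =
      (Submodule.mkQ (F.tameSpan k)) ∘ₗ (shift k q y 1 • LinearMap.id) by
    rw [← Submodule.Quotient.mk_eq_zero, Submodule.Quotient.mk_sub, sub_eq_zero]
    exact LinearMap.congr_fun h f
  refine ext_powVec q (y := y) fun n w hw h => ?_
  rw [LinearMap.comp_apply, LinearMap.comp_apply, coe_lauUnit q hy, lauOp_powVec q hy _ _ hw h,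
    Submodule.mkQ_apply, Submodule.mkQ_apply, Submodule.Quotient.eq, LinearMap.smul_apply,
    LinearMap.id_apply]
  have h1 := sub_mem (hmem (n + 1) w) (Submodule.smul_mem _ (shift k q y 1) (hmem n w))
  rwa [smul_sub, smul_smul, hs, mul_comm, sub_sub_sub_cancel_right] at h1

variable (F) in
open Classical in
/-- The operator of the arrow `c e`, given the operator `W` that `1 + c s` is to be equal to: it
prepends `c e`, except that `c s w` is replaced by `(W - 1) w`. -/
def cOp (e : E) (W : (Module.End k (F.Space k))ˣ) : Module.End k (F.Space k) :=
  lin fun w => match w with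
    | .s e' :: w' => if e' = e then (W : Module.End k (F.Space k)) (F.vec k w') - F.vec k w'
      else F.vec k (.c e :: w)
    | w => F.vec k (.c e :: w)

theorem cOp_s (e : E) (W : (Module.End k (F.Space k))ˣ) {w} (h : F.Normal (.s e :: w)) :
    F.cOp e W (F.vec k (.s e :: w)) = (W : Module.End k (F.Space k)) (F.vec k w) - F.vec k w := by
  rw [cOp, lin_vec _ h]
  exact if_pos rfl

theorem cOp_of_ne (e : E) (W : (Module.End k (F.Space k))ˣ) {w} (h : F.Normal w)
    (h' : ∀ w', w ≠ .s e :: w') : F.cOp e W (F.vec k w) = F.vec k (.c e :: w) := by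
  rw [cOp, lin_vec _ h]
  split
  · exact if_neg fun h'' => h' _ (by rw [h''])
  · rfl

theorem normal_s {e : E} (he : ¬ F.IsCyc e) {w} (hw : F.Normal w) : F.Normal (.s e :: w) := by
  refine ⟨trivial, fun b _ hf => ?_, hw⟩
  cases hf with
  | s_c _ h => exact he h
  | s_cycle _ _ h => exact he h

theorem cOp_mul_app {e : E} (he : ¬ F.IsCyc e) (W : (Module.End k (F.Space k))ˣ) :
    F.cOp e W * F.app k (.s e) = W - 1 := by
  refine space_ext fun w hw => ?_
  rw [Module.End.mul_apply, app_vec, cOp_s e W (normal_s he hw)]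
  rfl

variable (F) in
open Classical in
/-- The operator `1 + c s` for an edge outside the cycle, given these operators for the edges
`d i`. -/
def edgeUnit (W : I → (Module.End k (F.Space k))ˣ) (e : E) : (Module.End k (F.Space k))ˣ :=
  if F.d (F.te e) = e then W (F.te e) else F.lauUnit q (.rest e)

variable (F) in
open Classical in
/-- The operator `1 + s c` for an edge outside the cycle. -/
def edgeUnit' (W : I → (Module.End k (F.Space k))ˣ) (e : E) : (Module.End k (F.Space k))ˣ :=
  if he : F.IsCyc e then 1 else
    swapUnit (F.cOp e (F.edgeUnit q W e)) (F.app k (.s e)) (F.edgeUnit q W e) (cOp_mul_app he _)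

theorem coe_edgeUnit' (W : I → (Module.End k (F.Space k))ˣ) {e : E} (he : ¬ F.IsCyc e) :
    (F.edgeUnit' q W e : Module.End k (F.Space k)) =
      1 + F.app k (.s e) * F.cOp e (F.edgeUnit q W e) := by
  rw [edgeUnit', dif_neg he]; rfl

variable (F) in
/-- The operators of the arrows of the double quiver outside the cycle: `1 + c s` for an edge and
the inverse of `1 + s c` for its opposite. -/
def arrowUnit (W : I → (Module.End k (F.Space k))ˣ) : E ⊕ E → (Module.End k (F.Space k))ˣ
  | .inl e => F.edgeUnit q W e
  | .inr e => (F.edgeUnit' q W e)⁻¹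

theorem app_s_mem_tameSpan {e : E} (he : ¬ F.IsCyc e) (f : F.Space k) :
    F.app k (.s e) f ∈ F.tameSpan k := by
  refine mem_of_vec_mem (N := (F.tameSpan k).comap (F.app k (.s e))) (fun w _ => ?_) f
  rw [Submodule.mem_comap, app_vec]
  exact vec_mem_tameSpan (a := .s e) he _

theorem mem_tameGroup_of_one_add {g : (Module.End k (F.Space k))ˣ} {x : Module.End k (F.Space k)}
    (hg : (g : Module.End k (F.Space k)) = 1 + x) (hx : ∀ f, x f ∈ F.tameSpan k) :
    g ∈ F.tameGroup k := by
  refine ⟨1, one_ne_zero, fun f => ?_⟩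
  rw [hg, one_smul, LinearMap.add_apply, Module.End.one_apply, add_sub_cancel_left]
  exact hx f

theorem arrowUnit_mem_tameGroup (W : I → (Module.End k (F.Space k))ˣ) {i : I} {a : E ⊕ E}
    (ha : a ∈ F.L₁ i ++ F.L₂ i ++ F.L₃ i) : F.arrowUnit q W a ∈ F.tameGroup k := by
  rcases a with e | e
  · have h := (F.pos_mem i e ha).2
    rw [arrowUnit, edgeUnit, if_neg h]
    exact lauUnit_mem_tameGroup q h fun _ => trivial
  · have h : ¬ F.IsCyc e := fun h => (F.neg_mem i e ha).2 h.1 h.2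
    exact inv_mem (mem_tameGroup_of_one_add (coe_edgeUnit' q W h) fun f =>
      app_s_mem_tameSpan h _)

/-- The arrows at `i`, apart from the distinguished ones, only involve the operators of vertices of
smaller rank. -/
theorem arrowUnit_congr {W W' : I → (Module.End k (F.Space k))ˣ} {i : I}
    (h : ∀ j, F.rank j < F.rank i → W j = W' j) {a : E ⊕ E}
    (ha : a ∈ F.L₁ i ++ F.L₂ i ++ F.L₃ i) : F.arrowUnit q W a = F.arrowUnit q W' a := by
  rcases a with e | e
  · have h := (F.pos_mem i e ha).2
    rw [arrowUnit, arrowUnit, edgeUnit, edgeUnit, if_neg h, if_neg h]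
  · obtain ⟨h1, h2⟩ := F.neg_mem i e ha
    have : F.edgeUnit q W e = F.edgeUnit q W' e := by
      rw [edgeUnit, edgeUnit]
      split_ifs with h3
      · refine h _ ?_
        have h4 := F.rank_lt _ (h2 h3)
        rwa [h3, h1] at h4
      · rfl
    rw [arrowUnit, arrowUnit, edgeUnit', edgeUnit']
    simp only [this]

variable (F) in
theorem exists_treeUnit : ∃ W : I → (Module.End k (F.Space k))ˣ, ∀ i,
    W i = F.treeVal (F.arrowUnit q W) (fun i => F.lauUnit q (.rho i)) i :=
  exists_fixedPoint_of_local F.rank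
    (fun W => F.treeVal (F.arrowUnit q W) (fun i => F.lauUnit q (.rho i)))
    fun _ _ _ h => treeVal_congr fun _ ha => arrowUnit_congr q h ha

variable (F) in
/-- The operators `1 + c s` for the edges `d i` with `i` outside the cycle, determined by the
requirement that the product of the arrows at `i` be the invertible operator of index `rho i`. -/
def treeUnit : I → (Module.End k (F.Space k))ˣ := (F.exists_treeUnit q).choose

theorem treeUnit_eq (i : I) : F.treeUnit q i =
    F.treeVal (F.arrowUnit q (F.treeUnit q)) (fun i => F.lauUnit q (.rho i)) i :=
  (F.exists_treeUnit q).choose_spec i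

end Frame

end

/-! ### Operators on the cycle -/

section

/-- Two-sided recursion: a sequence indexed by `ℤ` with invertible steps. -/
theorem exists_int_sequence {α : Type*} (x : α) (step : ℤ → α ≃ α) :
    ∃ f : ℤ → α, f 0 = x ∧ ∀ n, f (n + 1) = step n (f n) := by
  let up : ℕ → α := fun n => Nat.rec x (fun n y => step n y) n
  let down : ℕ → α := fun n => Nat.rec x (fun n y => (step (-(n + 1))).symm y) n
  have hd : ∀ n : ℕ, step (-((n : ℤ) + 1)) (down (n + 1)) = down n := fun n =>
    Equiv.apply_symm_apply _ _
  refine ⟨fun n => if 0 ≤ n then up n.toNat else down (-n).toNat, rfl, fun n => ?_⟩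
  rcases lt_trichotomy n (-1) with h | rfl | h
  · obtain ⟨m, hm⟩ : ∃ m : ℕ, n = -(m + 1 + 1) := ⟨(-n - 2).toNat, by omega⟩
    have e1 : (-(n + 1)).toNat = m + 1 := by omega
    have e2 : (-n).toNat = m + 1 + 1 := by omega
    simp only [if_neg (show ¬ 0 ≤ n + 1 by omega), if_neg (show ¬ 0 ≤ n by omega), e1, e2]
    rw [← hd (m + 1), hm]
    push_cast
    rfl
  · exact (hd 0).symm
  · obtain ⟨m, rfl⟩ : ∃ m : ℕ, n = m := ⟨n.toNat, by omega⟩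
    simp only [if_pos (show (0 : ℤ) ≤ m + 1 by omega), if_pos (show (0 : ℤ) ≤ m by omega)]
    rfl

theorem sub_sub_one_mul_comm {R : Type*} [Ring R] {x g : R} (h : x * g = g * x) :
    (x - (g - 1)) * g = g * (x - (g - 1)) := by
  rw [sub_mul, mul_sub, h, sub_mul, mul_sub, one_mul, mul_one]

namespace Frame

variable {I E : Type*} {F : Frame I E} {k : Type*} [Field k] (q : I → kˣ)
  {M : Type*} [AddCommGroup M] [Module k M]

theorem cycle_powVec (i : I) {n : ℤ} (hn : n ≠ 0) (w) :
    F.powVec k q (.cycle i) n w = F.vec k (.lau (.cycle i) n :: w) := by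
  rw [powVec, shift, if_neg hn, zero_smul, add_zero]

open Classical in
/-- The linear map with prescribed values on the elements `powVec (cycle i) n w`. -/
def cycleExt (i : I) (f : ℤ → List (Letter I E) → M) : F.Space k →ₗ[k] M :=
  lin fun w => match w with
    | .lau y n :: w' => if y = .cycle i then f n w' else f 0 w
    | _ => f 0 w

theorem cycleExt_vec {i : I} (f : ℤ → List (Letter I E) → M) {w} (hw : F.Normal w)
    (h : ¬ Headed (.cycle i) w) : cycleExt i f (F.vec k w) = f 0 w := by
  rw [cycleExt, lin_vec _ hw]
  split
  · exact if_neg fun h' => h ⟨_, _, by rw [h']⟩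
  · rfl

theorem cycleExt_powVec {i : I} (hi : i ∈ F.cyc) (f : ℤ → List (Letter I E) → M) (n : ℤ) {w}
    (hw : F.Normal w) (h : ¬ Headed (.cycle i) w) :
    cycleExt i f (F.powVec k q (.cycle i) n w) = f n w := by
  by_cases hn : n = 0
  · subst hn
    rw [powVec_zero, cycleExt_vec f hw h]
  · rw [cycle_powVec q i hn, cycleExt,
    lin_vec _ (normal_lau hn (show F.Admissible (.cycle i) from hi) hw h)]
    exact if_pos rfl

theorem not_headed_of_isTame {a : Letter I E} (ha : F.IsTame a) (i w) :
    ¬ Headed (.cycle i) (a :: w) := by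
  rintro ⟨n, w', h⟩
  rw [List.cons.injEq] at h
  rw [h.1] at ha
  exact ha

theorem lauUnit_cycle_powVec {i : I} (hi : i ∈ F.cyc) (n : ℤ) {w}
    (hw : F.Normal w) (h : ¬ Headed (.cycle i) w) :
    (F.lauUnit q (.cycle i) : Module.End k (F.Space k)) (F.powVec k q (.cycle i) n w) =
      F.powVec k q (.cycle i) (n + 1) w := by
  rw [coe_lauUnit q (y := .cycle i) hi]
  exact lauOp_powVec q (show F.Admissible (.cycle i) from hi) _ _ hw h

/-- A linear map vanishing on the words that do not start with a power of index `cycle i`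
vanishes, if its kernel is stable under `γ u` and its inverse, where `u` is the operator of
index `cycle i` and `γ` is a scalar modulo `tameSpan`. -/
theorem eq_zero_of_cycle {i : I} (hi : i ∈ F.cyc) {γ : (Module.End k (F.Space k))ˣ}
    (hγ : γ ∈ F.tameGroup k) {T : F.Space k →ₗ[k] M}
    (h0 : ∀ w, F.Normal w → ¬ Headed (.cycle i) w → T (F.vec k w) = 0)
    (hT : ∀ f, T ((γ * F.lauUnit q (.cycle i) : (Module.End k (F.Space k))ˣ).1 f) = 0 ↔ T f = 0) :
    T = 0 := by
  obtain ⟨a, ha, hγ⟩ := hγ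
  have htame : ∀ f ∈ F.tameSpan k, T f = 0 := by
    intro f hf
    induction hf using Submodule.span_induction with
    | mem f hf =>
      obtain ⟨b, w, hb, rfl⟩ := hf
      by_cases hw : F.Normal (b :: w)
      · exact h0 _ hw (not_headed_of_isTame hb i w)
      · rw [vec_of_not hw, map_zero]
    | zero => simp
    | add x y _ _ hx hy => rw [map_add, hx, hy, add_zero]
    | smul c x _ hx => rw [map_smul, hx, smul_zero]
  refine ext_powVec q (y := .cycle i) fun n w hw h => ?_
  have step : ∀ n, T (F.powVec k q (.cycle i) n w) = 0 ↔
      T (F.powVec k q (.cycle i) (n + 1) w) = 0 := by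
    intro n
    rw [← hT, Units.val_mul, Module.End.mul_apply, lauUnit_cycle_powVec q hi n hw h]
    have h1 := htame _ (hγ (F.powVec k q (.cycle i) (n + 1) w))
    rw [map_sub, map_smul, sub_eq_zero] at h1
    rw [h1, smul_eq_zero, or_iff_right ha]
  rw [LinearMap.zero_apply]
  induction n using Int.induction_on with
  | zero => rw [powVec_zero]; exact h0 w hw h
  | succ n ih => exact (step _).1 ih
  | pred n ih => exact (step _).2 (by rwa [sub_add_cancel])

variable (F)

open Classical in
/-- The operator of `s e` for an edge of the cycle, as it is to act on words not starting with a
power of index `cycle (te e)`: it prepends `s e`, except that `s c w` is replaced by `(u - 1) w`,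
with `u` of index `cycle (he e)`. -/
def sOpZero (e : E) : Module.End k (F.Space k) :=
  lin fun w => match w with
    | .c e' :: w' => if e' = e then
        (F.lauUnit q (.cycle (F.he e)) : Module.End k (F.Space k)) (F.vec k w') - F.vec k w'
      else F.vec k (.s e :: w)
    | w => F.vec k (.s e :: w)

variable {F}

theorem sOpZero_c (e : E) {w} (h : F.Normal (.c e :: w)) :
    F.sOpZero q e (F.vec k (.c e :: w)) =
      (F.lauUnit q (.cycle (F.he e)) : Module.End k (F.Space k)) (F.vec k w) - F.vec k w := by
  rw [sOpZero, lin_vec _ h]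
  exact if_pos rfl

theorem sOpZero_of_ne (e : E) {w} (h : F.Normal w) (h' : ∀ w', w ≠ .c e :: w') :
    F.sOpZero q e (F.vec k w) = F.vec k (.s e :: w) := by
  rw [sOpZero, lin_vec _ h]
  split
  · exact if_neg fun h'' => h' _ (by rw [h''])
  · rfl

theorem normal_c_of {e : E} {w} (hw : F.Normal w) (h1 : F.IsCyc e → ¬ Headed (.cycle (F.he e)) w)
    (h2 : ∀ w', w ≠ .s e :: w') : F.Normal (.c e :: w) := by
  refine ⟨trivial, fun b hb hf => ?_, hw⟩
  rcases w with _ | ⟨a, w⟩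
  · simp at hb
  · simp only [List.head?_cons, Option.mem_def, Option.some.injEq] at hb
    subst hb
    cases hf with
    | c_s => exact h2 w rfl
    | c_cycle _ n h => exact h1 h ⟨n, w, rfl⟩

theorem normal_s_of {e : E} {w} (hw : F.Normal w) (h1 : ¬ Headed (.cycle (F.te e)) w)
    (h2 : ∀ w', w ≠ .c e :: w') : F.Normal (.s e :: w) := by
  refine ⟨trivial, fun b hb hf => ?_, hw⟩
  rcases w with _ | ⟨a, w⟩
  · simp at hb
  · simp only [List.head?_cons, Option.mem_def, Option.some.injEq] at hb
    subst hb
    cases hf with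
    | s_c => exact h2 w rfl
    | s_cycle _ n _ => exact h1 ⟨n, w, rfl⟩

theorem of_normal_c {e : E} (he : F.IsCyc e) {w} (hw : F.Normal (.c e :: w)) :
    ¬ Headed (.cycle (F.he e)) w ∧ ∀ w', w ≠ .s e :: w' := by
  refine ⟨?_, ?_⟩
  · rintro ⟨n, w', rfl⟩
    exact hw.2.1 _ (by simp) (.c_cycle e n he)
  · rintro w' rfl
    exact hw.2.1 _ (by simp) (.c_s e)

theorem of_normal_s {e : E} (he : F.IsCyc e) {w} (hw : F.Normal (.s e :: w)) :
    ¬ Headed (.cycle (F.te e)) w ∧ ∀ w', w ≠ .c e :: w' := by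
  refine ⟨?_, ?_⟩
  · rintro ⟨n, w', rfl⟩
    exact hw.2.1 _ (by simp) (.s_cycle e n he)
  · rintro w' rfl
    exact hw.2.1 _ (by simp) (.s_c e he)

theorem not_headed_c (i : I) (e : E) (w) : ¬ Headed (.cycle i) (.c e :: w) := by
  rintro ⟨n, w', h⟩; cases h

theorem not_headed_s (i : I) (e : E) (w) : ¬ Headed (.cycle i) (.s e :: w) := by
  rintro ⟨n, w', h⟩; cases h

variable (F) in
/-- The operator of `c e` for an edge of the cycle, untwisted by `β`. It intertwines the operator
of index `cycle (he e)` with `γ u`, where `u` has index `cycle (te e)`, and is determined by this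
and by its values on words not starting with a power of index `cycle (he e)`. -/
def cycC (e : E) (γ : (Module.End k (F.Space k))ˣ) : Module.End k (F.Space k) :=
  cycleExt (F.he e) fun n w =>
    ((γ * F.lauUnit q (.cycle (F.te e))) ^ n : (Module.End k (F.Space k))ˣ).1
      (F.cOp e (γ * F.lauUnit q (.cycle (F.te e))) (F.vec k w))

variable (F) in
/-- `f n` is the value of the operator of `s e` on the vector `uⁿ w`, with `u` of index
`cycle (te e)`. The recursion expresses that this operator intertwines `γ u` with the operator of
index `cycle (he e)`: as `γ` is the scalar `a` modulo `tameSpan`, where the operator prepends `s e`,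
the value on `γ uⁿ⁺¹ w` is known up to `a f (n + 1)`. -/
def IsSSequence (e : E) (γ : (Module.End k (F.Space k))ˣ) (a : k) (w : List (Letter I E))
    (f : ℤ → F.Space k) : Prop :=
  f 0 = F.sOpZero q e (F.vec k w) ∧
    ∀ n, (F.lauUnit q (.cycle (F.he e)) : Module.End k (F.Space k)) (f n) =
      F.app k (.s e) (γ.1 (F.powVec k q (.cycle (F.te e)) (n + 1) w) -
        a • F.powVec k q (.cycle (F.te e)) (n + 1) w) + a • f (n + 1)

/-- Each step of the recursion can be solved in both directions, as `a` is a nonzero scalar and the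
operator of index `cycle (he e)` is invertible. -/
theorem exists_isSSequence (e : E) (γ : (Module.End k (F.Space k))ˣ) {a : k} (ha : a ≠ 0)
    (w : List (Letter I E)) : ∃ f, F.IsSSequence q e γ a w f := by
  set U := F.lauUnit q (.cycle (F.he e)) with hU
  set g : ℤ → F.Space k := fun n => F.app k (.s e)
    (γ.1 (F.powVec k q (.cycle (F.te e)) (n + 1) w) -
        a • F.powVec k q (.cycle (F.te e)) (n + 1) w) with hg
  have hUU : ∀ x, U.1 (U⁻¹.1 x) = x := fun x => by
    rw [← Module.End.mul_apply, Units.mul_inv]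
    rfl
  have hUU' : ∀ x, U⁻¹.1 (U.1 x) = x := fun x => by
    rw [← Module.End.mul_apply, Units.inv_mul]
    rfl
  let step : ℤ → F.Space k ≃ F.Space k := fun n =>
    { toFun := fun x => a⁻¹ • (U.1 x - g n)
      invFun := fun y => U⁻¹.1 (g n + a • y)
      left_inv := fun x => by
        simp only
        rw [smul_smul, mul_inv_cancel₀ ha, one_smul, add_sub_cancel, hUU']
      right_inv := fun y => by
        simp only
        rw [hUU, add_sub_cancel_left, smul_smul, inv_mul_cancel₀ ha, one_smul] }
  obtain ⟨f, hf0, hf⟩ := exists_int_sequence (F.sOpZero q e (F.vec k w)) step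
  refine ⟨f, hf0, fun n => ?_⟩
  rw [hf]
  change U.1 (f n) = g n + a • (a⁻¹ • (U.1 (f n) - g n))
  rw [smul_smul, mul_inv_cancel₀ ha, one_smul, add_sub_cancel]

variable (F) in
open Classical in
/-- The operator of `s e` for an edge of the cycle, untwisted by `β`. It intertwines `γ u`, with
`u` of index `cycle (te e)`, with the operator of index `cycle (he e)`. -/
def cycS (e : E) (γ : (Module.End k (F.Space k))ˣ) : Module.End k (F.Space k) :=
  if h : γ ∈ F.tameGroup k then cycleExt (F.te e) fun n w =>
    (exists_isSSequence q e γ h.choose_spec.1 w).choose n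
  else 0

section

variable {e : E} (he : F.IsCyc e) {γ : (Module.End k (F.Space k))ˣ}

include he

theorem he_mem : F.he e ∈ F.cyc := he.1 ▸ F.he_d_mem _ he.2

theorem cycC_powVec (n : ℤ) {w} (hw : F.Normal w) (h : ¬ Headed (.cycle (F.he e)) w) :
    F.cycC q e γ (F.powVec k q (.cycle (F.he e)) n w) =
      ((γ * F.lauUnit q (.cycle (F.te e))) ^ n : (Module.End k (F.Space k))ˣ).1
      (F.cOp e (γ * F.lauUnit q (.cycle (F.te e))) (F.vec k w)) :=
  cycleExt_powVec q (he_mem he) _ n hw h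

theorem cycC_vec {w} (hw : F.Normal w) (h : ¬ Headed (.cycle (F.he e)) w) :
    F.cycC q e γ (F.vec k w) = F.cOp e (γ * F.lauUnit q (.cycle (F.te e))) (F.vec k w) := by
  have h1 := cycC_powVec q he (γ := γ) 0 hw h
  rwa [powVec_zero, zpow_zero] at h1

theorem cycC_mul_lauUnit : F.cycC q e γ * F.lauUnit q (.cycle (F.he e)) =
    (γ * F.lauUnit q (.cycle (F.te e)) : (Module.End k (F.Space k))ˣ) * F.cycC q e γ := by
  refine ext_powVec q (y := .cycle (F.he e)) fun n w hw h => ?_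
  rw [Module.End.mul_apply, Module.End.mul_apply, lauUnit_cycle_powVec q (he_mem he) n hw h,
    cycC_powVec q he _ hw h, cycC_powVec q he _ hw h, add_comm, zpow_one_add, Units.val_mul,
    Module.End.mul_apply]

theorem cycC_normal {w} (hw : F.Normal (.c e :: w)) :
    F.cycC q e γ (F.vec k w) = F.vec k (.c e :: w) := by
  obtain ⟨h1, h2⟩ := of_normal_c he hw
  rw [cycC_vec q he hw.2.2 h1, cOp_of_ne _ _ hw.2.2 h2]

variable (hγ : γ ∈ F.tameGroup k)

include hγ

omit he in
theorem exists_cycS : ∃ a : k, a ≠ 0 ∧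
    (∀ f, (γ : Module.End k (F.Space k)) f - a • f ∈ F.tameSpan k) ∧
    ∃ f : List (Letter I E) → ℤ → F.Space k, (∀ w, F.IsSSequence q e γ a w (f w)) ∧
      F.cycS q e γ = cycleExt (F.te e) fun n w => f w n := by
  refine ⟨_, hγ.choose_spec.1, hγ.choose_spec.2, _,
    fun w => (exists_isSSequence q e γ hγ.choose_spec.1 w).choose_spec, ?_⟩
  rw [cycS, dif_pos hγ]

omit he in
theorem cycS_vec {w} (hw : F.Normal w) (h : ¬ Headed (.cycle (F.te e)) w) :
    F.cycS q e γ (F.vec k w) = F.sOpZero q e (F.vec k w) := by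
  obtain ⟨a, ha, haγ, f, hf, hS⟩ := exists_cycS q (e := e) hγ
  rw [hS, cycleExt_vec _ hw h, (hf w).1]

theorem cycS_normal {w} (hw : F.Normal (.s e :: w)) :
    F.cycS q e γ (F.vec k w) = F.vec k (.s e :: w) := by
  obtain ⟨h1, h2⟩ := of_normal_s he hw
  rw [cycS_vec q hγ hw.2.2 h1, sOpZero_of_ne q _ hw.2.2 h2]

theorem cycS_tame {f : F.Space k} (hf : f ∈ F.tameSpan k) :
    F.cycS q e γ f = F.app k (.s e) f := by
  induction hf using Submodule.span_induction with
  | mem f hf =>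
    obtain ⟨b, w, hb, rfl⟩ := hf
    by_cases hw : F.Normal (b :: w)
    · rw [cycS_vec q hγ hw (not_headed_of_isTame hb _ w), app_vec, sOpZero_of_ne q _ hw]
      rintro w' h
      rw [List.cons.injEq] at h
      rw [h.1] at hb
      exact hb he
    · rw [vec_of_not hw, map_zero, map_zero]
  | zero => simp
  | add x y _ _ hx hy => rw [map_add, map_add, hx, hy]
  | smul c x _ hx => rw [map_smul, map_smul, hx]

theorem cycS_mul : F.cycS q e γ * (γ * F.lauUnit q (.cycle (F.te e)) :
    (Module.End k (F.Space k))ˣ) = F.lauUnit q (.cycle (F.he e)) * F.cycS q e γ := by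
  refine ext_powVec q (y := .cycle (F.te e)) fun n w hw h => ?_
  rw [Module.End.mul_apply, Module.End.mul_apply, Units.val_mul, Module.End.mul_apply,
    lauUnit_cycle_powVec q he.2 n hw h]
  have htame := fun f => cycS_tame q he hγ (f := f)
  obtain ⟨a, ha, haγ, f, hf, hS⟩ := exists_cycS q (e := e) hγ
  have h1 := haγ (F.powVec k q (.cycle (F.te e)) (n + 1) w)
  have h2 := htame _ h1
  rw [map_sub, map_smul, sub_eq_iff_eq_add] at h2
  rw [h2, hS, cycleExt_powVec q he.2 _ _ hw h, cycleExt_powVec q he.2 _ _ hw h, (hf w).2]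

/-- Both sides commute with `γ u`, so it suffices to compare them on words not starting with a power
of `u`. -/
theorem cycC_mul_cycS : F.cycC q e γ * F.cycS q e γ =
    (γ * F.lauUnit q (.cycle (F.te e)) : (Module.End k (F.Space k))ˣ) - 1 := by
  set G := γ * F.lauUnit q (.cycle (F.te e)) with hG
  rw [← sub_eq_zero]
  set T : Module.End k (F.Space k) := F.cycC q e γ * F.cycS q e γ - ((G : Module.End k
    (F.Space k)) - 1) with hTdef
  have hcomm : T * (G : Module.End k (F.Space k)) = G * T := by
    have h1 : F.cycC q e γ * F.cycS q e γ * G = G * (F.cycC q e γ * F.cycS q e γ) := by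
      rw [mul_assoc, cycS_mul q he hγ, ← mul_assoc, cycC_mul_lauUnit q he, mul_assoc]
    exact sub_sub_one_mul_comm h1
  refine eq_zero_of_cycle q he.2 hγ (T := T) (fun w hw h => ?_) fun f => ?_
  · have hgoal : F.cycC q e γ (F.cycS q e γ (F.vec k w)) = G.1 (F.vec k w) - F.vec k w := by
      rw [cycS_vec q hγ hw h]
      by_cases hc : ∃ w', w = .c e :: w'
      · obtain ⟨w', rfl⟩ := hc
        rw [sOpZero_c q e hw, map_sub, ← Module.End.mul_apply, cycC_mul_lauUnit q he,
          Module.End.mul_apply, cycC_normal q he hw]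
      · push Not at hc
        have hs := normal_s_of hw h hc
        rw [sOpZero_of_ne q e hw hc, cycC_vec q he hs (not_headed_s _ _ _), cOp_s _ _ hs]
    exact sub_eq_zero.2 hgoal
  · have h1 : T (G.1 f) = G.1 (T f) := LinearMap.congr_fun hcomm f
    rw [← hG, h1]
    exact ((Module.End.isUnit_iff _).1 G.isUnit).1.eq_iff' (map_zero _)

/-- Both sides commute with the operator `u` of index `cycle (he e)`, so it suffices to compare them
on words not starting with a power of `u`. -/
theorem cycS_mul_cycC : F.cycS q e γ * F.cycC q e γ =
    (F.lauUnit q (.cycle (F.he e)) : (Module.End k (F.Space k))ˣ) - 1 := by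
  set G := F.lauUnit q (.cycle (F.he e)) with hG
  rw [← sub_eq_zero]
  set T : Module.End k (F.Space k) := F.cycS q e γ * F.cycC q e γ - ((G : Module.End k
    (F.Space k)) - 1) with hTdef
  have hcomm : T * (G : Module.End k (F.Space k)) = G * T := by
    have h1 : F.cycS q e γ * F.cycC q e γ * G = G * (F.cycS q e γ * F.cycC q e γ) := by
      rw [mul_assoc, cycC_mul_lauUnit q he, ← mul_assoc, cycS_mul q he hγ, mul_assoc]
    exact sub_sub_one_mul_comm h1
  refine eq_zero_of_cycle q (he_mem he) (γ := 1) (one_mem _) (T := T) (fun w hw h => ?_) fun f => ?_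
  · have hgoal : F.cycS q e γ (F.cycC q e γ (F.vec k w)) = G.1 (F.vec k w) - F.vec k w := by
      rw [cycC_vec q he hw h]
      by_cases hc : ∃ w', w = .s e :: w'
      · obtain ⟨w', rfl⟩ := hc
        rw [cOp_s _ _ hw, map_sub, ← Module.End.mul_apply (F.cycS q e γ), cycS_mul q he hγ,
          Module.End.mul_apply, cycS_normal q he hγ hw]
      · push Not at hc
        have hs := normal_c_of hw (fun _ => h) hc
        rw [cOp_of_ne _ _ hw hc, cycS_vec q hγ hs (not_headed_c _ _ _), sOpZero_c q _ hs]
    exact sub_eq_zero.2 hgoal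
  · have h1 : T (G.1 f) = G.1 (T f) := LinearMap.congr_fun hcomm f
    rw [one_mul, ← hG, h1]
    exact ((Module.End.isUnit_iff _).1 G.isUnit).1.eq_iff' (map_zero _)

end

end Frame

end

/-! ### The operators of all arrows -/

section

namespace Frame

variable {I E : Type*} (F : Frame I E) {k : Type*} [Field k] (q : I → kˣ)

/-- The operator `β` at a vertex. -/
def opBeta (i : I) : (Module.End k (F.Space k))ˣ :=
  F.betaVal (F.arrowUnit q (F.treeUnit q)) (fun i => F.lauUnit q (.rho i)) i

/-- The operator `γ` at a vertex. -/
def opGamma (i : I) : (Module.End k (F.Space k))ˣ :=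
  F.gammaVal (F.arrowUnit q (F.treeUnit q)) (fun i => F.lauUnit q (.rho i)) i

variable {F} in
theorem opGamma_mem (i : I) : F.opGamma q i ∈ F.tameGroup k :=
  gammaVal_mem (fun _ ha => arrowUnit_mem_tameGroup q _ ha)
    (lauUnit_mem_tameGroup q trivial fun _ => trivial)

open Classical in
/-- The operator of the arrow `c e`; on the cycle, `cycC` twisted by `β`. -/
def opC (e : E) : Module.End k (F.Space k) :=
  if F.IsCyc e then F.cycC q e (F.opGamma q (F.te e)) * ↑(F.opBeta q (F.he e))⁻¹
  else F.cOp e (F.edgeUnit q (F.treeUnit q) e)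

open Classical in
/-- The operator of the arrow `s e`; on the cycle, `cycS` twisted by `β`. -/
def opS (e : E) : Module.End k (F.Space k) :=
  if F.IsCyc e then F.opBeta q (F.he e) * F.cycS q e (F.opGamma q (F.te e))
  else F.app k (.s e)

open Classical in
/-- The invertible operator `1 + c s`. -/
def opW (e : E) : (Module.End k (F.Space k))ˣ :=
  if F.IsCyc e then F.opGamma q (F.te e) * F.lauUnit q (.cycle (F.te e))
  else F.edgeUnit q (F.treeUnit q) e

variable {F}

theorem opC_mul_opS (e : E) : F.opC q e * F.opS q e = F.opW q e - 1 := by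
  rw [opC, opS, opW]
  split_ifs with h
  · rw [mul_assoc, Units.inv_mul_cancel_left]
    exact cycC_mul_cycS q h (opGamma_mem q _)
  · exact cOp_mul_app h _

theorem coe_opW (e : E) : (F.opW q e : Module.End k (F.Space k)) = 1 + F.opC q e * F.opS q e := by
  rw [opC_mul_opS]; exact (add_sub_cancel (1 : Module.End k (F.Space k)) _).symm

variable (F) in
/-- The invertible operator `1 + s c`. -/
def opV (e : E) : (Module.End k (F.Space k))ˣ := swapUnit _ _ _ (opC_mul_opS q e)

theorem coe_opV (e : E) : (F.opV q e : Module.End k (F.Space k)) = 1 + F.opS q e * F.opC q e := rfl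

theorem opV_of_isCyc {e : E} (h : F.IsCyc e) : F.opV q e =
    F.opBeta q (F.he e) * F.lauUnit q (.cycle (F.he e)) * (F.opBeta q (F.he e))⁻¹ := by
  refine Units.ext ?_
  have h1 : F.opS q e * F.opC q e = F.opBeta q (F.he e) *
      (F.cycS q e (F.opGamma q (F.te e)) * F.cycC q e (F.opGamma q (F.te e))) *
        ↑(F.opBeta q (F.he e))⁻¹ := by
    rw [opC, opS, if_pos h, if_pos h]
    simp only [mul_assoc]
  have h2 := cycS_mul_cycC q h (opGamma_mem q (F.te e))
  have key : ∀ {R : Type _} [Ring R] (b x : Rˣ) (y z : R), y = ↑b * z * ↑b⁻¹ → z = ↑x - 1 →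
      1 + y = ↑(b * x * b⁻¹) := by
    intro R _ b x y z hy hz
    rw [hy, hz, mul_sub, sub_mul, mul_one, Units.mul_inv, Units.val_mul, Units.val_mul,
      add_sub_cancel]
  exact key _ _ _ _ h1 h2

theorem opV_of_not_isCyc {e : E} (h : ¬ F.IsCyc e) :
    F.opV q e = F.edgeUnit' q (F.treeUnit q) e := by
  refine Units.ext ?_
  rw [coe_opV, coe_edgeUnit' q _ h, opC, opS, if_neg h, if_neg h]

variable (F) in
/-- The operators `gPow` of the arrows of the double quiver. -/
def opArrow : E ⊕ E → (Module.End k (F.Space k))ˣ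
  | .inl e => F.opW q e
  | .inr e => (F.opV q e)⁻¹

/-- The elements `β` and `γ` do not involve the arrows of the cycle, so they may be computed from
the operators of all arrows. -/
theorem opArrow_eq_arrowUnit {i : I} {a : E ⊕ E} (ha : a ∈ F.L₁ i ++ F.L₂ i ++ F.L₃ i) :
    F.opArrow q a = F.arrowUnit q (F.treeUnit q) a := by
  rcases a with e | e
  · have h : ¬ F.IsCyc e := fun h => (F.pos_mem i e ha).2 h.1
    rw [opArrow, arrowUnit, opW, if_neg h]
  · have h : ¬ F.IsCyc e := fun h => (F.neg_mem i e ha).2 h.1 h.2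
    rw [opArrow, arrowUnit, opV_of_not_isCyc q h]

theorem opBeta_eq (i : I) :
    F.opBeta q i = F.betaVal (F.opArrow q) (fun i => F.lauUnit q (.rho i)) i :=
  (betaVal_congr fun _ ha => opArrow_eq_arrowUnit q ha).symm

theorem opGamma_eq (i : I) :
    F.opGamma q i = F.gammaVal (F.opArrow q) (fun i => F.lauUnit q (.rho i)) i :=
  (gammaVal_congr fun _ ha => opArrow_eq_arrowUnit q ha).symm

theorem lauUnit_cycle_eq {i : I} (hi : i ∈ F.cyc) : F.lauUnit q (.cycle i) =
    (F.opBeta q i)⁻¹ * (F.opArrow q (.inr (F.d (F.prd i))))⁻¹ * F.opBeta q i := by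
  rw [opArrow, inv_inv, opV_of_isCyc q (F.isCyc_d.2 (F.prd_mem i hi)), F.he_d_prd i hi]
  simp only [mul_assoc, inv_mul_cancel, inv_mul_cancel_left, mul_one]

/-- The operators satisfy the multiplicative preprojective relation with `ρ` of index `rho i`. -/
theorem prod_opArrow (i : I) :
    ((F.arrowList i).map (F.opArrow q)).prod = F.lauUnit q (.rho i) := by
  by_cases hi : i ∈ F.cyc
  · refine (prod_arrowList_of_mem F (ρ := fun i => F.lauUnit q (.rho i)) hi).2 ?_
    rw [← opBeta_eq, ← opGamma_eq, ← lauUnit_cycle_eq q hi, opArrow, opW, if_pos (F.isCyc_d.2 hi),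
      F.te_d]
  · refine (prod_arrowList_of_not_mem F (ρ := fun i => F.lauUnit q (.rho i)) hi).2 ?_
    rw [treeVal_congr fun _ ha => opArrow_eq_arrowUnit q ha, ← treeUnit_eq, opArrow, opW,
      if_neg (fun h => hi (F.isCyc_d.1 h)), edgeUnit, F.te_d, if_pos rfl]

end Frame

end

/-! ### Algebras acting on normal words -/

section

/-- The embedding of the `i`-th summand of `V^I`. -/
def inj (k : Type*) [Field k] {I : Type*} (V : Type*) [AddCommGroup V] [Module k V] (i : I) :
    V →ₗ[k] (I → V) :=
  letI := Classical.decEq I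
  LinearMap.single k (fun _ => V) i

section Inj

variable {k : Type*} [Field k] {I : Type*} {V : Type*} [AddCommGroup V] [Module k V]

theorem inj_same (i : I) (v : V) : inj k V i v i = v := by simp [inj]

theorem inj_ne {i j : I} (h : j ≠ i) (v : V) : inj k V i v j = 0 := by simp [inj, h]

theorem smul_inj (x : I → k) (i : I) (v : V) :
    (fun j => x j • inj k V i v j) = x i • inj k V i v := by
  ext j
  by_cases h : j = i
  · subst h; rfl
  · rw [Pi.smul_apply, inj_ne h, smul_zero, smul_zero]

theorem sum_inj [Fintype I] (f : I → V) : ∑ i, inj k V i (f i) = f := by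
  ext j
  rw [Finset.sum_apply, Finset.sum_eq_single j (fun i _ h => inj_ne (Ne.symm h) _) (by simp),
    inj_same]

end Inj

/-- An algebra `A` over `k^I` generated, together with the inverses of its units, by arrows `c e`
and `s e` for which `1 + c s` and `1 + s c` are invertible, which acts on `V^I`, where
`V = F.Space k`, through the operators `opC` and `opS`. The unit `arr a` is `1 + c s` for an edge
and the inverse of `1 + s c` for its opposite, and `ρ` has as its component at `i` the ordered
product of the units of the arrows with tail `i`. -/
structure Realization {I E : Type*} (F : Frame I E) {k : Type*} [Field k] (q : I → kˣ)
    {A : Type*} [Ring A] [Algebra k A] (η : (I → k) →ₐ[k] A) (ρ : Aˣ) where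
  c : E → A
  s : E → A
  map_mul_c : ∀ e x, η x * c e = x (F.te e) • c e
  c_mul_map : ∀ e x, c e * η x = x (F.he e) • c e
  map_mul_s : ∀ e x, η x * s e = x (F.he e) • s e
  s_mul_map : ∀ e x, s e * η x = x (F.te e) • s e
  arr : E ⊕ E → Aˣ
  arr_inl : ∀ e, (arr (.inl e) : A) = 1 + c e * s e
  arr_inr_inv : ∀ e, ((arr (.inr e))⁻¹ : Aˣ) = 1 + s e * c e
  commute_rho : ∀ x, Commute (η x) (ρ : A)
  rho_eq : ∀ i, η (idem k i) * ρ = η (idem k i) * (((F.arrowList i).map arr).prod : Aˣ)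
  mem_of_closed : ∀ B : Subalgebra k A, (∀ x, η x ∈ B) → (∀ e, c e ∈ B) → (∀ e, s e ∈ B) →
    (∀ u : Aˣ, (u : A) ∈ B → ((u⁻¹ : Aˣ) : A) ∈ B) → ∀ a, a ∈ B
  act : A →ₐ[k] Module.End k (I → F.Space k)
  act_map : ∀ x f, act (η x) f = fun i => x i • f i
  act_c : ∀ e f, act (c e) f = inj k _ (F.te e) (F.opC q e (f (F.he e)))
  act_s : ∀ e f, act (s e) f = inj k _ (F.he e) (F.opS q e (f (F.te e)))

namespace Realization

variable {I E : Type*} {F : Frame I E} {k : Type*} [Field k] {q : I → kˣ}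
    {A : Type*} [Ring A] [Algebra k A] {η : (I → k) →ₐ[k] A} {ρ : Aˣ} (R : Realization F q η ρ)

/-- The product of the arrows at a vertex. -/
def vertexProd (i : I) : Aˣ := ((F.arrowList i).map R.arr).prod

/-- The element `β` at a vertex. -/
def elBeta (i : I) : Aˣ := F.betaVal R.arr R.vertexProd i

/-- The element `γ` at a vertex. -/
def elGamma (i : I) : Aˣ := F.gammaVal R.arr R.vertexProd i

/-- The vertex at which a power is located. -/
def vert (F : Frame I E) : LaurentIndex I E → I
  | .rho i => i
  | .rest e => F.te e
  | .cycle i => i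

/-- The invertible element with a given index. -/
def el : LaurentIndex I E → Aˣ
  | .rho i => R.vertexProd i
  | .rest e => R.arr (.inl e)
  | .cycle i => (R.elBeta i)⁻¹ * (R.arr (.inr (F.d (F.prd i))))⁻¹ * R.elBeta i

open Classical in
/-- The element `c e`, twisted by `β` on the cycle. -/
def elC (e : E) : A := if F.IsCyc e then R.c e * R.elBeta (F.he e) else R.c e

open Classical in
/-- The element `s e`, twisted by `β` on the cycle. -/
def elS (e : E) : A := if F.IsCyc e then ↑(R.elBeta (F.he e))⁻¹ * R.s e else R.s e

/-- The element of `A` represented by a letter. -/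
def letterVal : Letter I E → A
  | .lau y n => η (idem k (vert F y)) * ((R.el y ^ n : Aˣ) - algebraMap k A (Frame.shift k q y n))
  | .c e => R.elC e
  | .s e => R.elS e

/-- The start of a letter. -/
def letterTl (F : Frame I E) : Letter I E → I
  | .lau y _ => vert F y
  | .c e => F.te e
  | .s e => F.he e

/-- The end of a letter. -/
def letterHd (F : Frame I E) : Letter I E → I
  | .lau y _ => vert F y
  | .c e => F.he e
  | .s e => F.te e

/-- The units commuting with `k^I`. -/
def baseCentralizer (η : (I → k) →ₐ[k] A) : Subgroup Aˣ where
  carrier := {u | ∀ x, Commute (η x) (u : A)}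
  one_mem' _ := Commute.one_right _
  mul_mem' hu hv x := (hu x).mul_right (hv x)
  inv_mem' hu x := (hu x).units_inv_right

theorem arr_mem (a : E ⊕ E) : R.arr a ∈ baseCentralizer η := by
  rcases a with e | e
  · intro x
    rw [R.arr_inl]
    refine (Commute.one_right _).add_right ?_
    rw [Commute, SemiconjBy, ← mul_assoc, R.map_mul_c, mul_assoc, R.s_mul_map, smul_mul_assoc,
      mul_smul_comm]
  · refine inv_mem_iff.1 fun x => ?_
    rw [R.arr_inr_inv]
    refine (Commute.one_right _).add_right ?_
    rw [Commute, SemiconjBy, ← mul_assoc, R.map_mul_s, mul_assoc, R.c_mul_map, smul_mul_assoc,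
      mul_smul_comm]

theorem vertexProd_mem (i : I) : R.vertexProd i ∈ baseCentralizer η :=
  Frame.listProd_mem fun a _ => R.arr_mem a

theorem elBeta_mem (i : I) : R.elBeta i ∈ baseCentralizer η :=
  Frame.betaVal_mem (fun a _ => R.arr_mem a) (R.vertexProd_mem i)

theorem el_mem (y : LaurentIndex I E) : R.el y ∈ baseCentralizer η := by
  cases y with
  | rho i => exact R.vertexProd_mem i
  | rest e => exact R.arr_mem _
  | cycle i =>
    exact mul_mem (mul_mem (inv_mem (R.elBeta_mem i)) (inv_mem (R.arr_mem _)))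
      (R.elBeta_mem i)

theorem commute_el_zpow (y : LaurentIndex I E) (n : ℤ) (x : I → k) :
    Commute (η x) ((R.el y ^ n : Aˣ) : A) := zpow_mem (R.el_mem y) n x

theorem map_mul_elC (e : E) (x : I → k) : η x * R.elC e = x (F.te e) • R.elC e := by
  rw [elC]
  split_ifs
  · rw [← mul_assoc, R.map_mul_c, smul_mul_assoc]
  · exact R.map_mul_c e x

theorem elC_mul_map (e : E) (x : I → k) : R.elC e * η x = x (F.he e) • R.elC e := by
  rw [elC]
  split_ifs
  · rw [mul_assoc, ← (R.elBeta_mem _ x).eq, ← mul_assoc, R.c_mul_map, smul_mul_assoc]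
  · exact R.c_mul_map e x

theorem map_mul_elS (e : E) (x : I → k) : η x * R.elS e = x (F.he e) • R.elS e := by
  rw [elS]
  split_ifs
  · rw [← mul_assoc, (inv_mem (R.elBeta_mem (F.he e)) x).eq, mul_assoc, R.map_mul_s, mul_smul_comm]
  · exact R.map_mul_s e x

theorem elS_mul_map (e : E) (x : I → k) : R.elS e * η x = x (F.te e) • R.elS e := by
  rw [elS]
  split_ifs
  · rw [mul_assoc, R.s_mul_map, mul_smul_comm]
  · exact R.s_mul_map e x

theorem map_mul_letterVal (a : Letter I E) (x : I → k) :
    η x * R.letterVal a = x (letterTl F a) • R.letterVal a := by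
  cases a with
  | lau y n => rw [letterVal, ← mul_assoc, ← map_mul, mul_idem, map_smul, smul_mul_assoc]; rfl
  | c e => exact R.map_mul_elC e x
  | s e => exact R.map_mul_elS e x

theorem letterVal_mul_map (a : Letter I E) (x : I → k) :
    R.letterVal a * η x = x (letterHd F a) • R.letterVal a := by
  cases a with
  | lau y n =>
    rw [letterVal, mul_assoc, ← ((R.commute_el_zpow y n x).sub_right
      (Algebra.commute_algebraMap_right _ _)).eq, ← mul_assoc, ← map_mul, mul_comm, mul_idem,
      map_smul, smul_mul_assoc]
    rfl
  | c e => exact R.elC_mul_map e x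
  | s e => exact R.elS_mul_map e x

theorem elC_mul_elS (e : E) : R.elC e * R.elS e = R.arr (.inl e) - 1 := by
  rw [R.arr_inl, add_sub_cancel_left, elC, elS]
  split_ifs
  · rw [mul_assoc, Units.mul_inv_cancel_left]
  · rfl

theorem arr_inl_d {i : I} (hi : i ∈ F.cyc) :
    R.arr (.inl (F.d i)) = R.elGamma i * R.el (.cycle i) :=
  (Frame.prod_arrowList_of_mem F (g := R.arr) (ρ := R.vertexProd) hi).1 rfl

theorem arr_inl_d_of_not_mem {i : I} (hi : i ∉ F.cyc) :
    R.arr (.inl (F.d i)) = F.treeVal R.arr R.vertexProd i :=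
  (Frame.prod_arrowList_of_not_mem F (g := R.arr) (ρ := R.vertexProd) hi).1 rfl

section Cycle

variable {e : E} (he : F.IsCyc e)

include he

theorem arr_inl_of_isCyc : R.arr (.inl e) = R.elGamma (F.te e) * R.el (.cycle (F.te e)) := by
  conv_lhs => rw [← he.1]
  exact R.arr_inl_d he.2

theorem el_cycle_he : R.el (.cycle (F.he e)) =
    (R.elBeta (F.he e))⁻¹ * (R.arr (.inr e))⁻¹ * R.elBeta (F.he e) := by
  have h : F.d (F.prd (F.he e)) = e := by
    conv_lhs => rw [← he.1]
    rw [F.prd_he_d _ he.2]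
    exact he.1
  rw [el, h]

theorem elS_mul_elC : R.elS e * R.elC e = R.el (.cycle (F.he e)) - 1 := by
  rw [R.el_cycle_he he, Units.val_mul, Units.val_mul, R.arr_inr_inv, elC, elS, if_pos he,
    if_pos he, mul_add, add_mul, mul_one, Units.inv_mul]
  simp only [mul_assoc, add_sub_cancel_left]

theorem elC_mul_el : R.elC e * R.el (.cycle (F.he e)) = R.arr (.inl e) * R.elC e := by
  have h := R.elS_mul_elC he
  have h1 := R.elC_mul_elS e
  have h2 : R.elC e * (R.elS e * R.elC e) = (R.elC e * R.elS e) * R.elC e := (mul_assoc _ _ _).symm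
  rw [h, h1, mul_sub, sub_mul, mul_one, one_mul] at h2
  exact sub_left_injective h2

theorem elS_mul_arr : R.elS e * R.arr (.inl e) = R.el (.cycle (F.he e)) * R.elS e := by
  have h := R.elS_mul_elC he
  have h1 := R.elC_mul_elS e
  have h2 : R.elS e * (R.elC e * R.elS e) = (R.elS e * R.elC e) * R.elS e := (mul_assoc _ _ _).symm
  rw [h, h1, mul_sub, sub_mul, mul_one, one_mul] at h2
  exact sub_left_injective h2

end Cycle

/-- The value in `A` of a vector of `V`, read at the vertex `i`. -/
def eval (i : I) : F.Space k →ₗ[k] A := Frame.lin fun w => wordVal η R.letterVal i w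

theorem eval_vec (i : I) {w} (hw : F.Normal w) :
    R.eval i (F.vec k w) = wordVal η R.letterVal i w := Frame.lin_vec _ hw

theorem map_mul_eval (x : I → k) (i : I) (f : F.Space k) :
    η x * R.eval i f = x i • R.eval i f := by
  have : LinearMap.mulLeft k (η x) ∘ₗ R.eval i = x i • R.eval i := Frame.space_ext fun w hw => by
    rw [LinearMap.comp_apply, LinearMap.mulLeft_apply, LinearMap.smul_apply, R.eval_vec i hw,
      map_mul_wordVal]
  exact LinearMap.congr_fun this f

/-- Prepending a letter corresponds to left multiplication by its value. -/
theorem eval_vec_cons {a : Letter I E} {w} (hw : F.Normal (a :: w)) :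
    R.eval (letterTl F a) (F.vec k (a :: w)) =
      R.letterVal a * R.eval (letterHd F a) (F.vec k w) := by
  rw [R.eval_vec _ hw, R.eval_vec _ hw.2.2, wordVal_cons R.letterVal_mul_map, R.map_mul_letterVal]
  simp [idem]

theorem eval_powVec {y : LaurentIndex I E} (hy : F.Admissible y) (n : ℤ) {w} (hw : F.Normal w)
    (h : ¬ Frame.Headed y w) : R.eval (vert F y) (F.powVec k q y n w) =
      (R.el y ^ n : Aˣ) * R.eval (vert F y) (F.vec k w) := by
  by_cases hn : n = 0
  · subst hn
    rw [Frame.powVec_zero, zpow_zero, Units.val_one, one_mul]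
  · have h1 := R.eval_vec_cons (Frame.normal_lau hn hy hw h)
    have h2 : R.eval (vert F y) (F.vec k w) = η (idem k (vert F y)) * R.eval (vert F y)
      (F.vec k w) := by
      rw [R.map_mul_eval]; simp [idem]
    have h3 : R.letterVal (.lau y n) * R.eval (vert F y) (F.vec k w) =
        ((R.el y ^ n : Aˣ) - algebraMap k A (Frame.shift k q y n)) * R.eval (vert F y)
          (F.vec k w) := by
      rw [letterVal, ((R.commute_el_zpow y n _).sub_right
        (Algebra.commute_algebraMap_right _ _)).eq, mul_assoc, ← h2]
    rw [Frame.powVec, map_add, map_smul]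
    refine (congrArg (· + _) (h1.trans h3)).trans ?_
    rw [sub_mul, ← Algebra.smul_def, sub_add_cancel]

end Realization

end

/-! ### Normal words span -/

section

namespace Realization

variable {I E : Type*} {F : Frame I E} {k : Type*} [Field k] {q : I → kˣ}
    {A : Type*} [Ring A] [Algebra k A] {η : (I → k) →ₐ[k] A} {ρ : Aˣ} (R : Realization F q η ρ)

/-- The pairs of an invertible operator on `V` and a unit of `A` which are compatible with the
evaluation at the vertex `i`. -/
def evalGroup (i : I) : Subgroup ((Module.End k (F.Space k))ˣ × Aˣ) where
  carrier := {p | ∀ f, R.eval i (p.1.1 f) = p.2 * R.eval i f}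
  one_mem' f := (one_mul _).symm
  mul_mem' {p p'} hp hp' f := by
    change R.eval i (p.1.1 (p'.1.1 f)) = ((p.2 * p'.2 : Aˣ) : A) * _
    rw [hp, hp', Units.val_mul, mul_assoc]
  inv_mem' {p} hp f := by
    have h := hp ((p.1⁻¹).1 f)
    rw [← Module.End.mul_apply, Units.mul_inv, Module.End.one_apply] at h
    change R.eval i ((p.1⁻¹).1 f) = ((p.2⁻¹ : Aˣ) : A) * _
    rw [h, Units.inv_mul_cancel_left]

theorem lauUnit_mem_evalGroup {y : LaurentIndex I E} (hy : F.Admissible y) :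
    (F.lauUnit q y, R.el y) ∈ R.evalGroup (vert F y) := by
  suffices h : R.eval (vert F y) ∘ₗ (F.lauUnit q y).1 =
      LinearMap.mulLeft k (R.el y : A) ∘ₗ R.eval (vert F y) from LinearMap.congr_fun h
  refine Frame.ext_powVec q (y := y) fun n w hw h => ?_
  rw [LinearMap.comp_apply, LinearMap.comp_apply, LinearMap.mulLeft_apply, Frame.coe_lauUnit q hy,
    Frame.lauOp_powVec q hy _ _ hw h, R.eval_powVec hy _ hw h, R.eval_powVec hy _ hw h,
    ← mul_assoc, ← Units.val_mul, ← zpow_one_add, add_comm]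

theorem eval_vec_c {e : E} {w} (hw : F.Normal (.c e :: w)) :
    R.eval (F.te e) (F.vec k (.c e :: w)) = R.elC e * R.eval (F.he e) (F.vec k w) :=
  R.eval_vec_cons (a := .c e) hw

theorem eval_vec_s {e : E} {w} (hw : F.Normal (.s e :: w)) :
    R.eval (F.he e) (F.vec k (.s e :: w)) = R.elS e * R.eval (F.te e) (F.vec k w) :=
  R.eval_vec_cons (a := .s e) hw

theorem eval_cOp_vec {e : E} {W : (Module.End k (F.Space k))ˣ}
    (hW : (W, R.arr (.inl e)) ∈ R.evalGroup (F.te e)) {w} (hw : F.Normal w)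
    (h : F.IsCyc e → ¬ Frame.Headed (.cycle (F.he e)) w) :
    R.eval (F.te e) (F.cOp e W (F.vec k w)) = R.elC e * R.eval (F.he e) (F.vec k w) := by
  by_cases hc : ∃ w', w = .s e :: w'
  · obtain ⟨w', rfl⟩ := hc
    rw [Frame.cOp_s _ _ hw, map_sub, hW, R.eval_vec_s hw, ← mul_assoc, R.elC_mul_elS, sub_mul,
      one_mul]
  · push Not at hc
    rw [Frame.cOp_of_ne _ _ hw hc]
    exact R.eval_vec_c (Frame.normal_c_of hw h hc)

theorem eval_app_s {e : E} (he : ¬ F.IsCyc e) (f : F.Space k) :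
    R.eval (F.he e) (F.app k (.s e) f) = R.elS e * R.eval (F.te e) f := by
  suffices h : R.eval (F.he e) ∘ₗ F.app k (.s e) =
      LinearMap.mulLeft k (R.elS e) ∘ₗ R.eval (F.te e) from LinearMap.congr_fun h f
  refine Frame.space_ext fun w hw => ?_
  rw [LinearMap.comp_apply, LinearMap.comp_apply, Frame.app_vec]
  exact R.eval_vec_s (Frame.normal_s he hw)

theorem eval_cOp {e : E} (he : ¬ F.IsCyc e) {W : (Module.End k (F.Space k))ˣ}
    (hW : (W, R.arr (.inl e)) ∈ R.evalGroup (F.te e)) (f : F.Space k) :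
    R.eval (F.te e) (F.cOp e W f) = R.elC e * R.eval (F.he e) f := by
  suffices h : R.eval (F.te e) ∘ₗ F.cOp e W =
      LinearMap.mulLeft k (R.elC e) ∘ₗ R.eval (F.he e) from LinearMap.congr_fun h f
  exact Frame.space_ext fun w hw => R.eval_cOp_vec hW hw fun h => absurd h he

theorem edgeUnit'_mem_evalGroup {e : E} (he : ¬ F.IsCyc e)
    (hW : (F.edgeUnit q (F.treeUnit q) e, R.arr (.inl e)) ∈ R.evalGroup (F.te e)) :
    (F.edgeUnit' q (F.treeUnit q) e, (R.arr (.inr e))⁻¹) ∈ R.evalGroup (F.he e) := by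
  intro f
  change R.eval (F.he e) ((F.edgeUnit' q (F.treeUnit q) e).1 f) = ((R.arr (.inr e))⁻¹ : Aˣ) * _
  have h1 : R.elS e * R.elC e = R.s e * R.c e := by rw [elS, elC, if_neg he, if_neg he]
  rw [R.arr_inr_inv, Frame.coe_edgeUnit' q _ he, LinearMap.add_apply, map_add,
    Module.End.mul_apply, R.eval_app_s he, R.eval_cOp he hW, ← mul_assoc, h1, add_mul, one_mul]
  rfl

/-- By induction on the rank of the tail: for an edge `d i` the operator and the unit are computed
by the same formula `treeVal` from arrows involving only vertices of smaller rank. -/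
theorem edgeUnit_mem_evalGroup : ∀ (n : ℕ) {e : E}, ¬ F.IsCyc e → F.rank (F.te e) < n →
    (F.edgeUnit q (F.treeUnit q) e, R.arr (.inl e)) ∈ R.evalGroup (F.te e) := by
  intro n
  induction n with
  | zero => intro e _ hn; exact absurd hn (Nat.not_lt_zero _)
  | succ n ih =>
    intro e he hn
    by_cases hd : F.d (F.te e) = e
    · have hi : F.te e ∉ F.cyc := fun h => he ⟨hd, h⟩
      have h1 := R.arr_inl_d_of_not_mem hi
      rw [hd] at h1
      rw [Frame.edgeUnit, if_pos hd, Frame.treeUnit_eq, h1, Frame.prodMk_treeVal]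
      refine Frame.treeVal_mem (fun a ha => ?_) (R.lauUnit_mem_evalGroup (y := .rho
        (F.te e)) trivial)
      rcases a with e' | e'
      · obtain ⟨h2, h3⟩ := F.pos_mem _ _ ha
        have h4 := R.lauUnit_mem_evalGroup (y := .rest e') h3
        rw [Frame.arrowUnit, Frame.edgeUnit, if_neg h3]
        rw [← h2]
        exact h4
      · obtain ⟨h2, h3⟩ := F.neg_mem _ _ ha
        have he' : ¬ F.IsCyc e' := fun h => h3 h.1 h.2
        have h4 : (F.edgeUnit q (F.treeUnit q) e', R.arr (.inl e')) ∈ R.evalGroup (F.te e') := by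
          by_cases hd' : F.d (F.te e') = e'
          · refine ih he' ?_
            have h5 := F.rank_lt _ (h3 hd')
            rw [hd', h2] at h5
            omega
          · have h4 := R.lauUnit_mem_evalGroup (y := .rest e') hd'
            rw [Frame.edgeUnit, if_neg hd']
            exact h4
        have h5 := inv_mem (R.edgeUnit'_mem_evalGroup he' h4)
        rw [← h2]
        rwa [Prod.inv_mk, inv_inv] at h5
    · have h4 := R.lauUnit_mem_evalGroup (y := .rest e) hd
      rw [Frame.edgeUnit, if_neg hd]
      exact h4

theorem arrowUnit_mem_evalGroup {i : I} {a : E ⊕ E} (ha : a ∈ F.L₁ i ++ F.L₂ i ++ F.L₃ i) :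
    (F.arrowUnit q (F.treeUnit q) a, R.arr a) ∈ R.evalGroup i := by
  rcases a with e | e
  · obtain ⟨h2, h3⟩ := F.pos_mem _ _ ha
    rw [← h2]
    exact R.edgeUnit_mem_evalGroup _ (fun h => h3 h.1) (Nat.lt_succ_self _)
  · obtain ⟨h2, h3⟩ := F.neg_mem _ _ ha
    have he : ¬ F.IsCyc e := fun h => h3 h.1 h.2
    have h5 := inv_mem (R.edgeUnit'_mem_evalGroup he
      (R.edgeUnit_mem_evalGroup _ he (Nat.lt_succ_self _)))
    rw [← h2]
    rwa [Prod.inv_mk, inv_inv] at h5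

theorem opBeta_mem_evalGroup (i : I) : (F.opBeta q i, R.elBeta i) ∈ R.evalGroup i := by
  rw [Frame.opBeta, elBeta, Frame.prodMk_betaVal]
  exact Frame.betaVal_mem (fun a ha => R.arrowUnit_mem_evalGroup ha)
    (R.lauUnit_mem_evalGroup (y := .rho i) trivial)

theorem opGamma_mem_evalGroup (i : I) : (F.opGamma q i, R.elGamma i) ∈ R.evalGroup i := by
  rw [Frame.opGamma, elGamma, Frame.prodMk_gammaVal]
  exact Frame.gammaVal_mem (fun a ha => R.arrowUnit_mem_evalGroup ha)
    (R.lauUnit_mem_evalGroup (y := .rho i) trivial)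

section Cycle

variable {e : E} (he : F.IsCyc e)

include he

theorem mul_lauUnit_mem_evalGroup :
    (F.opGamma q (F.te e) * F.lauUnit q (.cycle (F.te e)), R.arr (.inl e)) ∈
      R.evalGroup (F.te e) := by
  rw [R.arr_inl_of_isCyc he]
  have h := (R.evalGroup (F.te e)).mul_mem (R.opGamma_mem_evalGroup (F.te e))
    (R.lauUnit_mem_evalGroup (y := .cycle (F.te e)) he.2)
  rwa [Prod.mk_mul_mk] at h

theorem eval_cycC (f : F.Space k) :
    R.eval (F.te e) (F.cycC q e (F.opGamma q (F.te e)) f) = R.elC e * R.eval (F.he e) f := by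
  suffices h : R.eval (F.te e) ∘ₗ F.cycC q e (F.opGamma q (F.te e)) =
      LinearMap.mulLeft k (R.elC e) ∘ₗ R.eval (F.he e) from LinearMap.congr_fun h f
  refine Frame.ext_powVec q (y := .cycle (F.he e)) fun n w hw h => ?_
  have h1 := R.mul_lauUnit_mem_evalGroup he
  have h2 := zpow_mem h1 n (F.cOp e (F.opGamma q (F.te e) * F.lauUnit q (.cycle (F.te e)))
    (F.vec k w))
  have h3 : SemiconjBy (R.elC e) ((R.el (.cycle (F.he e)) ^ n : Aˣ) : A)
      ((R.arr (.inl e) ^ n : Aˣ) : A) := SemiconjBy.units_zpow_right (R.elC_mul_el he) n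
  have h4 := R.eval_powVec (q := q) (y := .cycle (F.he e)) (Frame.he_mem he) n hw h
  rw [LinearMap.comp_apply, LinearMap.comp_apply, LinearMap.mulLeft_apply,
    Frame.cycC_powVec q he n hw h]
  refine (h2.trans ?_).trans (congrArg (R.elC e * ·) h4.symm)
  rw [R.eval_cOp_vec h1 hw fun _ => h]
  simp only [← mul_assoc, vert]
  rw [h3.eq]
  rfl

/-- The two sides agree on words not starting with a power of index `cycle (te e)`, and both
intertwine `γ u` with the element of index `cycle (he e)`. -/
theorem eval_cycS (f : F.Space k) :
    R.eval (F.he e) (F.cycS q e (F.opGamma q (F.te e)) f) = R.elS e * R.eval (F.te e) f := by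
  have hγ := Frame.opGamma_mem (F := F) q (F.te e)
  have hU : ∀ f, R.eval (F.he e) ((F.lauUnit q (.cycle (F.he e))).1 f) =
    R.el (.cycle (F.he e)) * R.eval (F.he e) f :=
    R.lauUnit_mem_evalGroup (y := .cycle (F.he e)) (Frame.he_mem he)
  set T : F.Space k →ₗ[k] A := R.eval (F.he e) ∘ₗ F.cycS q e (F.opGamma q (F.te e)) -
      LinearMap.mulLeft k (R.elS e) ∘ₗ R.eval (F.te e) with hTdef
  have hTapp : ∀ f, T f = R.eval (F.he e) (F.cycS q e (F.opGamma q (F.te e)) f) -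
    R.elS e * R.eval (F.te e) f := fun f => rfl
  suffices h : T = 0 by
    have h1 := LinearMap.congr_fun h f
    rwa [hTapp, LinearMap.zero_apply, sub_eq_zero] at h1
  refine Frame.eq_zero_of_cycle q he.2 hγ (fun w hw h => ?_) fun f => ?_
  · rw [hTapp, sub_eq_zero, Frame.cycS_vec q hγ hw h]
    by_cases hc : ∃ w', w = .c e :: w'
    · obtain ⟨w', rfl⟩ := hc
      rw [Frame.sOpZero_c q e hw, map_sub, hU, R.eval_vec_c hw, ← mul_assoc, R.elS_mul_elC he,
        sub_mul, one_mul]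
    · push Not at hc
      rw [Frame.sOpZero_of_ne q e hw hc]
      exact R.eval_vec_s (Frame.normal_s_of hw h hc)
  · have h1 := LinearMap.congr_fun (Frame.cycS_mul q he hγ) f
    rw [Module.End.mul_apply, Module.End.mul_apply] at h1
    rw [hTapp, hTapp, h1, hU, R.mul_lauUnit_mem_evalGroup he, ← mul_assoc (R.elS e),
      R.elS_mul_arr he, mul_assoc, ← mul_sub]
    exact Units.mul_right_eq_zero _

end Cycle

theorem eval_opC (e : E) (f : F.Space k) :
    R.eval (F.te e) (F.opC q e f) = R.c e * R.eval (F.he e) f := by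
  rw [Frame.opC]
  split_ifs with he
  · have h := inv_mem (R.opBeta_mem_evalGroup (F.he e)) f
    rw [Module.End.mul_apply, R.eval_cycC he]
    refine (congrArg (R.elC e * ·) h).trans ?_
    change R.elC e * (((R.elBeta (F.he e))⁻¹ : Aˣ) * _) = _
    rw [elC, if_pos he, mul_assoc, Units.mul_inv_cancel_left]
  · rw [R.eval_cOp he (R.edgeUnit_mem_evalGroup _ he (Nat.lt_succ_self _)), elC, if_neg he]

theorem eval_opS (e : E) (f : F.Space k) :
    R.eval (F.he e) (F.opS q e f) = R.s e * R.eval (F.te e) f := by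
  rw [Frame.opS]
  split_ifs with he
  · rw [Module.End.mul_apply, R.opBeta_mem_evalGroup, R.eval_cycS he, elS, if_pos he, mul_assoc,
      Units.mul_inv_cancel_left]
  · rw [R.eval_app_s he, elS, if_neg he]

theorem mul_eval_of_mul_map {a : A} {i : I} (ha : ∀ x, a * η x = x i • a) {j : I} (h : j ≠ i)
    (f : F.Space k) : a * R.eval j f = 0 := by
  have h1 : R.eval j f = η (idem k j) * R.eval j f := by
    rw [R.map_mul_eval]; simp [idem]
  rw [h1, ← mul_assoc, ha]
  simp [idem, h.symm]

variable [Fintype I]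

/-- The evaluation map from `V^I` to `A`. -/
def evalTotal : (I → F.Space k) →ₗ[k] A := ∑ i, R.eval i ∘ₗ LinearMap.proj i

theorem evalTotal_apply (f : I → F.Space k) : R.evalTotal f = ∑ i, R.eval i (f i) := by
  simp [evalTotal]

theorem evalTotal_inj (i : I) (v : F.Space k) : R.evalTotal (inj k _ i v) = R.eval i v := by
  rw [evalTotal_apply, Finset.sum_eq_single i (fun j _ h => by rw [inj_ne h, map_zero]) (by simp),
    inj_same]

theorem mul_evalTotal_of_mul_map {a : A} {i : I} (ha : ∀ x, a * η x = x i • a)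
    (f : I → F.Space k) : a * R.evalTotal f = a * R.eval i (f i) := by
  rw [evalTotal_apply, Finset.mul_sum, Finset.sum_eq_single i
    (fun j _ h => R.mul_eval_of_mul_map ha h _) (by simp)]

/-- The evaluation `V^I → A` is `A`-linear. -/
theorem evalTotal_act (a : A) (f : I → F.Space k) :
    R.evalTotal (R.act a f) = a * R.evalTotal f := by
  let B : Subalgebra k A :=
    { carrier := {a | ∀ f, R.evalTotal (R.act a f) = a * R.evalTotal f}
      mul_mem' := fun {a b} ha hb f => by
        rw [map_mul, Module.End.mul_apply, ha, hb, mul_assoc]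
      add_mem' := fun {a b} ha hb f => by
        rw [map_add, LinearMap.add_apply, map_add, ha, hb, add_mul]
      algebraMap_mem' := fun c f => by
        rw [AlgHom.commutes, Module.algebraMap_end_apply, map_smul, Algebra.smul_def] }
  refine R.mem_of_closed B (fun x f => ?_) (fun e f => ?_) (fun e f => ?_) (fun u hu f => ?_) a f
  · rw [R.act_map, evalTotal_apply, evalTotal_apply, Finset.mul_sum]
    exact Finset.sum_congr rfl fun i _ => by rw [map_smul, R.map_mul_eval]
  · rw [R.act_c, evalTotal_inj, R.eval_opC, R.mul_evalTotal_of_mul_map (R.c_mul_map e)]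
  · rw [R.act_s, evalTotal_inj, R.eval_opS, R.mul_evalTotal_of_mul_map (R.s_mul_map e)]
  · have h1 := hu (R.act ((u⁻¹ : Aˣ) : A) f)
    rw [← Module.End.mul_apply, ← map_mul, Units.mul_inv, map_one, Module.End.one_apply] at h1
    rw [h1, Units.inv_mul_cancel_left]

/-- The normal words span `A`. -/
theorem span_wordVal_eq_top : ⊤ ≤ Submodule.span k (Set.range
    fun p : {p : I × List (Letter I E) //
      F.Normal p.2 ∧ Composable (letterTl F) (letterHd F) p.1 p.2} =>
        wordVal η R.letterVal p.1.1 p.1.2) := by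
  intro a _
  -- Every `a` is the evaluation of `a` applied to the family of empty words.
  have h1 : R.evalTotal (fun _ => F.vec k []) = 1 := by
    rw [evalTotal_apply]
    simp only [fun i => R.eval_vec i (w := []) trivial, wordVal_nil]
    rw [← map_sum, sum_idem, map_one]
  rw [← mul_one a, ← h1, ← R.evalTotal_act, evalTotal_apply]
  refine Submodule.sum_mem _ fun i _ => ?_
  refine Submodule.mem_comap.1 (Frame.mem_of_vec_mem (fun w hw => ?_) _)
  rw [Submodule.mem_comap, R.eval_vec i hw]
  by_cases hc : Composable (letterTl F) (letterHd F) i w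
  · exact Submodule.subset_span ⟨⟨(i, w), hw, hc⟩, rfl⟩
  · rw [wordVal_of_not_composable R.map_mul_letterVal R.letterVal_mul_map w i hc]
    exact zero_mem _

end Realization

end

/-! ### Normal words are linearly independent -/

section

theorem prodMk_listProd {α G G' : Type*} [Monoid G] [Monoid G'] (g : α → G) (g' : α → G')
    (l : List α) : ((l.map g).prod, (l.map g').prod) = (l.map fun a => (g a, g' a)).prod := by
  induction l with
  | nil => rfl
  | cons a l ih => rw [List.map_cons, List.map_cons, List.map_cons, List.prod_cons, List.prod_cons,
      List.prod_cons, ← ih, Prod.mk_mul_mk]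

namespace Realization

variable {I E : Type*} {F : Frame I E} {k : Type*} [Field k] {q : I → kˣ}
    {A : Type*} [Ring A] [Algebra k A] {η : (I → k) →ₐ[k] A} {ρ : Aˣ} (R : Realization F q η ρ)

theorem act_map_inj (x : I → k) (i : I) (f : F.Space k) :
    R.act (η x) (inj k _ i f) = x i • inj k _ i f := by
  rw [R.act_map, smul_inj]

theorem act_c_inj (e : E) (f : F.Space k) :
    R.act (R.c e) (inj k _ (F.he e) f) = inj k _ (F.te e) (F.opC q e f) := by
  rw [R.act_c, inj_same]

theorem act_s_inj (e : E) (f : F.Space k) :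
    R.act (R.s e) (inj k _ (F.te e) f) = inj k _ (F.he e) (F.opS q e f) := by
  rw [R.act_s, inj_same]

/-- The pairs of an invertible operator on `V` and a unit of `A` which acts on the `i`-th summand
of `V^I` through this operator. -/
def actGroup (i : I) : Subgroup ((Module.End k (F.Space k))ˣ × Aˣ) where
  carrier := {p | ∀ f, R.act p.2 (inj k _ i f) = inj k _ i (p.1.1 f)}
  one_mem' f := by
    change R.act ((1 : Aˣ) : A) _ = _
    rw [Units.val_one, map_one]
    rfl
  mul_mem' {p p'} hp hp' f := by
    change R.act ((p.2 * p'.2 : Aˣ) : A) _ = inj k _ i (p.1.1 (p'.1.1 f))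
    rw [← hp, ← hp', Units.val_mul, map_mul, Module.End.mul_apply]
  inv_mem' {p} hp f := by
    have h := congrArg (R.act ((p.2⁻¹ : Aˣ) : A)) (hp ((p.1⁻¹).1 f))
    rw [← Module.End.mul_apply, ← Module.End.mul_apply p.1.1, ← map_mul, Units.inv_mul, map_one,
      Units.mul_inv] at h
    exact h.symm

theorem arr_inl_mem_actGroup (e : E) :
    (F.opW q e, R.arr (.inl e)) ∈ R.actGroup (F.te e) := by
  intro f
  change R.act (R.arr (.inl e) : A) _ = inj k _ _ ((F.opW q e).1 f)
  rw [R.arr_inl, Frame.coe_opW, map_add, map_one, map_mul, LinearMap.add_apply,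
    Module.End.mul_apply, R.act_s_inj, R.act_c_inj, LinearMap.add_apply, map_add]
  rfl

theorem arr_inr_mem_actGroup (e : E) :
    ((F.opV q e)⁻¹, R.arr (.inr e)) ∈ R.actGroup (F.he e) := by
  have h : (F.opV q e, (R.arr (.inr e))⁻¹) ∈ R.actGroup (F.he e) := by
    intro f
    change R.act ((R.arr (.inr e))⁻¹ : Aˣ) _ = inj k _ _ ((F.opV q e).1 f)
    rw [R.arr_inr_inv, Frame.coe_opV, map_add, map_one, map_mul, LinearMap.add_apply,
      Module.End.mul_apply, R.act_c_inj, R.act_s_inj, LinearMap.add_apply, map_add]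
    rfl
  have h5 := inv_mem h
  rwa [Prod.inv_mk, inv_inv] at h5

theorem opArrow_mem_actGroup_of_mem {i : I} {a : E ⊕ E}
    (ha : a ∈ F.L₁ i ++ F.L₂ i ++ F.L₃ i) : (F.opArrow q a, R.arr a) ∈ R.actGroup i := by
  rcases a with e | e
  · rw [← (F.pos_mem _ _ ha).1]
    exact R.arr_inl_mem_actGroup e
  · rw [← (F.neg_mem _ _ ha).1]
    exact R.arr_inr_mem_actGroup e

theorem opArrow_mem_actGroup {i : I} {a : E ⊕ E} (ha : a ∈ F.arrowList i) :
    (F.opArrow q a, R.arr a) ∈ R.actGroup i := by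
  by_cases hL : a ∈ F.L₁ i ++ F.L₂ i ++ F.L₃ i
  · exact R.opArrow_mem_actGroup_of_mem hL
  have h : a = .inl (F.d i) ∨ i ∈ F.cyc ∧ a = .inr (F.d (F.prd i)) := by
    simp only [List.mem_append, not_or] at hL
    rw [Frame.arrowList] at ha
    split_ifs at ha with h1 h2
    · simp only [List.mem_append, List.mem_cons] at ha; tauto
    · simp only [List.mem_append, List.mem_cons] at ha; tauto
    · simp only [List.mem_append, List.mem_cons] at ha; tauto
  rcases h with rfl | ⟨hi, rfl⟩
  · have h1 := R.arr_inl_mem_actGroup (F.d i)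
    rwa [F.te_d] at h1
  · have h1 := R.arr_inr_mem_actGroup (F.d (F.prd i))
    rwa [F.he_d_prd _ hi] at h1

theorem vertexProd_mem_actGroup (i : I) :
    (F.lauUnit q (.rho i), R.vertexProd i) ∈ R.actGroup i := by
  rw [← Frame.prod_opArrow, vertexProd, prodMk_listProd]
  exact Frame.listProd_mem fun a ha => R.opArrow_mem_actGroup ha

theorem elBeta_mem_actGroup (i : I) : (F.opBeta q i, R.elBeta i) ∈ R.actGroup i := by
  rw [Frame.opBeta_eq, elBeta, Frame.prodMk_betaVal]
  exact Frame.betaVal_mem (fun a ha => R.opArrow_mem_actGroup_of_mem ha)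
    (R.vertexProd_mem_actGroup i)

theorem el_mem_actGroup {y : LaurentIndex I E} (hy : F.Admissible y) :
    (F.lauUnit q y, R.el y) ∈ R.actGroup (vert F y) := by
  cases y with
  | rho i => exact R.vertexProd_mem_actGroup i
  | rest e =>
    have h := R.arr_inl_mem_actGroup e
    rwa [Frame.opW, if_neg fun h => hy h.1, Frame.edgeUnit, if_neg hy] at h
  | cycle i =>
    have h := R.arr_inr_mem_actGroup (F.d (F.prd i))
    rw [F.he_d_prd _ hy] at h
    have hβ := R.elBeta_mem_actGroup i
    have h1 := (R.actGroup i).mul_mem ((R.actGroup i).mul_mem (inv_mem hβ) (inv_mem h)) hβ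
    rw [Frame.lauUnit_cycle_eq q hy]
    exact h1

theorem act_elC {e : E} {w} (hw : F.Normal (.c e :: w)) :
    R.act (R.elC e) (inj k _ (F.he e) (F.vec k w)) = inj k _ (F.te e) (F.vec k (.c e :: w)) := by
  rw [elC]
  split_ifs with he
  · rw [map_mul, Module.End.mul_apply, R.elBeta_mem_actGroup, R.act_c_inj, Frame.opC, if_pos he,
      Module.End.mul_apply, ← Module.End.mul_apply _ _ (F.vec k w), Units.inv_mul,
      Module.End.one_apply, Frame.cycC_normal q he hw]
  · rw [R.act_c_inj, Frame.opC, if_neg he, Frame.cOp_of_ne _ _ hw.2.2]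
    rintro w' rfl
    exact hw.2.1 _ (by simp) (.c_s e)

theorem act_elS {e : E} {w} (hw : F.Normal (.s e :: w)) :
    R.act (R.elS e) (inj k _ (F.te e) (F.vec k w)) = inj k _ (F.he e) (F.vec k (.s e :: w)) := by
  rw [elS]
  split_ifs with he
  · have h := inv_mem (R.elBeta_mem_actGroup (F.he e))
      ((F.opBeta q (F.he e)).1 (F.cycS q e (F.opGamma q (F.te e)) (F.vec k w)))
    rw [map_mul, Module.End.mul_apply, R.act_s_inj, Frame.opS, if_pos he, Module.End.mul_apply]
    refine h.trans ?_
    change inj k _ (F.he e) (((F.opBeta q (F.he e))⁻¹).1 _) = _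
    rw [← Module.End.mul_apply, Units.inv_mul, Module.End.one_apply,
      Frame.cycS_normal q he (Frame.opGamma_mem q _) hw]
  · rw [R.act_s_inj, Frame.opS, if_neg he, Frame.app_vec]

theorem act_letterVal {a : Letter I E} {w} (hw : F.Normal (a :: w)) :
    R.act (R.letterVal a) (inj k _ (letterHd F a) (F.vec k w)) =
      inj k _ (letterTl F a) (F.vec k (a :: w)) := by
  cases a with
  | lau y n =>
    have h1 := zpow_mem (R.el_mem_actGroup hw.1.2) n (F.vec k w)
    change R.act ((R.el y ^ n : Aˣ) : A) _ = inj k _ _ (((F.lauUnit q y) ^ n).1 _) at h1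
    change R.act (R.letterVal (.lau y n)) (inj k _ (vert F y) _) = inj k _ (vert F y) _
    rw [letterVal, map_mul, map_sub, AlgHom.commutes, Module.End.mul_apply, LinearMap.sub_apply, h1,
      Frame.coe_lauUnit_zpow q hw.1.2, Frame.lauOp_of_not_headed q n hw.2.2
      (Frame.not_headed_of_normal hw), Module.algebraMap_end_apply, ← map_smul, ← map_sub,
      Frame.powVec, add_sub_cancel_right, R.act_map_inj]
    simp [idem]
  | c e => exact R.act_elC hw
  | s e => exact R.act_elS hw

/-- The value of a normal word, applied to the family of empty words, gives back the word. -/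
theorem act_wordVal (w : List (Letter I E)) : ∀ i, F.Normal w →
    Composable (letterTl F) (letterHd F) i w →
    R.act (wordVal η R.letterVal i w) (fun _ => F.vec k []) = inj k _ i (F.vec k w) := by
  induction w with
  | nil =>
    intro i _ _
    rw [wordVal_nil, R.act_map]
    ext j
    by_cases h : j = i
    · subst h; rw [inj_same]; simp [idem]
    · rw [inj_ne h]; simp [idem, h]
  | cons a w ih =>
    rintro i hw ⟨rfl, hc⟩
    rw [wordVal_cons R.letterVal_mul_map, R.map_mul_letterVal, map_mul, Module.End.mul_apply,
      ih _ hw.2.2 hc, map_smul, LinearMap.smul_apply, R.act_letterVal hw]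
    simp [idem]

/-- The normal words are linearly independent. -/
theorem linearIndependent_wordVal [Fintype I] : LinearIndependent k
    fun p : {p : I × List (Letter I E) //
      F.Normal p.2 ∧ Composable (letterTl F) (letterHd F) p.1 p.2} =>
        wordVal η R.letterVal p.1.1 p.1.2 := by
  refine LinearIndependent.of_comp
    ((LinearMap.applyₗ (R := k) fun _ : I => F.vec k []) ∘ₗ R.act.toLinearMap) ?_
  let b : Module.Basis (Σ _ : I, {w : List (Letter I E) // F.Normal w}) k (I → F.Space k) :=
    Pi.basis fun _ : I => F.spaceBasis k
  have h1 := b.linearIndependent.comp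
    (fun p : {p : I × List (Letter I E) //
      F.Normal p.2 ∧ Composable (letterTl F) (letterHd F) p.1 p.2} => ⟨p.1.1, p.1.2, p.2.1⟩)
    (by
      rintro ⟨⟨i, w⟩, h⟩ ⟨⟨j, v⟩, h'⟩ h''
      simp only [Sigma.mk.injEq] at h''
      obtain ⟨rfl, h2⟩ := h''
      rw [heq_eq_eq, Subtype.mk.injEq] at h2
      subst h2
      rfl)
  convert h1 using 1
  funext p
  change R.act (wordVal η R.letterVal p.1.1 p.1.2) (fun _ => F.vec k []) = _
  rw [R.act_wordVal _ _ p.2.1 p.2.2, Frame.vec_of_normal p.2.1]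
  classical
  rw [Function.comp_apply]
  refine Eq.trans ?_ (Pi.basis_apply (fun _ : I => F.spaceBasis k) _).symm
  ext j
  by_cases h : j = p.1.1
  · subst h; rw [inj_same]; simp
  · rw [inj_ne h]; simp [h]

end Realization

namespace Frame

variable {I E : Type*} (F : Frame I E)

/-- The letters `lau (rho i) n`. -/
def IsRho (a : Letter I E) : Prop := ∃ i n, a = .lau (.rho i) n

/-- The adjacent letters allowed in normal words without adjacent powers of `ρ`. -/
def Allowed (a b : Letter I E) : Prop := ¬ F.Forbidden a b ∧ ¬ (IsRho a ∧ IsRho b)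

/-- The normal words in which no two powers of `ρ`, at possibly different vertices, are adjacent.
For paths this is the same as normality, but it can be tested without reference to composability.
-/
def SepNormal (w : List (Letter I E)) : Prop := (∀ a ∈ w, F.Valid a) ∧ w.IsChain F.Allowed

variable {F}

theorem normal_of_sepNormal : ∀ {w : List (Letter I E)}, F.SepNormal w → F.Normal w
  | [], _ => trivial
  | a :: w, ⟨h1, h2⟩ => by
    rw [List.isChain_cons] at h2
    exact ⟨h1 a (by simp), fun b hb => (h2.1 b hb).1,
      normal_of_sepNormal ⟨fun b hb => h1 b (by simp [hb]), h2.2⟩⟩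

theorem sepNormal_of_normal : ∀ {w : List (Letter I E)} (i), F.Normal w →
    Composable (Realization.letterTl F) (Realization.letterHd F) i w → F.SepNormal w
  | [], _, _, _ => ⟨by simp, List.isChain_nil⟩
  | a :: w, i, h, hc => by
    obtain ⟨h1, h2⟩ := sepNormal_of_normal _ h.2.2 hc.2
    refine ⟨by simpa using ⟨h.1, h1⟩, List.isChain_cons.2 ⟨fun b hb => ⟨h.2.1 b hb, ?_⟩, h2⟩⟩
    rintro ⟨⟨i, n, rfl⟩, ⟨j, m, rfl⟩⟩
    obtain ⟨v, rfl⟩ := List.head?_eq_some_iff.1 hb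
    have hij : j = i := hc.2.1
    subst hij
    exact h.2.1 _ hb (.lau _ n m)

theorem allowed_rho_right {a : Letter I E} {i n} :
    F.Allowed a (.lau (.rho i) n) ↔ ¬ IsRho a := by
  refine ⟨fun h h' => h.2 ⟨h', _, _, rfl⟩, fun h => ⟨fun hf => ?_, fun h' => h h'.1⟩⟩
  cases hf with
  | lau _ m _ => exact h ⟨_, _, rfl⟩

theorem allowed_rho_left {a : Letter I E} {i n} :
    F.Allowed (.lau (.rho i) n) a ↔ ¬ IsRho a := by
  refine ⟨fun h h' => h.2 ⟨⟨_, _, rfl⟩, h'⟩, fun h => ⟨fun hf => ?_, fun h' => h h'.2⟩⟩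
  cases hf with
  | lau _ _ m => exact h ⟨_, _, rfl⟩

theorem sepNormal_rho (u : List (Letter I E)) (i : I) (n : ℤ) (v : List (Letter I E)) :
    F.SepNormal (u ++ .lau (.rho i) n :: v) ↔ F.SepNormal u ∧ F.SepNormal v ∧ n ≠ 0 ∧
      (∀ u' j m, u ≠ u' ++ [.lau (.rho j) m]) ∧ (∀ v' j m, v ≠ .lau (.rho j) m :: v') := by
  have e1 : (∀ a ∈ u.getLast?, ∀ b ∈ (Letter.lau (.rho i) n :: v).head?, F.Allowed a b) ↔
      ∀ u' j m, u ≠ u' ++ [.lau (.rho j) m] := by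
    simp only [List.head?_cons, Option.mem_def, Option.some.injEq, forall_eq', allowed_rho_right,
      List.getLast?_eq_some_iff]
    constructor
    · rintro h u' j m rfl
      exact h _ ⟨u', rfl⟩ ⟨j, m, rfl⟩
    · rintro h a ⟨u', rfl⟩ ⟨j, m, rfl⟩
      exact h u' j m rfl
  have e2 : (∀ b ∈ v.head?, F.Allowed (.lau (.rho i) n) b) ↔
      ∀ v' j m, v ≠ .lau (.rho j) m :: v' := by
    simp only [Option.mem_def, allowed_rho_left, List.head?_eq_some_iff]
    constructor
    · rintro h v' j m rfl
      exact h _ ⟨v', rfl⟩ ⟨j, m, rfl⟩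
    · rintro h a ⟨v', rfl⟩ ⟨j, m, rfl⟩
      exact h v' j m rfl
  have e3 : (∀ a ∈ u ++ Letter.lau (.rho i) n :: v, F.Valid a) ↔
      (∀ a ∈ u, F.Valid a) ∧ n ≠ 0 ∧ ∀ a ∈ v, F.Valid a := by
    simp only [List.mem_append, List.mem_cons, or_imp, forall_and, forall_eq]
    refine and_congr_right fun _ => and_congr_left fun _ => ?_
    exact ⟨fun h => h.1, fun h => ⟨h, trivial⟩⟩
  rw [SepNormal, List.isChain_append, e1, List.isChain_cons, e2, e3, SepNormal, SepNormal]
  tauto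

end Frame

namespace Realization

variable {I E : Type*} {F : Frame I E} {k : Type*} [Field k] {q : I → kˣ}
    {A : Type*} [Ring A] [Algebra k A] {η : (I → k) →ₐ[k] A} {ρ : Aˣ}

/-- The pairs of units whose components at `i` agree, the first one commuting with `eᵢ`. -/
def cornerGroup (η : (I → k) →ₐ[k] A) (i : I) : Subgroup (Aˣ × Aˣ) where
  carrier := {p | Commute (η (idem k i)) p.1 ∧ η (idem k i) * p.1 = η (idem k i) * p.2}
  one_mem' := ⟨Commute.one_right _, rfl⟩
  mul_mem' {p p'} hp hp' := by
    refine ⟨hp.1.mul_right hp'.1, ?_⟩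
    change _ * ((p.1 * p'.1 : Aˣ) : A) = _ * ((p.2 * p'.2 : Aˣ) : A)
    rw [Units.val_mul, Units.val_mul, ← mul_assoc, hp.1.eq, mul_assoc, hp'.2, ← mul_assoc,
      ← hp.1.eq, hp.2, mul_assoc]
  inv_mem' {p} hp := by
    refine ⟨hp.1.units_inv_right, ?_⟩
    change _ * ((p.1⁻¹ : Aˣ) : A) = _ * ((p.2⁻¹ : Aˣ) : A)
    rw [hp.1.units_inv_right.eq, Units.inv_mul_eq_iff_eq_mul, ← mul_assoc, ← hp.1.eq, hp.2,
      mul_assoc, Units.mul_inv, mul_one]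

variable (R : Realization F q η ρ)

theorem letterVal_rho (i : I) (n : ℤ) : R.letterVal (.lau (.rho i) n) = powElt q η ρ i n := by
  have h : (ρ, R.vertexProd i) ∈ cornerGroup η i := ⟨R.commute_rho _, R.rho_eq i⟩
  have h1 : η (idem k i) * ((ρ ^ n : Aˣ) : A) = η (idem k i) * ((R.vertexProd i ^ n : Aˣ) : A) :=
    (zpow_mem h n).2
  rw [powElt, mul_sub, h1, ← mul_sub]
  rfl

variable [Fintype I]

theorem linearIndependent_sepNormal : LinearIndependent k
    fun p : {p : I × List (Letter I E) //
      F.SepNormal p.2 ∧ Composable (letterTl F) (letterHd F) p.1 p.2} =>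
        wordVal η R.letterVal p.1.1 p.1.2 := by
  let φ : {p : I × List (Letter I E) //
      F.SepNormal p.2 ∧ Composable (letterTl F) (letterHd F) p.1 p.2} →
      {p : I × List (Letter I E) //
        F.Normal p.2 ∧ Composable (letterTl F) (letterHd F) p.1 p.2} :=
    Subtype.map id fun p hp => ⟨Frame.normal_of_sepNormal hp.1, hp.2⟩
  exact R.linearIndependent_wordVal.comp φ (Subtype.map_injective _ Function.injective_id)

theorem span_sepNormal_eq_top : ⊤ ≤ Submodule.span k (Set.range
    fun p : {p : I × List (Letter I E) //
      F.SepNormal p.2 ∧ Composable (letterTl F) (letterHd F) p.1 p.2} =>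
        wordVal η R.letterVal p.1.1 p.1.2) := by
  refine R.span_wordVal_eq_top.trans (Submodule.span_mono ?_)
  rintro _ ⟨⟨p, h1, h2⟩, rfl⟩
  exact ⟨⟨p, Frame.sepNormal_of_normal _ h1 h2, h2⟩, rfl⟩

/-- The basis of normal words. -/
def wordBasis : WordBasis η q ρ (Letter I E) where
  tl := letterTl F
  hd := letterHd F
  val := R.letterVal
  map_mul_val := R.map_mul_letterVal
  val_mul_map := R.letterVal_mul_map
  T i n := .lau (.rho i) n
  T_injective i j m n h := by cases h; rfl
  tl_T _ _ := rfl
  hd_T _ _ := rfl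
  val_T := R.letterVal_rho
  Normal := F.SepNormal
  normal_nil := ⟨by simp, List.isChain_nil⟩
  normal_T := Frame.sepNormal_rho
  linearIndependent := R.linearIndependent_sepNormal
  span_eq_top := R.span_sepNormal_eq_top

end Realization

end

/-! ### Representations of `L_Q` -/

section

section Blocks

variable {k : Type*} [Field k] {I : Type*} {V : Type*} [AddCommGroup V] [Module k V]

/-- The operator on `V^I` with a single block `T`, from the `j`-th to the `i`-th summand. -/
def blk (i j : I) (T : Module.End k V) : Module.End k (I → V) :=
  inj k V i ∘ₗ T ∘ₗ LinearMap.proj j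

theorem blk_apply (i j : I) (T : Module.End k V) (f : I → V) :
    blk i j T f = inj k V i (T (f j)) := rfl

theorem blk_mul (i j l : I) (T T' : Module.End k V) :
    blk i j T * blk j l T' = blk i l (T * T') := by
  refine LinearMap.ext fun f => ?_
  rw [Module.End.mul_apply, blk_apply, blk_apply, inj_same, blk_apply, Module.End.mul_apply]

theorem blk_mul_ne {i j j' l : I} (h : j ≠ j') (T T' : Module.End k V) :
    blk i j T * blk j' l T' = 0 := by
  refine LinearMap.ext fun f => ?_
  rw [Module.End.mul_apply, blk_apply, blk_apply, inj_ne h, map_zero, map_zero]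
  rfl

theorem blk_add (i j : I) (T T' : Module.End k V) : blk i j (T + T') = blk i j T + blk i j T' :=
  LinearMap.ext fun f => by
    rw [LinearMap.add_apply, blk_apply, blk_apply, blk_apply, LinearMap.add_apply, map_add]

theorem blk_zero (i j : I) : blk i j (0 : Module.End k V) = 0 :=
  LinearMap.ext fun f => by rw [blk_apply, LinearMap.zero_apply, map_zero, LinearMap.zero_apply]

theorem blk_neg (i j : I) (T : Module.End k V) : blk i j (-T) = -blk i j T :=
  LinearMap.ext fun f => by
    rw [LinearMap.neg_apply, blk_apply, blk_apply, LinearMap.neg_apply, map_neg]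

theorem sum_blk [Fintype I] : ∑ i : I, blk i i (1 : Module.End k V) = 1 :=
  LinearMap.ext fun f => by
    rw [LinearMap.sum_apply]
    exact sum_inj (k := k) f

theorem one_add_blk_mul (i : I) (G H : Module.End k V) (h : G * H = 1) :
    (1 + blk i i (G - 1)) * (1 + blk i i (H - 1)) = 1 := by
  rw [add_mul, mul_add, mul_add, one_mul, one_mul, mul_one, blk_mul, add_assoc, ← blk_add,
    ← blk_add]
  have : H - 1 + (G - 1 + (G - 1) * (H - 1)) = 0 := by
    rw [sub_mul, mul_sub, h]; noncomm_ring
  rw [this, blk_zero, add_zero]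

end Blocks

namespace ArrowQuiver

variable {Q₀ Q₁ : Type*} (Q : ArrowQuiver Q₀ Q₁)

theorem dhead_swap (a : Q₁ ⊕ Q₁) : Q.dhead a.swap = Q.dtail a := by
  rcases a with a | a <;> rfl

theorem dtail_swap (a : Q₁ ⊕ Q₁) : Q.dtail a.swap = Q.dhead a := by
  rcases a with a | a <;> rfl

end ArrowQuiver

namespace LAlg

variable (k : Type*) [Field k] {Q₀ Q₁ : Type*} [Fintype Q₀] (Q : ArrowQuiver Q₀ Q₁)

/-- The invertible element `g_a`. -/
def gUnit (a : Q₁ ⊕ Q₁) : (LAlg k Q)ˣ := ⟨g k Q a, gInv k Q a, g_mul_gInv k Q a, gInv_mul_g k Q a⟩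

/-- The invertible element `g_a^{ε(a)}`. -/
def gPowUnit : Q₁ ⊕ Q₁ → (LAlg k Q)ˣ
  | .inl a => gUnit k Q (.inl a)
  | .inr a => (gUnit k Q (.inr a))⁻¹

theorem coe_gPowUnit (a : Q₁ ⊕ Q₁) : (gPowUnit k Q a : LAlg k Q) = gPow k Q a := by
  rcases a with a | a <;> rfl

theorem ofBase_idem (i : Q₀) : ofBase k Q (idem k i) = e k Q i := by
  classical
  rw [ofBase_apply, Finset.sum_eq_single i (fun j _ h => by simp [idem, h]) (by simp)]
  simp [idem]

variable {k Q}

/-- `L_Q` is generated by the idempotents, the arrows and the inverses of the `g_a`. -/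
theorem induction {B : Subalgebra k (LAlg k Q)} (h1 : ∀ i, e k Q i ∈ B) (h2 : ∀ a, x k Q a ∈ B)
    (h3 : ∀ a, gInv k Q a ∈ B) (y : LAlg k Q) : y ∈ B := by
  obtain ⟨z, rfl⟩ := RingQuot.mkAlgHom_surjective k (LRel k Q) y
  change mk k Q z ∈ B
  induction z using FreeAlgebra.induction with
  | grade0 c => rw [AlgHom.commutes]; exact B.algebraMap_mem c
  | grade1 z =>
    cases z with
    | vertex i => exact h1 i
    | arrow a => exact h2 a
    | gInv a => exact h3 a
  | mul a b ha hb => rw [map_mul]; exact mul_mem ha hb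
  | add a b ha hb => rw [map_add]; exact add_mem ha hb

section Lift

variable {V : Type*} [AddCommGroup V] [Module k V] (X : Q₁ ⊕ Q₁ → Module.End k V)
  (G : Q₁ ⊕ Q₁ → (Module.End k V)ˣ) (hG : ∀ a, X a * X a.swap = G a - 1)

include hG in
omit [Fintype Q₀] in
theorem one_add_blk_eq (a : Q₁ ⊕ Q₁) : 1 + blk (Q.dtail a) (Q.dhead a) (X a) *
    blk (Q.dtail a.swap) (Q.dhead a.swap) (X a.swap) =
      1 + blk (Q.dtail a) (Q.dtail a) ((G a : Module.End k V) - 1) := by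
  rw [Q.dtail_swap, Q.dhead_swap, blk_mul, hG]

variable (Q) in
/-- The images of the generators of `L_Q` in the representation given by `X`. -/
def liftGen : LGen Q₀ Q₁ → Module.End k (Q₀ → V)
  | .vertex i => blk i i 1
  | .arrow a => blk (Q.dtail a) (Q.dhead a) (X a)
  | .gInv a => 1 + blk (Q.dtail a) (Q.dtail a) ((↑(G a)⁻¹ : Module.End k V) - 1)

variable (Q) in
/-- The representation of `L_Q` on `V^{Q₀}` in which the arrow `a` acts through the operator `X a`.
-/
def lift : LAlg k Q →ₐ[k] Module.End k (Q₀ → V) :=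
  RingQuot.liftAlgHom k ⟨FreeAlgebra.lift k (liftGen Q X G), by
    intro x y hxy
    induction hxy with
    | idem i => simp only [map_mul, FreeAlgebra.lift_ι_apply, liftGen, blk_mul, mul_one]
    | orth i j h => simp only [map_mul, FreeAlgebra.lift_ι_apply, liftGen, blk_mul_ne h, map_zero]
    | sum_vertex => simp only [map_sum, FreeAlgebra.lift_ι_apply, liftGen, sum_blk, map_one]
    | tail a => simp only [map_mul, FreeAlgebra.lift_ι_apply, liftGen, blk_mul, one_mul]
    | head a => simp only [map_mul, FreeAlgebra.lift_ι_apply, liftGen, blk_mul, mul_one]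
    | mul_gInv a =>
      simp only [map_mul, map_add, map_one, FreeAlgebra.lift_ι_apply, liftGen]
      rw [one_add_blk_eq X G hG]
      exact one_add_blk_mul _ _ _ (Units.mul_inv _)
    | gInv_mul a =>
      simp only [map_mul, map_add, map_one, FreeAlgebra.lift_ι_apply, liftGen]
      rw [one_add_blk_eq X G hG]
      exact one_add_blk_mul _ _ _ (Units.inv_mul _)⟩

theorem lift_e (i : Q₀) : lift Q X G hG (e k Q i) = blk i i 1 :=
  (RingQuot.liftAlgHom_mkAlgHom_apply k _ _ _).trans (FreeAlgebra.lift_ι_apply _ _)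

theorem lift_x (a : Q₁ ⊕ Q₁) : lift Q X G hG (x k Q a) = blk (Q.dtail a) (Q.dhead a) (X a) :=
  (RingQuot.liftAlgHom_mkAlgHom_apply k _ _ _).trans (FreeAlgebra.lift_ι_apply _ _)

theorem lift_gInv (a : Q₁ ⊕ Q₁) : lift Q X G hG (gInv k Q a) =
    1 + blk (Q.dtail a) (Q.dtail a) ((↑(G a)⁻¹ : Module.End k V) - 1) :=
  (RingQuot.liftAlgHom_mkAlgHom_apply k _ _ _).trans (FreeAlgebra.lift_ι_apply _ _)

theorem lift_ofBase (c : Q₀ → k) (f : Q₀ → V) :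
    lift Q X G hG (ofBase k Q c) f = fun i => c i • f i := by
  rw [ofBase_apply, map_sum, LinearMap.sum_apply]
  simp only [map_smul, lift_e, LinearMap.smul_apply, blk_apply, Module.End.one_apply]
  simp only [← map_smul]
  exact sum_inj fun i => c i • f i

end Lift

theorem e_mul_g {i : Q₀} {a : Q₁ ⊕ Q₁} (h : Q.dtail a ≠ i) : e k Q i * g k Q a = e k Q i := by
  rw [g, mul_add, mul_one, ← e_tail_mul k Q a, ← mul_assoc, ← mul_assoc, e_mul_ne k Q h.symm,
    zero_mul, zero_mul, add_zero]

theorem e_mul_gPow {i : Q₀} {a : Q₁ ⊕ Q₁} (h : Q.dtail a ≠ i) :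
    e k Q i * gPow k Q a = e k Q i := by
  rcases a with a | a
  · exact e_mul_g h
  · conv_lhs => rw [← e_mul_g h]
    exact (mul_assoc _ _ _).trans ((congrArg (e k Q i * ·) (g_mul_gInv k Q _)).trans (mul_one _))

/-- At the vertex `i` only the arrows with tail `i` contribute to the product `ρ`. -/
theorem e_mul_prod [DecidableEq Q₀] (i : Q₀) (l : List (Q₁ ⊕ Q₁)) :
    e k Q i * (l.map (gPow k Q)).prod =
    e k Q i * ((l.filter fun a => Q.dtail a = i).map (gPow k Q)).prod := by
  induction l with
  | nil => rfl
  | cons a l ih =>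
    by_cases h : Q.dtail a = i
    · rw [List.filter_cons_of_pos (by simpa using h), List.map_cons, List.map_cons, List.prod_cons,
        List.prod_cons, ← mul_assoc, ← mul_assoc, ← ofBase_idem, (commute_gPow k Q _ a).eq,
        mul_assoc, mul_assoc, ofBase_idem, ih]
    · rw [List.filter_cons_of_neg (by simpa using h), List.map_cons, List.prod_cons, ← mul_assoc,
        e_mul_gPow h, ih]

end LAlg

end

/-! ### Reversal of arrows -/

section

section Twist

variable {Q₁ : Type*} (flip : Q₁ → Prop)

open Classical in
/-- The involution of the arrows of the double quiver that exchanges `a` and `a*` for the arrows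
`a` to be reversed. -/
def twist : Q₁ ⊕ Q₁ → Q₁ ⊕ Q₁
  | .inl e => if flip e then .inr e else .inl e
  | .inr e => if flip e then .inl e else .inr e

variable {flip}

theorem twist_inl {e : Q₁} (h : flip e) : twist flip (.inl e) = .inr e := if_pos h

theorem twist_inr {e : Q₁} (h : flip e) : twist flip (.inr e) = .inl e := if_pos h

theorem twist_inl_of_not {e : Q₁} (h : ¬ flip e) : twist flip (.inl e) = .inl e := if_neg h

theorem twist_inr_of_not {e : Q₁} (h : ¬ flip e) : twist flip (.inr e) = .inr e := if_neg h

theorem twist_swap (a : Q₁ ⊕ Q₁) : twist flip a.swap = (twist flip a).swap := by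
  rcases a with e | e <;> by_cases h : flip e <;> simp [twist, h]

theorem twist_twist (a : Q₁ ⊕ Q₁) : twist flip (twist flip a) = a := by
  rcases a with e | e <;> by_cases h : flip e <;> simp [twist, h]

end Twist

open Classical in
/-- A frame on the vertices and arrows of `Q`, where the arrows satisfying `flip` are reversed,
whose lists of arrows are those given by the order on the arrows of the double quiver. -/
structure QuiverFrame {Q₀ Q₁ : Type*} [Fintype Q₁] [LinearOrder (Q₁ ⊕ Q₁)]
    (Q : ArrowQuiver Q₀ Q₁) extends Frame Q₀ Q₁ where
  flip : Q₁ → Prop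
  te_eq : ∀ e, te e = Q.dtail (twist flip (.inl e))
  he_eq : ∀ e, he e = Q.dhead (twist flip (.inl e))
  map_arrowList : ∀ i, (toFrame.arrowList i).map (twist flip) =
    ((Finset.univ : Finset (Q₁ ⊕ Q₁)).sort (· ≤ ·)).filter fun a => Q.dtail a = i

namespace QuiverFrame

variable {Q₀ Q₁ : Type*} [Fintype Q₀] [Fintype Q₁] [LinearOrder (Q₁ ⊕ Q₁)]
    {Q : ArrowQuiver Q₀ Q₁} (F : QuiverFrame Q) {k : Type*} [Field k] (q : Q₀ → kˣ)

open Classical in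
/-- The operators through which the arrows of the double quiver act, indexed by the arrows after
reversal. -/
def opY : Q₁ ⊕ Q₁ → Module.End k (F.Space k)
  | .inl e => F.opC q e
  | .inr e => if F.flip e then -(F.opS q e * ↑(F.opW q e)⁻¹) else F.opS q e

open Classical in
/-- The invertible operators through which the elements `1 + a a*` act, indexed by the arrows after
reversal. -/
def opH : Q₁ ⊕ Q₁ → (Module.End k (F.Space k))ˣ
  | .inl e => if F.flip e then (F.opW q e)⁻¹ else F.opW q e
  | .inr e => if F.flip e then (F.opV q e)⁻¹ else F.opV q e

omit [Fintype Q₀] in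
open Classical in
theorem opY_mul_swap (b : Q₁ ⊕ Q₁) : F.opY q b * F.opY q b.swap = F.opH q b - 1 := by
  rcases b with e | e
  · rw [Sum.swap_inl, opY, opY, opH]
    split_ifs
    · rw [mul_neg, ← mul_assoc, Frame.opC_mul_opS, sub_mul, Units.mul_inv, one_mul, neg_sub]
    · exact Frame.opC_mul_opS q e
  · rw [Sum.swap_inr, opY, opY, opH]
    split_ifs
    · have h : ((F.opV q e)⁻¹ : (Module.End k (F.Space k))ˣ).1 =
          1 - F.opS q e * ↑(F.opW q e)⁻¹ * F.opC q e := rfl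
      rw [h]
      noncomm_ring
    · rw [Frame.coe_opV, add_sub_cancel_left]

variable {F}

/-- The action of `L_Q` on `V^{Q₀}`. -/
def act (F : QuiverFrame Q) : LAlg k Q →ₐ[k] Module.End k (Q₀ → F.Space k) :=
  LAlg.lift Q (fun a => F.opY q (twist F.flip a)) (fun a => F.opH q (twist F.flip a)) fun a => by
    rw [twist_swap, opY_mul_swap]

variable (k) in
open Classical in
/-- The element `s e` of `L_Q`. For a reversed arrow `a`, the element `c` is `a*`, and the choice
`s = -a (1 + a* a)⁻¹` makes `1 + c s` and `1 + s c` equal to the inverses of `1 + a* a` and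
`1 + a a*`, in accordance with the exponent `ε(a*) = -1` in `ρ`. -/
def sElt (F : QuiverFrame Q) (e : Q₁) : LAlg k Q :=
  if F.flip e then -(LAlg.x k Q (.inl e) * LAlg.gInv k Q (.inr e)) else LAlg.x k Q (.inr e)

omit [Fintype Q₁] [LinearOrder (Q₁ ⊕ Q₁)] in
theorem gInv_eq (a : Q₁ ⊕ Q₁) : LAlg.gInv k Q a =
    1 - LAlg.x k Q a * LAlg.gInv k Q a.swap * LAlg.x k Q a.swap := by
  have h := LAlg.g_mul_gInv k Q a.swap
  rw [LAlg.g, Sum.swap_swap, add_mul, one_mul] at h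
  refine Units.inv_eq_of_mul_eq_one_right (u := LAlg.gUnit k Q a) ?_
  change LAlg.g k Q a * _ = 1
  rw [LAlg.g]
  have h1 : (1 + LAlg.x k Q a * LAlg.x k Q a.swap) *
      (1 - LAlg.x k Q a * LAlg.gInv k Q a.swap * LAlg.x k Q a.swap) =
      1 + LAlg.x k Q a * LAlg.x k Q a.swap - LAlg.x k Q a * (LAlg.gInv k Q a.swap +
        LAlg.x k Q a.swap * LAlg.x k Q a * LAlg.gInv k Q a.swap) * LAlg.x k Q a.swap := by
    noncomm_ring
  rw [h1, h, mul_one, add_sub_cancel_right]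

/-- The algebra `L_Q` with its action on `V^{Q₀}`. -/
def realization (F : QuiverFrame Q) {ρ : (LAlg k Q)ˣ} (hρ : (ρ : LAlg k Q) = LAlg.rho k Q) :
    Realization F.toFrame q (LAlg.ofBase k Q) ρ where
  c e := LAlg.x k Q (twist F.flip (.inl e))
  s e := F.sElt k e
  map_mul_c e y := by rw [LAlg.ofBase_mul_x, F.te_eq]
  c_mul_map e y := by rw [LAlg.x_mul_ofBase, F.he_eq]
  map_mul_s e y := by
    rw [F.he_eq, sElt]
    split_ifs with h
    · rw [mul_neg, ← mul_assoc, LAlg.ofBase_mul_x, twist_inl h, smul_mul_assoc, smul_neg]; rfl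
    · rw [LAlg.ofBase_mul_x, twist_inl_of_not h]; rfl
  s_mul_map e y := by
    rw [F.te_eq, sElt]
    split_ifs with h
    · have h1 : Commute (LAlg.ofBase k Q y) (LAlg.gInv k Q (.inr e)) :=
        LAlg.commute_gPow k Q y (.inr e)
      rw [neg_mul, mul_assoc, ← h1.eq, ← mul_assoc, LAlg.x_mul_ofBase, twist_inl h,
        smul_mul_assoc, smul_neg]; rfl
    · rw [LAlg.x_mul_ofBase, twist_inl_of_not h]; rfl
  arr a := LAlg.gPowUnit k Q (twist F.flip a)
  arr_inl e := by
    rw [sElt]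
    split_ifs with h
    · have h1 := LAlg.g_mul_gInv k Q (.inr e)
      rw [LAlg.g, add_mul, one_mul] at h1
      rw [twist_inl h, mul_neg, ← mul_assoc, ← sub_eq_add_neg]
      exact eq_sub_of_add_eq h1
    · rw [twist_inl_of_not h]; rfl
  arr_inr_inv e := by
    rw [sElt]
    split_ifs with h
    · rw [twist_inl h, twist_inr h, neg_mul, ← sub_eq_add_neg]
      exact gInv_eq (.inl e)
    · rw [twist_inl_of_not h, twist_inr_of_not h]; rfl
  commute_rho y := hρ ▸ LAlg.commute_rho k Q y
  rho_eq i := by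
    classical
    rw [hρ, LAlg.ofBase_idem, LAlg.rho, LAlg.e_mul_prod]
    have h1 : (fun a => LAlg.gPowUnit k Q (twist F.flip a)) =
      LAlg.gPowUnit k Q ∘ twist F.flip := rfl
    have h2 : LAlg.gPow k Q = fun a => (LAlg.gPowUnit k Q a : LAlg k Q) :=
      funext fun a => (LAlg.coe_gPowUnit k Q a).symm
    rw [h1, ← List.map_map, F.map_arrowList, ← Units.coeHom_apply, map_list_prod, List.map_map, h2]
    congr
  mem_of_closed B h1 h2 h3 h4 := by
    have hx : ∀ a, LAlg.x k Q a ∈ B := by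
      intro a
      rw [← twist_twist (flip := F.flip) a]
      rcases twist F.flip a with e | e
      · exact h2 e
      · have h5 := h3 e
        rw [sElt] at h5
        split_ifs at h5 with h
        -- Here `1 + c s` is the inverse of `1 + a* a`, and `a` is recovered from `s` by
        -- multiplication with the latter.
        · have h6 := h2 e
          rw [twist_inl h] at h6
          have h7 : LAlg.g k Q (.inr e) ∈ B := by
            have h8 := h4 ((LAlg.gUnit k Q (.inr e))⁻¹) ?_
            · exact h8
            have h9 := LAlg.g_mul_gInv k Q (.inr e)
            rw [LAlg.g, add_mul, one_mul, mul_assoc] at h9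
            have h10 := add_mem (one_mem B) (mul_mem h6 h5)
            rw [mul_neg, ← sub_eq_add_neg, Sum.swap_inr] at *
            rwa [← eq_sub_of_add_eq h9] at h10
          have h11 := neg_mem (mul_mem h5 h7)
          rwa [neg_mul, neg_neg, mul_assoc, LAlg.gInv_mul_g, mul_one, ← twist_inr h] at h11
        · rwa [twist_inr_of_not h]
    refine LAlg.induction (fun i => ?_) hx fun a => ?_
    · rw [← LAlg.ofBase_idem]; exact h1 _
    · exact h4 (LAlg.gUnit k Q a) (add_mem (one_mem _) (mul_mem (hx _) (hx _)))
  act := F.act q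
  act_map c f := LAlg.lift_ofBase _ _ _ c f
  act_c e f := by
    rw [act, LAlg.lift_x, twist_twist, F.te_eq, F.he_eq]
    rfl
  act_s e f := by
    rw [act, sElt, F.he_eq, F.te_eq]
    split_ifs with h
    · have h1 : F.opY q (.inr e) = -(F.opS q e * ↑(F.opW q e)⁻¹) := if_pos h
      have h2 : (F.opH q (.inl e))⁻¹ = F.opW q e := by rw [opH, if_pos h, inv_inv]
      have h3 : Q.dhead (.inl e) = Q.dtail (.inr e) := rfl
      rw [twist_inl h, map_neg, map_mul, LAlg.lift_x, LAlg.lift_gInv, twist_inr h, twist_inl h, h1,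
        h2, h3, mul_add, mul_one, blk_mul, ← blk_add, ← blk_neg, neg_mul, mul_sub, mul_one,
        mul_assoc, Units.inv_mul, mul_one, neg_sub, neg_add_eq_sub, neg_sub, sub_sub_cancel]
      rfl
    · rw [LAlg.lift_x, twist_inr_of_not h, opY, if_neg h, twist_inl_of_not h]
      rfl

end QuiverFrame

end

/-! ### Connected quivers containing a cycle -/

section

namespace ArrowQuiver

variable {Q₀ Q₁ : Type*} (Q : ArrowQuiver Q₀ Q₁)

/-- The choice, for every vertex `i`, of an arrow `d i` joining `i` to a vertex `nx i`, distinct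
for different vertices, such that following these arrows from any vertex leads into the cycle
`cyc`, on which `prd` is the inverse of `nx`; outside the cycle `rank` increases along `nx`. -/
structure Flow where
  d : Q₀ → Q₁
  nx : Q₀ → Q₀
  d_injective : Function.Injective d
  ends_d : ∀ i, s(Q.tail (d i), Q.head (d i)) = s(i, nx i)
  cyc : Set Q₀
  prd : Q₀ → Q₀
  nx_mem : ∀ i ∈ cyc, nx i ∈ cyc
  prd_mem : ∀ i ∈ cyc, prd i ∈ cyc
  nx_prd : ∀ i ∈ cyc, nx (prd i) = i
  prd_nx : ∀ i ∈ cyc, prd (nx i) = i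
  rank : Q₀ → ℕ
  rank_lt : ∀ i, i ∉ cyc → rank i < rank (nx i)

variable {Q}

/-- A vertex other than `v` is joined by an arrow to a vertex closer to `v`. -/
theorem exists_dist_lt (hQ : Q.Connected) (v i : Q₀) (h : i ≠ v) :
    ∃ (j : Q₀) (a : Q₁), s(Q.tail a, Q.head a) = s(i, j) ∧
      (SimpleGraph.fromRel fun i j : Q₀ => ∃ a : Q₁, Q.tail a = i ∧ Q.head a = j).dist j v <
      (SimpleGraph.fromRel fun i j : Q₀ => ∃ a : Q₁, Q.tail a = i ∧ Q.head a = j).dist i v := by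
  obtain ⟨p, hp⟩ := SimpleGraph.Connected.exists_walk_length_eq_dist hQ i v
  cases p with
  | nil => exact absurd rfl h
  | @cons _ j _ hij p =>
    rw [SimpleGraph.fromRel_adj] at hij
    rw [SimpleGraph.Walk.length_cons] at hp
    have h1 := SimpleGraph.dist_le p
    rcases hij.2 with ⟨a, ha, ha'⟩ | ⟨a, ha, ha'⟩
    · exact ⟨j, a, by rw [ha, ha'], by omega⟩
    · exact ⟨j, a, by rw [ha, ha', Sym2.eq_swap], by omega⟩

/-- On the cycle follow the cycle; from any other vertex follow an arrow decreasing the distance to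
a fixed vertex of the cycle. -/
theorem nonempty_flow [Finite Q₀] (hQ : Q.Connected) (hc : Q.ContainsCycle) : Nonempty Q.Flow := by
  classical
  cases nonempty_fintype Q₀
  obtain ⟨n, v, a, hv, ha, hva⟩ := hc
  choose j b hb hlt using fun i : {i // i ∉ Set.range v} =>
    exists_dist_lt hQ (v 0) i.1 fun h => i.2 ⟨0, h.symm⟩
  set dist := (SimpleGraph.fromRel fun i j : Q₀ => ∃ a : Q₁, Q.tail a = i ∧ Q.head a = j).dist
    with hdist
  let w := Function.invFun v
  have hw : ∀ m, w (v m) = m := Function.leftInverse_invFun hv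
  have hle : ∀ i, dist i (v 0) ≤ Finset.univ.sup fun i => dist i (v 0) := fun i =>
    Finset.le_sup (f := fun i => dist i (v 0)) (Finset.mem_univ i)
  let d : Q₀ → Q₁ := fun i => if h : i ∈ Set.range v then a (w i) else b ⟨i, h⟩
  let nx : Q₀ → Q₀ := fun i => if h : i ∈ Set.range v then v (w i + 1) else j ⟨i, h⟩
  have d1 : ∀ m, d (v m) = a m := fun m => by simp only [d, dif_pos (Set.mem_range_self m), hw]
  have n1 : ∀ m, nx (v m) = v (m + 1) := fun m => by
    simp only [nx, dif_pos (Set.mem_range_self m), hw]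
  have d2 : ∀ i (h : i ∉ Set.range v), d i = b ⟨i, h⟩ := fun i h => dif_neg h
  have n2 : ∀ i (h : i ∉ Set.range v), nx i = j ⟨i, h⟩ := fun i h => dif_neg h
  have hends : ∀ i, s(Q.tail (d i), Q.head (d i)) = s(i, nx i) := by
    intro i
    by_cases h : i ∈ Set.range v
    · obtain ⟨m, rfl⟩ := h
      rw [d1, n1, hva]
    · rw [d2 i h, n2 i h, hb]
  have hlt' : ∀ i, i ∉ Set.range v → dist (nx i) (v 0) < dist i (v 0) := fun i h => by
    rw [n2 i h]; exact hlt ⟨i, h⟩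
  refine ⟨⟨d, nx, fun i i' h => ?_, hends, Set.range v, fun i => v (w i - 1), ?_,
    fun i _ => ⟨_, rfl⟩, ?_, ?_, fun i => (Finset.univ.sup fun i => dist i (v 0)) - dist i (v 0),
    fun i h => ?_⟩⟩
  -- If `d i = d i'` for `i ≠ i'`, then `nx` exchanges `i` and `i'`. Both then lie on the cycle,
  -- where the arrows are distinct, or both distances decrease.
  · by_contra hne
    have h1 : s(i, nx i) = s(i', nx i') := by rw [← hends, ← hends, h]
    rw [Sym2.eq_iff] at h1
    obtain ⟨h1, h2⟩ | ⟨h1, h2⟩ := h1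
    · exact hne h1
    by_cases hi : i ∈ Set.range v
    · by_cases hi' : i' ∈ Set.range v
      · obtain ⟨m, rfl⟩ := hi
        obtain ⟨m', rfl⟩ := hi'
        rw [d1, d1] at h
        exact hne (congrArg v (ha h))
      · obtain ⟨m, rfl⟩ := hi
        rw [n1] at h2
        exact hi' ⟨_, h2⟩
    · by_cases hi' : i' ∈ Set.range v
      · obtain ⟨m, rfl⟩ := hi'
        rw [n1] at h1
        exact hi ⟨_, h1.symm⟩
      · have h3 := hlt' i hi
        have h4 := hlt' i' hi'
        rw [h2] at h3
        rw [← h1] at h4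
        omega
  · rintro _ ⟨m, rfl⟩
    exact ⟨m + 1, (n1 m).symm⟩
  · rintro _ ⟨m, rfl⟩
    simp only [n1, hw, sub_add_cancel]
  · rintro _ ⟨m, rfl⟩
    simp only [n1, hw, add_sub_cancel_right]
  · have h1 := hlt' i h
    have h2 := hle i
    have h3 := hle (nx i)
    change _ - _ < _ - _
    omega

namespace Flow

variable (Φ : Q.Flow)

/-- The arrows to be reversed so that `d i` leaves `i`. -/
def flip (e : Q₁) : Prop := ∃ i, Φ.d i = e ∧ Q.tail e ≠ i

/-- The tail of an arrow after reversal. -/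
def te (e : Q₁) : Q₀ := Q.dtail (twist Φ.flip (.inl e))

/-- The head of an arrow after reversal. -/
def he (e : Q₁) : Q₀ := Q.dhead (twist Φ.flip (.inl e))

theorem te_he_d (i : Q₀) : Φ.te (Φ.d i) = i ∧ Φ.he (Φ.d i) = Φ.nx i := by
  have h := Φ.ends_d i
  rw [Sym2.eq_iff] at h
  rw [te, he]
  by_cases hf : Q.tail (Φ.d i) = i
  · have h1 : ¬ Φ.flip (Φ.d i) := by
      rintro ⟨j, hj, hj'⟩
      rw [Φ.d_injective hj] at hj'
      exact hj' hf
    rw [twist_inl_of_not h1]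
    refine ⟨hf, ?_⟩
    rcases h with h | h
    · exact h.2
    · exact h.2.trans (hf.symm.trans h.1)
  · rw [twist_inl ⟨i, rfl, hf⟩]
    rcases h with h | h
    · exact absurd h.1 hf
    · exact ⟨h.2, h.1⟩

variable [Fintype Q₁] [LinearOrder (Q₁ ⊕ Q₁)]

open Classical in
/-- The arrows of the double quiver with tail `i`, after reversal. -/
def arrows (i : Q₀) : List (Q₁ ⊕ Q₁) :=
  (((Finset.univ : Finset (Q₁ ⊕ Q₁)).sort (· ≤ ·)).filter fun a => Q.dtail a = i).map
    (twist Φ.flip)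

theorem mem_arrows {i : Q₀} {b : Q₁ ⊕ Q₁} :
    b ∈ Φ.arrows i ↔ Q.dtail (twist Φ.flip b) = i := by
  simp only [arrows, List.mem_map, List.mem_filter, Finset.mem_sort, Finset.mem_univ, true_and,
    decide_eq_true_eq]
  constructor
  · rintro ⟨a, ha, rfl⟩
    rwa [twist_twist]
  · exact fun h => ⟨_, h, twist_twist b⟩

theorem inl_mem_arrows {i : Q₀} {e : Q₁} : Sum.inl e ∈ Φ.arrows i ↔ Φ.te e = i := Φ.mem_arrows

theorem inr_mem_arrows {i : Q₀} {e : Q₁} : Sum.inr e ∈ Φ.arrows i ↔ Φ.he e = i := by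
  rw [mem_arrows, he, ← Q.dtail_swap, ← twist_swap]
  rfl

theorem nodup_arrows (i : Q₀) : (Φ.arrows i).Nodup :=
  ((Finset.sort_nodup _ _).filter _).map
    (Function.LeftInverse.injective (g := twist Φ.flip) twist_twist)

end Flow

theorem _root_.List.Nodup.exists_cut {α : Type*} {l : List α} (h : l.Nodup) {x : α} (hx : x ∈ l) :
    ∃ l₁ l₃, l = l₁ ++ x :: l₃ ∧ ∀ b ∈ l₁ ++ l₃, b ∈ l ∧ b ≠ x := by
  obtain ⟨l₁, l₃, rfl⟩ := List.append_of_mem hx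
  refine ⟨l₁, l₃, rfl, fun b hb => ?_⟩
  rw [List.nodup_middle, List.nodup_cons] at h
  refine ⟨?_, fun hbx => h.1 (hbx ▸ hb)⟩
  simp only [List.mem_append, List.mem_cons] at hb ⊢
  tauto

/-- The proposition `p` records which of the two elements comes first. -/
theorem _root_.List.Nodup.exists_cut_cut {α : Type*} {l : List α} (h : l.Nodup) {x y : α}
    (hx : x ∈ l) (hy : y ∈ l) (hxy : y ≠ x) : ∃ (p : Prop) (l₁ l₂ l₃ : List α),
      (p → l = l₁ ++ y :: (l₂ ++ x :: l₃)) ∧ (¬ p → l = l₁ ++ x :: (l₂ ++ y :: l₃)) ∧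
        ∀ b ∈ l₁ ++ l₂ ++ l₃, b ∈ l ∧ b ≠ x ∧ b ≠ y := by
  obtain ⟨l₁, l₃, rfl⟩ := List.append_of_mem hx
  have hy' : y ∈ l₁ ++ l₃ := by
    simp only [List.mem_append, List.mem_cons] at hy ⊢
    tauto
  have hx' := (List.nodup_cons.1 (List.nodup_middle.1 h)).1
  rcases List.mem_append.1 hy' with hy' | hy'
  · obtain ⟨m₁, m₂, rfl⟩ := List.append_of_mem hy'
    refine ⟨True, m₁, m₂, l₃, fun _ => by simp, fun h => absurd trivial h, fun b hb => ?_⟩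
    rw [List.append_assoc, List.cons_append] at h
    have h1 := (List.nodup_cons.1 (List.nodup_middle.1 h)).1
    grind
  · obtain ⟨m₁, m₂, rfl⟩ := List.append_of_mem hy'
    refine ⟨False, l₁, m₁, m₂, fun h => h.elim, fun _ => rfl, fun b hb => ?_⟩
    rw [← List.cons_append, ← List.append_assoc] at h
    have h1 := (List.nodup_cons.1 (List.nodup_middle.1 h)).1
    grind

/-- A flow defines a frame: reverse the arrows so that `d i` leaves `i`, and cut the list of the
arrows with tail `i` at the distinguished ones. -/
theorem Flow.nonempty_quiverFrame [Fintype Q₁] [LinearOrder (Q₁ ⊕ Q₁)] (Φ : Q.Flow) :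
    Nonempty (QuiverFrame Q) := by
  classical
  have key : ∀ i, ∃ (p : Prop) (l₁ l₂ l₃ : List (Q₁ ⊕ Q₁)),
      (i ∉ Φ.cyc → Φ.arrows i = l₁ ++ .inl (Φ.d i) :: l₃) ∧
      (i ∈ Φ.cyc → p →
        Φ.arrows i = l₁ ++ .inr (Φ.d (Φ.prd i)) :: (l₂ ++ .inl (Φ.d i) :: l₃)) ∧
      (i ∈ Φ.cyc → ¬ p →
        Φ.arrows i = l₁ ++ .inl (Φ.d i) :: (l₂ ++ .inr (Φ.d (Φ.prd i)) :: l₃)) ∧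
      ∀ b ∈ l₁ ++ l₂ ++ l₃, b ∈ Φ.arrows i ∧ b ≠ .inl (Φ.d i) ∧
        (i ∈ Φ.cyc → b ≠ .inr (Φ.d (Φ.prd i))) := by
    intro i
    have hx : Sum.inl (Φ.d i) ∈ Φ.arrows i := Φ.inl_mem_arrows.2 (Φ.te_he_d i).1
    by_cases hi : i ∈ Φ.cyc
    · have hy : Sum.inr (Φ.d (Φ.prd i)) ∈ Φ.arrows i := Φ.inr_mem_arrows.2 (by
        rw [(Φ.te_he_d _).2, Φ.nx_prd i hi])
      obtain ⟨p, l₁, l₂, l₃, h1, h2, h3⟩ := (Φ.nodup_arrows i).exists_cut_cut hx hy (by simp)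
      exact ⟨p, l₁, l₂, l₃, fun h => absurd hi h, fun _ => h1, fun _ => h2,
        fun b hb => ⟨(h3 b hb).1, (h3 b hb).2.1, fun _ => (h3 b hb).2.2⟩⟩
    · obtain ⟨l₁, l₃, h1, h2⟩ := (Φ.nodup_arrows i).exists_cut hx
      exact ⟨True, l₁, [], l₃, fun _ => h1, fun h => absurd h hi, fun h => absurd h hi,
        fun b hb => ⟨(h2 b (by simpa using hb)).1, (h2 b (by simpa using hb)).2,
          fun h => absurd h hi⟩⟩
  choose p l₁ l₂ l₃ h1 h2 h3 h4 using key
  let F : Frame Q₀ Q₁ :=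
    { te := Φ.te
      he := Φ.he
      d := Φ.d
      te_d := fun i => (Φ.te_he_d i).1
      cyc := Φ.cyc
      prd := Φ.prd
      he_d_mem := fun i hi => by rw [(Φ.te_he_d i).2]; exact Φ.nx_mem i hi
      prd_mem := Φ.prd_mem
      he_d_prd := fun i hi => by rw [(Φ.te_he_d _).2, Φ.nx_prd i hi]
      prd_he_d := fun i hi => by rw [(Φ.te_he_d _).2, Φ.prd_nx i hi]
      rank := Φ.rank
      rank_lt := fun i hi => by rw [(Φ.te_he_d i).2]; exact Φ.rank_lt i hi
      negFirst := p
      L₁ := l₁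
      L₂ := l₂
      L₃ := l₃
      pos_mem := fun i e he => by
        obtain ⟨h5, h6, -⟩ := h4 i _ he
        have h7 := Φ.inl_mem_arrows.1 h5
        exact ⟨h7, fun h => h6 (by rw [← h7, h])⟩
      neg_mem := fun i e he => by
        obtain ⟨h5, -, h6⟩ := h4 i _ he
        have h7 := Φ.inr_mem_arrows.1 h5
        refine ⟨h7, fun h hc => ?_⟩
        have h8 : Φ.nx (Φ.te e) = i := by rw [← (Φ.te_he_d _).2, h, h7]
        have h9 : i ∈ Φ.cyc := h8 ▸ Φ.nx_mem _ hc
        exact h6 h9 (by rw [← h8, Φ.prd_nx _ hc, h]) }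
  have hF : ∀ i, F.arrowList i = Φ.arrows i := fun i => by
    rw [Frame.arrowList]
    split_ifs with h5 h6
    · exact (h2 i h5 h6).symm
    · exact (h3 i h5 h6).symm
    · exact (h1 i h5).symm
  exact ⟨{ toFrame := F
           flip := Φ.flip
           te_eq := fun e => rfl
           he_eq := fun e => rfl
           map_arrowList := fun i => by
            rw [hF, Flow.arrows, List.map_map]
            refine (List.map_congr_left fun a _ => ?_).trans (List.map_id _)
            exact twist_twist a }⟩

end ArrowQuiver

end

end MPA

end

theorem mainTheorem3 {k : Type*} [Field k] {Q₀ Q₁ : Type*} [Fintype Q₀] [Fintype Q₁]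
    [LinearOrder (Q₁ ⊕ Q₁)] (Q : MPA.ArrowQuiver Q₀ Q₁) (q : Q₀ → kˣ) :
    (Q.Connected → Q.ContainsCycle → MPA.MPAStrongFreeProduct Q q) ∧
    (MPA.MPAStrongFreeProduct Q q →
      (∀ n : ℤ, n ≠ 0 → (MPA.dgMPA Q q).cohomology.grading n = ⊥) ∧
      (MPA.dgMPA Q q).cohomology.grading 0 = ⊤ ∧
      (∃ φ : (MPA.dgMPA Q q).cohomology.carrier ≃ₐ[k] MPA.MPAlg Q q,
        ∀ x : MPA.LAlg k Q, φ (MPA.classMap Q q x) = MPA.QuotBy.mk k (MPA.mpaRel Q q) x) ∧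
      (MPA.dgMPA Q q).Formal) := by
  refine ⟨fun hQ hc => ?_, fun ⟨σ, hσ, h⟩ => ?_⟩
  · obtain ⟨Φ⟩ := MPA.ArrowQuiver.nonempty_flow hQ hc
    obtain ⟨F⟩ := Φ.nonempty_quiverFrame
    obtain ⟨ρ, hρ⟩ := MPA.LAlg.isUnit_rho k Q
    refine (F.realization q hρ).wordBasis.strongFreeProductProperty (MPA.mpaRel Q q) ?_
      (MPA.commute_mpaRel Q q) (MPA.isUnit_q_add_mpaRel Q q)
    rw [hρ, MPA.mpaRel]
    exact (add_sub_cancel _ _).symm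
  · exact MPA.StrongFreeProductProperty.homology
      (MulEquiv.piUnits.symm q).isUnit hσ h
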